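/- **Setting.** Fix integers $k\ge 1$ and $L\ge 1$, a probability vector $p=(p_1,\dots,p_k)$ and points $\mu_1,\dots,\mu_k\in\mathbb R^{k-1}$ with $\sum_a p_a\mu_a=0$ and $\sum_a p_a\mu_a\mu_a^T=I$. Let $(X_i,Y_i)$, $i\ge1$, be i.i.d., where $X_i=\mu_a$ with probability $p_a$ and $Y_i$ is a covariate with values in an arbitrary measurable space. For a symmetric positive semidefinite $(k-1)\times(k-1)$ matrix $S$ let $\tilde Y_i=S^{1/2}X_i+N_i$, where the $N_i\sim\mathcal N(0,I_{k-1})$ are i.i.d. and independent of everything else. Given the labels $\boldsymbol X=(X_1,\dots,X_n)$, let $\boldsymbol G=(\boldsymbol G_1,\dots,\boldsymbol G_L)$ be $L$ random graphs on $n$ nodes that are conditionally independent of each other and of the covariates, with conditionally independent edges $$G^\ell_{ij}\sim\mathrm{Ber}\Big(\frac{d_\ell}{n}+\frac{\sqrt{d_\ell(1-d_\ell/n)}}{n}\,X_i^TR_\ell X_j\Big),\qquad i<j,$$ where each $R_\ell$ is a fixed real symmetric matrix that is either positive definite or negative definite, and $d_\ell=d_\ell(n)$ satisfies $d_\ell\to\infty$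 and $n-d_\ell\to\infty$ as $n\to\infty$ (so that these are probabilities for all large $n$; for the remaining $n$ they are truncated to $[0,1]$). Put $\boldsymbol Y=(Y_1,\dots,Y_n)$, $\tilde{\boldsymbol Y}=(\tilde Y_1,\dots,\tilde Y_n)$, $$\mathcal I(S)=I(X_1;Y_1,\tilde Y_1),\qquad \mathrm{MMSE}_n(S)=\frac1n\sum_{i=1}^n\mathbb E\big[\mathrm{Cov}(X_i\mid \boldsymbol Y,\tilde{\boldsymbol Y},\boldsymbol G)\big],$$ and, for $U$ in the set $\mathcal U$ of symmetric matrices with $0\preceq U\preceq I$, $$\mathcal F_S(U)=\mathcal I\Big(S+\sum_{\ell=1}^L R_\ell(I-U)R_\ell\Big)+\frac14\sum_{\ell=1}^L\mathrm{tr}\big((R_\ell U)^2\big).$$ **Theorem 2.** Suppose that the upper bound $\limsup_n \frac1n I(\boldsymbol X;\boldsymbol Y,\tilde{\boldsymbol Y},\boldsymbol G)\le\min_{U\in\mathcal U}\mathcal F_S(U)$ is asymptotically tight at $S=0$, that is, $$\lim_{n\to\infty}\frac1n I(\boldsymbol X;\boldsymbol Y,\boldsymbol G)=\min_{U\in\mathcal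 U}\mathcal F_0(U).$$ Then for every positive definite $S$ and every minimizer $U^*$ of $\mathcal F_0$ over $\mathcal U$ there is a sequence of symmetric matrices $E_n\to0$ such that $$\mathrm{MMSE}_n(S)\preceq U^*+E_n\qquad\text{for all } n .$$ -/

import Mathlib

open MeasureTheory ProbabilityTheory Filter Topology
open scoped ENNReal Matrix

noncomputable section

namespace CommunityDetection

/-! ### Generic information-theoretic quantities -/

/-- Joint law of a pair `(i, ω)`, where `i` is drawn with weights `w` from a finite type and
`ω` is drawn from `κ i` given `i`. -/
def mixture {ι Ω : Type*} [Fintype ι] [MeasurableSpace ι] [MeasurableSpace Ω]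
    (w : ι → ℝ≥0∞) (κ : ι → Measure Ω) : Measure (ι × Ω) :=
  ∑ i, w i • (κ i).map (Prod.mk i)

/-- Mutual information `I(U; V)` (in nats): the Kullback-Leibler divergence of the joint law from
the product of the marginal laws. -/
def mutualInfo {Ω α β : Type*} [MeasurableSpace Ω] [MeasurableSpace α] [MeasurableSpace β]
    (P : Measure Ω) (U : Ω → α) (V : Ω → β) : ℝ :=
  (InformationTheory.klDiv (P.map fun ω => (U ω, V ω)) ((P.map U).prod (P.map V))).toReal

/-- The conditional covariance `Cov(U, V | m)` of two real random variables given the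
sub-σ-algebra `m`. -/
def condCov {Ω : Type*} (m : MeasurableSpace Ω) {_m₀ : MeasurableSpace Ω} (P : Measure Ω)
    (U V : Ω → ℝ) : Ω → ℝ :=
  P[(U - P[U | m]) * (V - P[V | m]) | m]

/-- The matrix `𝔼[Cov(X | O)]` for a random vector `X` and an observation `O`. -/
def expCondCov {Ω β : Type*} [MeasurableSpace Ω] [mβ : MeasurableSpace β] {m : ℕ}
    (P : Measure Ω) (X : Ω → Fin m → ℝ) (O : Ω → β) : Matrix (Fin m) (Fin m) ℝ :=
  Matrix.of fun a b =>
    ∫ ω, condCov (MeasurableSpace.comap O mβ) P (fun ω => X ω a) (fun ω => X ω b) ω ∂P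

/-! ### Labels and covariates -/

/-- The law of one pair `(X₁, Y₁)`: the label takes the value `emb a` with probability `p a`,
for `a` in a set of `k` labels, where the `k` points `emb a` of `ℝ^(k-1)` are centred and
whitened, and `cov a` is the conditional law of the covariate `Y₁` when the label is `a`.
As the label takes finitely many values, every joint law of `(X₁, Y₁)` is of this form. -/
structure LabelModel (k : ℕ) (𝒴 : Type*) [MeasurableSpace 𝒴] where
  p : PMF (Fin k)
  emb : Fin k → Fin (k - 1) → ℝ
  centered : ∑ a, (p a).toReal • emb a = 0
  whitened : ∑ a, (p a).toReal • Matrix.vecMulVec (emb a) (emb a) = 1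
  cov : Fin k → Measure 𝒴
  isProb : ∀ a, IsProbabilityMeasure (cov a)

namespace LabelModel

variable {k : ℕ} {𝒴 : Type*} [MeasurableSpace 𝒴] (M : LabelModel k 𝒴)

open scoped MatrixOrder in
/-- Conditional law of `Ỹ₁ = S^{1/2} X₁ + N₁`, `N₁ ∼ N(0, I)`, given the label `a`; here
`CFC.sqrt S` is the positive semidefinite square root of `S`. -/
def gaussLaw (S : Matrix (Fin (k - 1)) (Fin (k - 1)) ℝ) (a : Fin k) :
    Measure (Fin (k - 1) → ℝ) :=
  (Measure.pi fun _ : Fin (k - 1) => gaussianReal 0 1).map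
    fun z => CFC.sqrt S *ᵥ M.emb a + z

/-- Joint law of `(label of node 1, (Y₁, Ỹ₁))`. -/
def nodeLaw (S : Matrix (Fin (k - 1)) (Fin (k - 1)) ℝ) :
    Measure (Fin k × (𝒴 × (Fin (k - 1) → ℝ))) :=
  mixture (fun a => M.p a) fun a => (M.cov a).prod (M.gaussLaw S a)

/-- The information function `𝓘(S) = I(X₁; Y₁, Ỹ₁)`. -/
def info (S : Matrix (Fin (k - 1)) (Fin (k - 1)) ℝ) : ℝ :=
  mutualInfo (M.nodeLaw S) (fun ω => M.emb ω.1) (fun ω => ω.2)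

end LabelModel

/-! ### Networks -/

/-- Pairs `i < j` of nodes. -/
abbrev NodePair (n : ℕ) : Type := {e : Fin n × Fin n // e.1 < e.2}

/-- A network on `n` nodes: its symmetric binary adjacency matrix with zero diagonal, given by
the entries above the diagonal. -/
abbrev Network (n : ℕ) : Type := NodePair n → Bool

/-- The observations on `n` nodes: the covariates `Y` and `Ỹ`, and `L` networks. -/
abbrev Observation (𝒴 : Type*) (k L n : ℕ) : Type _ :=
  (Fin n → 𝒴) × (Fin n → Fin (k - 1) → ℝ) × (Fin L → Network n)

namespace LabelModel

variable {k L : ℕ} {𝒴 : Type*} [MeasurableSpace 𝒴] (M : LabelModel k 𝒴)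

/-- Probability of an edge between nodes with labels `a`, `b` in a degree-balanced stochastic
block model with parameters `(d, R)` on `n` nodes. -/
def edgeProb (n : ℕ) (d : ℝ) (R : Matrix (Fin (k - 1)) (Fin (k - 1)) ℝ) (a b : Fin k) : ℝ :=
  d / n + √(d * (1 - d / n)) / n * (M.emb a ⬝ᵥ R *ᵥ M.emb b)

/-- Law of a network given the labels `x`: independent Bernoulli edges. The projection to `[0, 1]`
changes nothing when `edgeProb` is a probability, hence nothing for large `n` if `d` and `n - d`
diverge; it only gives the small values of `n` a meaning. -/
def networkLaw (n : ℕ) (d : ℝ) (R : Matrix (Fin (k - 1)) (Fin (k - 1)) ℝ) (x : Fin n → Fin k) :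
    Measure (Network n) :=
  Measure.pi fun e : NodePair n =>
    bernoulliMeasure true false
      (Set.projIcc (0 : ℝ) 1 zero_le_one (M.edgeProb n d R (x e.1.1) (x e.1.2)))

/-- Law of the observations given the labels `x` of the `n` nodes: the covariates of the nodes and
the networks are conditionally independent. -/
def obsLaw (d : Fin L → ℕ → ℝ) (R : Fin L → Matrix (Fin (k - 1)) (Fin (k - 1)) ℝ) (n : ℕ)
    (S : Matrix (Fin (k - 1)) (Fin (k - 1)) ℝ) (x : Fin n → Fin k) :
    Measure (Observation 𝒴 k L n) :=
  (Measure.pi fun i => M.cov (x i)).prod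
    ((Measure.pi fun i => M.gaussLaw S (x i)).prod
      (Measure.pi fun ℓ => M.networkLaw n (d ℓ n) (R ℓ) x))

/-- Joint law of the labels of the `n` nodes, which are i.i.d. with law `p`, and the
observations. -/
def jointLaw (d : Fin L → ℕ → ℝ) (R : Fin L → Matrix (Fin (k - 1)) (Fin (k - 1)) ℝ) (n : ℕ)
    (S : Matrix (Fin (k - 1)) (Fin (k - 1)) ℝ) :
    Measure ((Fin n → Fin k) × Observation 𝒴 k L n) :=
  mixture (fun x => ∏ i, M.p (x i)) (M.obsLaw d R n S)

/-- `I(X; Y, G)`, where `X` is the matrix with rows `X_i`; the covariate `Ỹ` is not observed. -/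
def networkInfo (d : Fin L → ℕ → ℝ) (R : Fin L → Matrix (Fin (k - 1)) (Fin (k - 1)) ℝ)
    (n : ℕ) : ℝ :=
  mutualInfo (M.jointLaw d R n 0) (fun ω i => M.emb (ω.1 i)) (fun ω => (ω.2.1, ω.2.2.2))

/-- The matrix `MMSE(X | Y, Ỹ, G) = (1/n) ∑ᵢ 𝔼[Cov(X_i | Y, Ỹ, G)]`. -/
def mmse (d : Fin L → ℕ → ℝ) (R : Fin L → Matrix (Fin (k - 1)) (Fin (k - 1)) ℝ) (n : ℕ)
    (S : Matrix (Fin (k - 1)) (Fin (k - 1)) ℝ) : Matrix (Fin (k - 1)) (Fin (k - 1)) ℝ :=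
  (1 / n : ℝ) • ∑ i : Fin n,
    expCondCov (M.jointLaw d R n S) (fun ω => M.emb (ω.1 i)) (fun ω => ω.2)

/-- The potential function
`F(U) = 𝓘(S + ∑ₗ Rₗ (I - U) Rₗ) + (1/4) ∑ₗ tr((Rₗ U)²)` at side-information level `S`. -/
def potential (R : Fin L → Matrix (Fin (k - 1)) (Fin (k - 1)) ℝ)
    (S U : Matrix (Fin (k - 1)) (Fin (k - 1)) ℝ) : ℝ :=
  M.info (S + ∑ ℓ, R ℓ * (1 - U) * R ℓ) + 1 / 4 * ∑ ℓ, ((R ℓ * U) ^ 2).trace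

end LabelModel

/-- The set `𝒰` of symmetric matrices `U` with `0 ⪯ U ⪯ I`. -/
def loewnerInterval (m : ℕ) : Set (Matrix (Fin m) (Fin m) ℝ) :=
  {U | U.PosSemidef ∧ (1 - U).PosSemidef}

end CommunityDetection

end

set_option linter.unusedSectionVars false

noncomputable section

namespace CommunityDetection

/-! Weak Gaussian side information serves as a probe. Write H(T) for the entropy of all labels given
covariates, networks and Gaussian side information at level T, write h(T) for the entropy of one
label given its covariate and such side information, and put Δ = ∑ R(1 - U*)R and q = ¼ ∑
tr((RU*)²). Take T = ε vvᵀ ⪯ S. The probe gains at least half the signal variance that remains after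
it, and further side information only decreases this variance. Hence H(0) - H(T) ≥ n(ε/2) vᵀ MMSE(S)
v (`mmse_le_base_ent_sub`). Conversely, tightness says H(0) = n(h(Δ) - q + o(1)), while H(T) ≥ n(h(Δ
+ T) - q - o(1)) with an error uniform in T (`exists_le_base_gauss_ent`). Moreover h(Δ + T) ≥ h(Δ) -
½ tr(postCov(Δ) T) (`sub_le_nodeEnt_add_smul`), and postCov(Δ) = U* because U* is stationary
(`postCov_eq_of_isMinOn`). So the gain is at most n(ε/2 vᵀU*v + o(1)). None of these inequalities
needs ε to be small: if S ⪰ c·1, the choice ε = c/|v|² gives vᵀ MMSE(S) v ≤ vᵀU*v + o(1)|v|²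
uniformly in v.

The bound on H(T) has two parts. A Bernoulli edge is at most as informative as a Gaussian
observation with the same signal-to-noise ratio 1/n, up to o(1/n) (`exists_edge_comparison`). The
edges number O(n²) and are exchanged one at a time (`gauss_le_bernPow`), for a total error o(n). The
Gaussian edges are then interpolated to side information at level Δ about each node
(`gauss_ent_interpolation`). Along the path the entropy is controlled by the difference of the two
Gram matrices. Up to constants, this difference is tr(R(A - nW)R(A - nW)ᵀ)/(2n), where A is the
overlap of two label configurations and W = 1 - U. It is nonnegative because R is definite
(`overlap_bound`).

Stationarity also rests on definiteness. Along H = postCov(Δ) - U* the potential has slope -½ ∑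
tr(RHRHᵀ), which is negative unless H = 0.

Posteriors are kept as unnormalized weights and functionals of them are positively homogeneous, so
that conditionally independent observations compose and commute by Fubini. The relation between
mutual information and MMSE is used without derivatives: `gaussLik_ent_bounds` gives two-sided
bounds for a weak observation, which are summed over N small steps. -/

/-! ### Bayesian updates of unnormalized posteriors -/

section Bayes

variable {X Ω Ω' : Type*} [MeasurableSpace Ω] [MeasurableSpace Ω']

/-- A family of probability densities with respect to `μ`, indexed by the parameter. -/
structure IsLik (μ : Measure Ω) (l : X → Ω → ℝ) : Prop where
  measurable : ∀ x, Measurable (l x)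
  nonneg : ∀ x ω, 0 ≤ l x ω
  integrable : ∀ x, Integrable (l x) μ
  integral_eq_one : ∀ x, ∫ ω, l x ω ∂μ = 1

/-- The expected value of `Φ` at the unnormalized posterior, after observing a sample from the
experiment with densities `l`, when the unnormalized prior is `u`. -/
def bayes (μ : Measure Ω) (l : X → Ω → ℝ) (Φ : (X → ℝ) → ℝ) (u : X → ℝ) : ℝ :=
  ∫ ω, Φ (fun x => u x * l x ω) ∂μ

variable [Fintype X]

/-- Measurable functionals that grow at most linearly on the nonnegative orthant. -/
structure LinearGrowth (Φ : (X → ℝ) → ℝ) : Prop where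
  measurable : Measurable Φ
  bound : ∃ C, ∀ u : X → ℝ, 0 ≤ u → |Φ u| ≤ C * ∑ x, u x

lemma LinearGrowth.linear (a : X → ℝ) : LinearGrowth fun u : X → ℝ => ∑ x, u x * a x := by
  refine ⟨by fun_prop, ∑ x, |a x|, fun u hu => ?_⟩
  calc |∑ x, u x * a x| ≤ ∑ x, |u x * a x| := Finset.abs_sum_le_sum_abs _ _
    _ ≤ ∑ x, u x * ∑ y, |a y| := by
        refine Finset.sum_le_sum fun x _ => ?_
        rw [abs_mul, abs_of_nonneg (hu x)]
        exact mul_le_mul_of_nonneg_left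
          (Finset.single_le_sum (f := fun y => |a y|) (fun y _ => abs_nonneg _) (Finset.mem_univ x))
          (hu x)
    _ = _ := by rw [← Finset.sum_mul, mul_comm]

lemma LinearGrowth.add {Φ Ψ : (X → ℝ) → ℝ} (hΦ : LinearGrowth Φ) (hΨ : LinearGrowth Ψ) :
    LinearGrowth fun u => Φ u + Ψ u := by
  obtain ⟨C, hC⟩ := hΦ.bound
  obtain ⟨D, hD⟩ := hΨ.bound
  refine ⟨hΦ.measurable.add hΨ.measurable, C + D, fun u hu => ?_⟩
  rw [add_mul]
  exact (abs_add_le _ _).trans (add_le_add (hC u hu) (hD u hu))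

lemma LinearGrowth.const_mul {Φ : (X → ℝ) → ℝ} (hΦ : LinearGrowth Φ) (c : ℝ) :
    LinearGrowth fun u => c * Φ u := by
  obtain ⟨C, hC⟩ := hΦ.bound
  refine ⟨hΦ.measurable.const_mul c, |c| * C, fun u hu => ?_⟩
  rw [abs_mul, mul_assoc]
  exact mul_le_mul_of_nonneg_left (hC u hu) (abs_nonneg c)

lemma LinearGrowth.sub {Φ Ψ : (X → ℝ) → ℝ} (hΦ : LinearGrowth Φ) (hΨ : LinearGrowth Ψ) :
    LinearGrowth fun u => Φ u - Ψ u := by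
  simpa [sub_eq_add_neg] using hΦ.add (hΨ.const_mul (-1))

lemma LinearGrowth.sum {ι : Type*} (s : Finset ι) {Φ : ι → (X → ℝ) → ℝ}
    (hΦ : ∀ i ∈ s, LinearGrowth (Φ i)) : LinearGrowth fun u => ∑ i ∈ s, Φ i u := by
  classical
  induction s using Finset.induction_on with
  | empty => simpa using LinearGrowth.linear (0 : X → ℝ)
  | insert i s hi ih =>
    simp only [Finset.sum_insert hi]
    exact (hΦ i (by simp)).add (ih fun j hj => hΦ j (by simp [hj]))

lemma LinearGrowth.mass : LinearGrowth fun u : X → ℝ => ∑ x, u x := by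
  simpa using LinearGrowth.linear (1 : X → ℝ)

variable {μ : Measure Ω} {l : X → Ω → ℝ} {ν : Measure Ω'} {l' : X → Ω' → ℝ}
  {Φ Ψ : (X → ℝ) → ℝ} {u : X → ℝ}

lemma IsLik.mul_nonneg (hl : IsLik μ l) (hu : 0 ≤ u) (ω : Ω) : 0 ≤ fun x => u x * l x ω :=
  fun x => _root_.mul_nonneg (hu x) (hl.nonneg x ω)

lemma LinearGrowth.integrable (hΦ : LinearGrowth Φ) (hl : IsLik μ l) (hu : 0 ≤ u) :
    Integrable (fun ω => Φ fun x => u x * l x ω) μ := by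
  obtain ⟨C, hC⟩ := hΦ.bound
  have h : Integrable (fun ω => C * ∑ x, u x * l x ω) μ :=
    (integrable_finsetSum _ fun x _ => (hl.integrable x).const_mul (u x)).const_mul C
  refine h.mono' (hΦ.measurable.comp (measurable_pi_lambda _ fun x =>
    (hl.measurable x).const_mul _)).aestronglyMeasurable (Eventually.of_forall fun ω => ?_)
  exact hC _ (hl.mul_nonneg hu ω)

lemma bayes_linear (hl : IsLik μ l) (a : X → ℝ) (u : X → ℝ) :
    bayes μ l (fun u => ∑ x, u x * a x) u = ∑ x, u x * a x := by
  simp only [bayes]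
  rw [integral_finsetSum _ fun x _ => ((hl.integrable x).const_mul (u x)).mul_const (a x)]
  refine Finset.sum_congr rfl fun x _ => ?_
  rw [integral_mul_const, integral_const_mul, hl.integral_eq_one, mul_one]

lemma bayes_mass (hl : IsLik μ l) (u : X → ℝ) : bayes μ l (fun u => ∑ x, u x) u = ∑ x, u x := by
  simpa using bayes_linear hl 1 u

lemma bayes_mono (hl : IsLik μ l) (hΦ : LinearGrowth Φ) (hΨ : LinearGrowth Ψ)
    (h : ∀ u : X → ℝ, 0 ≤ u → Φ u ≤ Ψ u) (hu : 0 ≤ u) : bayes μ l Φ u ≤ bayes μ l Ψ u :=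
  integral_mono (hΦ.integrable hl hu) (hΨ.integrable hl hu) fun ω => h _ (hl.mul_nonneg hu ω)

lemma bayes_congr (hl : IsLik μ l) (h : ∀ u : X → ℝ, 0 ≤ u → Φ u = Ψ u) (hu : 0 ≤ u) :
    bayes μ l Φ u = bayes μ l Ψ u :=
  integral_congr_ae (Eventually.of_forall fun ω => h _ (hl.mul_nonneg hu ω))

lemma bayes_add (hl : IsLik μ l) (hΦ : LinearGrowth Φ) (hΨ : LinearGrowth Ψ) (hu : 0 ≤ u) :
    bayes μ l (fun u => Φ u + Ψ u) u = bayes μ l Φ u + bayes μ l Ψ u :=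
  integral_add (hΦ.integrable hl hu) (hΨ.integrable hl hu)

lemma bayes_sub (hl : IsLik μ l) (hΦ : LinearGrowth Φ) (hΨ : LinearGrowth Ψ) (hu : 0 ≤ u) :
    bayes μ l (fun u => Φ u - Ψ u) u = bayes μ l Φ u - bayes μ l Ψ u :=
  integral_sub (hΦ.integrable hl hu) (hΨ.integrable hl hu)

lemma bayes_const_mul (c : ℝ) : bayes μ l (fun u => c * Φ u) u = c * bayes μ l Φ u :=
  integral_const_mul c _

lemma bayes_sum {ι : Type*} (s : Finset ι) {Φ : ι → (X → ℝ) → ℝ} (hl : IsLik μ l)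
    (hΦ : ∀ i ∈ s, LinearGrowth (Φ i)) (hu : 0 ≤ u) :
    bayes μ l (fun u => ∑ i ∈ s, Φ i u) u = ∑ i ∈ s, bayes μ l (Φ i) u :=
  integral_finsetSum _ fun i hi => (hΦ i hi).integrable hl hu

lemma measurable_bayes [SFinite μ] (hl : ∀ x, Measurable (l x)) (hΦ : Measurable Φ) :
    Measurable (bayes μ l Φ) := by
  refine StronglyMeasurable.measurable (StronglyMeasurable.integral_prod_right
    (f := fun (u : X → ℝ) ω => Φ fun x => u x * l x ω) ?_)
  refine (hΦ.comp (measurable_pi_lambda _ fun x => ?_)).stronglyMeasurable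
  exact ((measurable_pi_apply x).comp measurable_fst).mul ((hl x).comp measurable_snd)

lemma LinearGrowth.bayes [SFinite μ] (hΦ : LinearGrowth Φ) (hl : IsLik μ l) :
    LinearGrowth (bayes μ l Φ) := by
  obtain ⟨C, hC⟩ := hΦ.bound
  refine ⟨measurable_bayes hl.measurable hΦ.measurable, C, fun u hu => ?_⟩
  calc |CommunityDetection.bayes μ l Φ u| ≤ ∫ ω, |Φ fun x => u x * l x ω| ∂μ :=
        abs_integral_le_integral_abs
    _ ≤ ∫ ω, C * ∑ x, u x * l x ω ∂μ :=
        integral_mono (hΦ.integrable hl hu).abs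
          ((LinearGrowth.mass.integrable hl hu).const_mul C) fun ω => hC _ (hl.mul_nonneg hu ω)
    _ = C * ∑ x, u x := by rw [integral_const_mul]; exact congrArg _ (bayes_mass hl u)

lemma IsLik.prod [SFinite μ] [SFinite ν] (hl : IsLik μ l) (hl' : IsLik ν l') :
    IsLik (μ.prod ν) fun x p => l x p.1 * l' x p.2 where
  measurable x := ((hl.measurable x).comp measurable_fst).mul
    ((hl'.measurable x).comp measurable_snd)
  nonneg x p := _root_.mul_nonneg (hl.nonneg x _) (hl'.nonneg x _)
  integrable x := (hl.integrable x).mul_prod (hl'.integrable x)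
  integral_eq_one x := by
    rw [integral_prod_mul, hl.integral_eq_one, hl'.integral_eq_one, one_mul]

lemma bayes_prod [SFinite μ] [SFinite ν] (hl : IsLik μ l) (hl' : IsLik ν l')
    (hΦ : LinearGrowth Φ) (hu : 0 ≤ u) :
    bayes (μ.prod ν) (fun x p => l x p.1 * l' x p.2) Φ u = bayes μ l (bayes ν l' Φ) u := by
  simp only [bayes]
  rw [integral_prod _ (hΦ.integrable (hl.prod hl') hu)]
  simp only [mul_assoc]

/-- Fubini. This is what allows a network edge to be moved past the Gaussian observations. -/
lemma bayes_comm [SFinite μ] [SFinite ν] (hl : IsLik μ l) (hl' : IsLik ν l')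
    (hΦ : LinearGrowth Φ) (hu : 0 ≤ u) :
    bayes μ l (bayes ν l' Φ) u = bayes ν l' (bayes μ l Φ) u := by
  rw [← bayes_prod hl hl' hΦ hu]
  simp only [bayes]
  rw [integral_prod_symm _ (hΦ.integrable (hl.prod hl') hu)]
  refine integral_congr_ae (Eventually.of_forall fun ω => ?_)
  simp only [mul_assoc, mul_comm (l' _ _)]

end Bayes

/-! ### Conditional entropy and posterior dispersion -/

section Functionals

variable {X : Type*} [Fintype X]

/-- Shannon entropy, extended to unnormalized weights as a positively homogeneous function. -/
def ent (u : X → ℝ) : ℝ := ∑ x, Real.negMulLog (u x) - Real.negMulLog (∑ x, u x)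

/-- The kernel `K` integrated against the posterior covariance, `∑ₓ uₓ Kₓₓ - ∑ₓᵧ uₓ uᵧ Kₓᵧ` for a
probability vector `u`, extended to unnormalized weights as a positively homogeneous function. -/
def spread (K : Matrix X X ℝ) (u : X → ℝ) : ℝ :=
  ∑ x, u x * K x x - (∑ x, ∑ y, u x * u y * K x y) / ∑ x, u x

lemma eq_zero_of_sum_eq_zero {u : X → ℝ} (hu : 0 ≤ u) (h : ∑ x, u x = 0) : u = 0 := by
  ext x
  exact (Finset.sum_eq_zero_iff_of_nonneg fun x _ => hu x).1 h x (Finset.mem_univ x)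

lemma ent_smul (c : ℝ) (u : X → ℝ) : ent (c • u) = c * ent u := by
  simp only [ent, Pi.smul_apply, smul_eq_mul, ← Finset.mul_sum, Real.negMulLog_mul,
    Finset.sum_add_distrib, ← Finset.sum_mul]
  ring

lemma ent_zero : ent (0 : X → ℝ) = 0 := by simp [ent]

lemma spread_zero (K : Matrix X X ℝ) : spread K 0 = 0 := by simp [spread]

lemma spread_smul_right (K : Matrix X X ℝ) (c : ℝ) (u : X → ℝ) :
    spread K (c • u) = c * spread K u := by
  rcases eq_or_ne c 0 with rfl | hc
  · simp [spread]
  have h : ∀ x y, c * u x * (c * u y) * K x y = c * (c * (u x * u y * K x y)) :=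
    fun x y => by ring
  simp only [spread, Pi.smul_apply, smul_eq_mul, h, ← Finset.mul_sum, mul_assoc c (u _) (K _ _)]
  rw [mul_div_mul_left _ _ hc, mul_sub, mul_div_assoc]

/-- Reduces statements about positively homogeneous functionals to probability vectors. For `u = 0`
the vector `v` is zero as well, so normalization is only claimed for nonzero mass. -/
lemma smul_normalize {u : X → ℝ} (hu : 0 ≤ u) :
    ∃ v : X → ℝ, u = (∑ x, u x) • v ∧ 0 ≤ v ∧ (∑ x, u x ≠ 0 → ∑ x, v x = 1) := by
  refine ⟨fun x => u x / ∑ y, u y, ?_, fun x => div_nonneg (hu x) (Finset.sum_nonneg fun y _ => hu y),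
    fun h => ?_⟩
  · rcases eq_or_ne (∑ x, u x) 0 with h | h
    · rw [eq_zero_of_sum_eq_zero hu h]; ext; simp
    · ext x
      simp only [Pi.smul_apply, smul_eq_mul]
      field_simp
  · rw [← Finset.sum_div, div_self h]

lemma ent_linearGrowth : LinearGrowth (ent : (X → ℝ) → ℝ) := by
  refine ⟨by unfold ent; fun_prop, Fintype.card X, fun u hu => ?_⟩
  obtain ⟨v, huv, hv, hv1⟩ := smul_normalize hu
  rcases eq_or_ne (∑ x, u x) 0 with h | h
  · rw [eq_zero_of_sum_eq_zero hu h, ent_zero]; simp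
  have hs : 0 ≤ ∑ x, u x := Finset.sum_nonneg fun x _ => hu x
  have hle : ∀ x, v x ≤ 1 := fun x => by
    rw [← hv1 h]; exact Finset.single_le_sum (fun y _ => hv y) (Finset.mem_univ x)
  have h1 : ent v = ∑ x, Real.negMulLog (v x) := by simp [ent, hv1 h]
  have h2 : |ent v| ≤ Fintype.card X := by
    rw [h1, abs_of_nonneg (Finset.sum_nonneg fun x _ => Real.negMulLog_nonneg (hv x) (hle x))]
    calc _ ≤ ∑ x : X, (1 : ℝ) := Finset.sum_le_sum fun x _ => by
          have := Real.one_sub_inv_le_log_of_pos (x := v x)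
          rcases (hv x).eq_or_lt with h0 | h0
          · simp [← h0]
          · have h3 := mul_le_mul_of_nonneg_left (this h0) h0.le
            rw [mul_sub, mul_inv_cancel₀ h0.ne'] at h3
            simp only [Real.negMulLog, Pi.zero_apply] at *
            linarith
      _ = _ := by simp
  conv_lhs => rw [huv, ent_smul, abs_mul, abs_of_nonneg hs]
  rw [mul_comm]
  gcongr

lemma abs_spread_le {K : Matrix X X ℝ} {B : ℝ} (hB : ∀ x y, |K x y| ≤ B) {u : X → ℝ}
    (hu : 0 ≤ u) : |spread K u| ≤ 2 * B * ∑ x, u x := by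
  have hs : 0 ≤ ∑ x, u x := Finset.sum_nonneg fun x _ => hu x
  have h1 : |∑ x, u x * K x x| ≤ B * ∑ x, u x := by
    rw [Finset.mul_sum]
    refine (Finset.abs_sum_le_sum_abs _ _).trans (Finset.sum_le_sum fun x _ => ?_)
    rw [abs_mul, abs_of_nonneg (hu x), mul_comm]
    exact mul_le_mul_of_nonneg_right (hB x x) (hu x)
  have h2 : |∑ x, ∑ y, u x * u y * K x y| ≤ B * (∑ x, u x) * ∑ x, u x := by
    rw [mul_assoc, Finset.sum_mul_sum, Finset.mul_sum]
    refine (Finset.abs_sum_le_sum_abs _ _).trans (Finset.sum_le_sum fun x _ => ?_)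
    rw [Finset.mul_sum]
    refine (Finset.abs_sum_le_sum_abs _ _).trans (Finset.sum_le_sum fun y _ => ?_)
    rw [abs_mul, abs_of_nonneg (mul_nonneg (hu x) (hu y)), mul_comm]
    exact mul_le_mul_of_nonneg_right (hB x y) (mul_nonneg (hu x) (hu y))
  rcases hs.eq_or_lt with h | h
  · rw [eq_zero_of_sum_eq_zero hu h.symm, spread_zero]; simp
  have h3 : |(∑ x, ∑ y, u x * u y * K x y) / ∑ x, u x| ≤ B * ∑ x, u x := by
    rw [abs_div, abs_of_pos h, div_le_iff₀ h]; exact h2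
  calc |spread K u| ≤ _ := abs_sub _ _
    _ ≤ B * ∑ x, u x + B * ∑ x, u x := add_le_add h1 h3
    _ = _ := by ring

lemma exists_abs_entry_le (K : Matrix X X ℝ) : ∃ B, 0 ≤ B ∧ ∀ x y, |K x y| ≤ B := by
  refine ⟨∑ x, ∑ y, |K x y|, by positivity, fun x y => ?_⟩
  exact (Finset.single_le_sum (f := fun y => |K x y|) (fun _ _ => abs_nonneg _)
    (Finset.mem_univ y)).trans (Finset.single_le_sum (f := fun x => ∑ y, |K x y|)
      (fun _ _ => Finset.sum_nonneg fun _ _ => abs_nonneg _) (Finset.mem_univ x))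

lemma spread_linearGrowth (K : Matrix X X ℝ) : LinearGrowth (spread K) := by
  obtain ⟨B, -, hB⟩ := exists_abs_entry_le K
  exact ⟨by unfold spread; fun_prop, _, fun u hu => abs_spread_le hB hu⟩

lemma spread_add (K K' : Matrix X X ℝ) (u : X → ℝ) :
    spread (K + K') u = spread K u + spread K' u := by
  simp only [spread, Matrix.add_apply, mul_add, Finset.sum_add_distrib, add_div]
  ring

lemma spread_smul_left (c : ℝ) (K : Matrix X X ℝ) (u : X → ℝ) :
    spread (c • K) u = c * spread K u := by
  simp only [spread, Matrix.smul_apply, smul_eq_mul, mul_left_comm _ c, ← Finset.mul_sum,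
    mul_div_assoc, mul_sub]

lemma spread_sum {ι : Type*} (s : Finset ι) (K : ι → Matrix X X ℝ) (u : X → ℝ) :
    spread (∑ i ∈ s, K i) u = ∑ i ∈ s, spread (K i) u := by
  classical
  induction s using Finset.induction_on with
  | empty => simp [spread]
  | insert i s hi ih => rw [Finset.sum_insert hi, spread_add, ih, Finset.sum_insert hi]

lemma spread_vecMulVec (f g u : X → ℝ) :
    spread (Matrix.vecMulVec f g) u
      = ∑ x, u x * (f x * g x) - (∑ x, u x * f x) * (∑ x, u x * g x) / ∑ x, u x := by
  simp only [spread, Matrix.vecMulVec_apply, Finset.sum_mul_sum]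
  congr 2
  exact Finset.sum_congr rfl fun x _ => Finset.sum_congr rfl fun y _ => by ring

/-- The decomposition of a mean square error into variance and squared bias. It exhibits the
variance as a minimum over constants `c` of functionals linear in `u`, which is how the next two
lemmas are used. -/
lemma sum_mul_sub_sq (f u : X → ℝ) (hu : ∑ x, u x ≠ 0) (c : ℝ) :
    ∑ x, u x * (f x - c) ^ 2 = spread (Matrix.vecMulVec f f) u
      + (∑ x, u x) * ((∑ x, u x * f x) / (∑ x, u x) - c) ^ 2 := by
  have h : ∑ x, u x * (f x - c) ^ 2 = ∑ x, u x * (f x * f x) - 2 * c * ∑ x, u x * f x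
      + c ^ 2 * ∑ x, u x := by
    rw [Finset.mul_sum, Finset.mul_sum, ← Finset.sum_sub_distrib, ← Finset.sum_add_distrib]
    exact Finset.sum_congr rfl fun x _ => by ring
  rw [h, spread_vecMulVec]
  field_simp
  ring

lemma spread_vecMulVec_le (f : X → ℝ) {u : X → ℝ} (hu : 0 ≤ u) (c : ℝ) :
    spread (Matrix.vecMulVec f f) u ≤ ∑ x, u x * (f x - c) ^ 2 := by
  rcases eq_or_ne (∑ x, u x) 0 with h | h
  · rw [eq_zero_of_sum_eq_zero hu h, spread_zero]; simp
  rw [sum_mul_sub_sq f u h]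
  have : 0 ≤ ∑ x, u x := Finset.sum_nonneg fun x _ => hu x
  have := mul_nonneg this (sq_nonneg ((∑ x, u x * f x) / (∑ x, u x) - c))
  linarith

lemma exists_spread_vecMulVec_eq (f : X → ℝ) {u : X → ℝ} (hu : 0 ≤ u) :
    ∃ c, spread (Matrix.vecMulVec f f) u = ∑ x, u x * (f x - c) ^ 2 := by
  rcases eq_or_ne (∑ x, u x) 0 with h | h
  · exact ⟨0, by rw [eq_zero_of_sum_eq_zero hu h, spread_zero]; simp⟩
  · exact ⟨_, by rw [sum_mul_sub_sq f u h, sub_self]; simp⟩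

-- Reduces positive semidefinite kernels to rank one, where `spread` is the variance of a real
-- function.
open scoped MatrixOrder Matrix.Norms.L2Operator in
lemma exists_eq_sum_vecMulVec {K : Matrix X X ℝ} (hK : K.PosSemidef) :
    ∃ f : X → X → ℝ, K = ∑ i, Matrix.vecMulVec (f i) (f i) := by
  classical
  obtain ⟨B, rfl⟩ := CStarAlgebra.nonneg_iff_eq_star_mul_self.mp hK.nonneg
  refine ⟨B, ?_⟩
  ext x y
  simp [Matrix.mul_apply, Matrix.sum_apply, Matrix.vecMulVec_apply, Matrix.star_apply]

lemma spread_nonneg {K : Matrix X X ℝ} (hK : K.PosSemidef) {u : X → ℝ} (hu : 0 ≤ u) :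
    0 ≤ spread K u := by
  obtain ⟨f, rfl⟩ := exists_eq_sum_vecMulVec hK
  rw [spread_sum]
  refine Finset.sum_nonneg fun i _ => ?_
  obtain ⟨c, hc⟩ := exists_spread_vecMulVec_eq (f i) hu
  rw [hc]
  exact Finset.sum_nonneg fun x _ => mul_nonneg (hu x) (sq_nonneg _)

variable {Ω : Type*} [MeasurableSpace Ω] {μ : Measure Ω} {l : X → Ω → ℝ}

/-- An observation decreases the posterior dispersion on average. -/
lemma bayes_spread_le (hl : IsLik μ l) {K : Matrix X X ℝ} (hK : K.PosSemidef) {u : X → ℝ}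
    (hu : 0 ≤ u) : bayes μ l (spread K) u ≤ spread K u := by
  obtain ⟨f, rfl⟩ := exists_eq_sum_vecMulVec hK
  have h : bayes μ l (spread (∑ i, Matrix.vecMulVec (f i) (f i))) u
      = ∑ i, bayes μ l (spread (Matrix.vecMulVec (f i) (f i))) u := by
    rw [← bayes_sum Finset.univ hl (fun i _ => spread_linearGrowth _) hu]
    exact congrArg (bayes μ l · u) (funext fun v => spread_sum _ _ v)
  rw [h, spread_sum]
  refine Finset.sum_le_sum fun i _ => ?_
  -- The constant that is optimal before the observation is kept afterwards. It is suboptimal for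
  -- each posterior, and for fixed `c` the functional is linear, hence preserved on average.
  obtain ⟨c, hc⟩ := exists_spread_vecMulVec_eq (f i) hu
  rw [hc, ← bayes_linear hl fun x => (f i x - c) ^ 2]
  exact bayes_mono hl (spread_linearGrowth _) (LinearGrowth.linear _)
    (fun v hv => spread_vecMulVec_le (f i) hv c) hu

end Functionals

/-! ### Gaussian observations -/

section Gaussian

variable {X : Type*} [Fintype X] {Ω Ω' : Type*} [MeasurableSpace Ω] [MeasurableSpace Ω']

/-- The family `g` is a centred Gaussian vector with covariance matrix `K`. -/
structure IsGaussVec (μ : Measure Ω) (g : X → Ω → ℝ) (K : Matrix X X ℝ) : Prop where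
  measurable : ∀ x, Measurable (g x)
  posSemidef : K.PosSemidef
  charFun : ∀ c : X → ℝ,
    ∫ ω, Complex.exp (((∑ x, c x * g x ω : ℝ) : ℂ) * Complex.I) ∂μ
      = Complex.exp ((-(c ⬝ᵥ K *ᵥ c) / 2 : ℝ) : ℂ)

/-- The densities, with respect to the law of the noise, of the observation of a Gaussian vector
in white noise, where `g x` is the inner product of the noise with the signal for the parameter
`x` and `K` is the Gram matrix of the signals. -/
def gaussLik (K : Matrix X X ℝ) (g : X → Ω → ℝ) (x : X) (ω : Ω) : ℝ :=
  Real.exp (g x ω - K x x / 2)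

variable {μ : Measure Ω} {g : X → Ω → ℝ} {K : Matrix X X ℝ} {ν : Measure Ω'} {g' : X → Ω' → ℝ}
  {K' : Matrix X X ℝ}

lemma IsGaussVec.measurable_sum (hg : IsGaussVec μ g K) (c : X → ℝ) :
    Measurable fun ω => ∑ x, c x * g x ω :=
  Finset.measurable_sum _ fun x _ => (hg.measurable x).const_mul (c x)

lemma IsGaussVec.map_sum [IsProbabilityMeasure μ] (hg : IsGaussVec μ g K) (c : X → ℝ) :
    μ.map (fun ω => ∑ x, c x * g x ω) = gaussianReal 0 (c ⬝ᵥ K *ᵥ c).toNNReal := by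
  have hm := hg.measurable_sum c
  have : IsProbabilityMeasure (μ.map fun ω => ∑ x, c x * g x ω) :=
    Measure.isProbabilityMeasure_map hm.aemeasurable
  refine Measure.ext_of_charFun (funext fun t => ?_)
  have h := hg.charFun (t • c)
  rw [charFun_gaussianReal, charFun_apply_real, integral_map hm.aemeasurable (by fun_prop)]
  have hq : (t • c) ⬝ᵥ K *ᵥ (t • c) = t ^ 2 * (c ⬝ᵥ K *ᵥ c) := by
    rw [Matrix.mulVec_smul, smul_dotProduct, dotProduct_smul, smul_eq_mul, smul_eq_mul]; ring
  rw [hq] at h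
  simp only [Pi.smul_apply, smul_eq_mul, mul_assoc, ← Finset.mul_sum] at h
  have h0 : 0 ≤ c ⬝ᵥ K *ᵥ c := by simpa using hg.posSemidef.dotProduct_mulVec_nonneg c
  simp only [Real.coe_toNNReal _ h0]
  push_cast at h ⊢
  rw [h]
  congr 1
  ring

lemma IsGaussVec.integrable_exp [IsProbabilityMeasure μ] (hg : IsGaussVec μ g K) (c : X → ℝ) :
    Integrable (fun ω => Real.exp (∑ x, c x * g x ω)) μ := by
  have h := integrable_exp_mul_gaussianReal (μ := 0) (v := (c ⬝ᵥ K *ᵥ c).toNNReal) 1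
  rw [← hg.map_sum c] at h
  simpa [Function.comp_def] using h.comp_measurable (hg.measurable_sum c)

lemma IsGaussVec.integral_exp [IsProbabilityMeasure μ] (hg : IsGaussVec μ g K) (c : X → ℝ) :
    ∫ ω, Real.exp (∑ x, c x * g x ω) ∂μ = Real.exp ((c ⬝ᵥ K *ᵥ c) / 2) := by
  have h := mgf_gaussianReal (hg.map_sum c) 1
  have h0 : 0 ≤ c ⬝ᵥ K *ᵥ c := by simpa using hg.posSemidef.dotProduct_mulVec_nonneg c
  simpa [mgf, Real.coe_toNNReal _ h0] using h

lemma IsGaussVec.isLik [IsProbabilityMeasure μ] (hg : IsGaussVec μ g K) :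
    IsLik μ (gaussLik K g) := by
  classical
  have h : ∀ x ω, gaussLik K g x ω
      = Real.exp (∑ y, (Pi.single x 1 : X → ℝ) y * g y ω) * Real.exp (-(K x x / 2)) :=
    fun x ω => by simp [gaussLik, sub_eq_add_neg, Real.exp_add, Pi.single_apply]
  refine ⟨fun x => ?_, fun x ω => (Real.exp_pos _).le, fun x => ?_, fun x => ?_⟩
  · have := hg.measurable x
    unfold gaussLik
    fun_prop
  · rw [show gaussLik K g x = _ from funext (h x)]
    exact (hg.integrable_exp _).mul_const _
  · simp only [h]
    rw [integral_mul_const, hg.integral_exp, ← Real.exp_add]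
    simp

/-- Cameron-Martin: tilting by the density for the parameter `x` shifts the mean of `g y` from 0 to
`K x y`. The mean is read off as the derivative at 0 of the moment generating function under the
tilted measure. -/
lemma integrable_mul_gaussLik_and_integral [IsProbabilityMeasure μ] (hg : IsGaussVec μ g K)
    (x y : X) : Integrable (fun ω => g y ω * gaussLik K g x ω) μ ∧
      ∫ ω, g y ω * gaussLik K g x ω ∂μ = K x y := by
  classical
  have hl := hg.isLik
  set ρ : Measure Ω := μ.withDensity fun ω => ENNReal.ofReal (gaussLik K g x ω) with hρ
  have hmeas : Measurable fun ω => ENNReal.ofReal (gaussLik K g x ω) :=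
    (hl.measurable x).ennreal_ofReal
  have hfin : ∀ᵐ ω ∂μ, ENNReal.ofReal (gaussLik K g x ω) < ∞ :=
    Eventually.of_forall fun ω => ENNReal.ofReal_lt_top
  have hint : ∀ f : Ω → ℝ, Integrable f ρ ↔ Integrable (fun ω => f ω * gaussLik K g x ω) μ := by
    intro f
    rw [hρ, integrable_withDensity_iff hmeas hfin]
    simp only [ENNReal.toReal_ofReal (hl.nonneg x _)]
  have heq : ∀ f : Ω → ℝ, ∫ ω, f ω ∂ρ = ∫ ω, f ω * gaussLik K g x ω ∂μ := by
    intro f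
    rw [hρ, integral_withDensity_eq_integral_toReal_smul hmeas hfin]
    simp only [ENNReal.toReal_ofReal (hl.nonneg x _), smul_eq_mul, mul_comm]
  have : IsProbabilityMeasure ρ := ⟨by
    rw [hρ, withDensity_apply _ MeasurableSet.univ, Measure.restrict_univ,
      ← ofReal_integral_eq_lintegral_ofReal (hl.integrable x)
        (Eventually.of_forall (hl.nonneg x)), hl.integral_eq_one, ENNReal.ofReal_one]⟩
  have hsum : ∀ t ω, Real.exp (t * g y ω) * gaussLik K g x ω
      = Real.exp (∑ z, (Pi.single x 1 + Pi.single y t : X → ℝ) z * g z ω)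
        * Real.exp (-(K x x / 2)) := fun t ω => by
    simp only [gaussLik, ← Real.exp_add, Pi.add_apply, add_mul, Finset.sum_add_distrib]
    congr 1
    simp [Pi.single_apply]
    ring
  have hexp : ∀ t, Integrable (fun ω => Real.exp (t * g y ω)) ρ := fun t => by
    rw [hint]
    simp only [hsum]
    exact (hg.integrable_exp _).mul_const _
  have hset : integrableExpSet (g y) ρ = Set.univ := by
    ext t
    simpa [integrableExpSet] using hexp t
  have hsymm : K y x = K x y := by simpa using hg.posSemidef.isHermitian.apply x y
  have hmgf : mgf (g y) ρ = fun t => Real.exp (t * K x y + t ^ 2 * K y y / 2) := by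
    ext t
    rw [mgf, heq]
    simp only [hsum]
    rw [integral_mul_const, hg.integral_exp, ← Real.exp_add]
    congr 1
    simp only [Matrix.mulVec_add, add_dotProduct, dotProduct_add, Matrix.mulVec_single,
      single_dotProduct, MulOpposite.op_one, one_smul, Matrix.col_apply, one_mul, Pi.smul_apply,
      MulOpposite.smul_eq_mul_unop, MulOpposite.unop_op, hsymm]
    ring
  have h0 : (0 : ℝ) ∈ interior (integrableExpSet (g y) ρ) := by simp [hset]
  have hder := deriv_mgf_zero h0
  refine ⟨(hint _).1 ?_, ?_⟩
  · simpa using integrable_pow_of_mem_interior_integrableExpSet h0 1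
  · rw [← heq, ← hder, hmgf]
    have h : HasDerivAt (fun t : ℝ => Real.exp (t * K x y + t ^ 2 * K y y / 2))
        (Real.exp (0 * K x y + 0 ^ 2 * K y y / 2)
          * (1 * K x y + ((2 : ℕ) * (0:ℝ) ^ (2 - 1) * 1) * K y y / 2)) 0 :=
      (((hasDerivAt_id (0 : ℝ)).mul_const _).add
        ((((hasDerivAt_id (0 : ℝ)).pow 2).mul_const _).div_const 2)).exp
    rw [h.deriv]
    simp

lemma IsGaussVec.prod [IsProbabilityMeasure μ] [IsProbabilityMeasure ν] (hg : IsGaussVec μ g K)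
    (hg' : IsGaussVec ν g' K') :
    IsGaussVec (μ.prod ν) (fun x p => g x p.1 + g' x p.2) (K + K') where
  measurable x := ((hg.measurable x).comp measurable_fst).add
    ((hg'.measurable x).comp measurable_snd)
  posSemidef := hg.posSemidef.add hg'.posSemidef
  charFun c := by
    have h : ∀ p : Ω × Ω', Complex.exp (((∑ x, c x * (g x p.1 + g' x p.2) : ℝ) : ℂ) * Complex.I)
        = Complex.exp (((∑ x, c x * g x p.1 : ℝ) : ℂ) * Complex.I)
          * Complex.exp (((∑ x, c x * g' x p.2 : ℝ) : ℂ) * Complex.I) := fun p => by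
      rw [← Complex.exp_add, ← add_mul, ← Complex.ofReal_add, ← Finset.sum_add_distrib]
      simp only [mul_add]
    simp only [h]
    rw [integral_prod_mul (fun ω => Complex.exp (((∑ x, c x * g x ω : ℝ) : ℂ) * Complex.I))
      (fun ω => Complex.exp (((∑ x, c x * g' x ω : ℝ) : ℂ) * Complex.I)), hg.charFun, hg'.charFun,
      ← Complex.exp_add, ← Complex.ofReal_add, Matrix.add_mulVec, dotProduct_add]
    congr 2
    ring

variable [DecidableEq X]

lemma IsGaussVec.map_eq [IsProbabilityMeasure μ] (hg : IsGaussVec μ g K) :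
    μ.map (fun ω => WithLp.toLp 2 fun x => g x ω)
      = multivariateGaussian (0 : EuclideanSpace ℝ X) K := by
  have hm : Measurable fun ω => (WithLp.toLp 2 fun x => g x ω : EuclideanSpace ℝ X) :=
    (WithLp.measurable_toLp 2 _).comp (measurable_pi_lambda _ hg.measurable)
  have := Measure.isProbabilityMeasure_map (μ := μ) hm.aemeasurable
  refine Measure.ext_of_charFun (funext fun t => ?_)
  rw [charFun_multivariateGaussian hg.posSemidef, charFun_apply,
    integral_map hm.aemeasurable (by fun_prop)]
  have h := hg.charFun t
  simp only [PiLp.inner_apply, RCLike.inner_apply, conj_trivial]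
  push_cast at h ⊢
  rw [h]
  congr 1
  simp
  ring

lemma isGaussVec_multivariateGaussian (hK : K.PosSemidef) :
    IsGaussVec (multivariateGaussian (0 : EuclideanSpace ℝ X) K) (fun x ω => ω x) K where
  measurable x := by fun_prop
  posSemidef := hK
  charFun c := by
    have h := charFun_multivariateGaussian (μ := 0) hK (WithLp.toLp 2 c)
    rw [charFun_apply] at h
    simp only [PiLp.inner_apply, RCLike.inner_apply, conj_trivial] at h
    rw [h]
    congr 1
    simp
    ring

/-- The expected value of `Φ` at the posterior after a Gaussian observation with Gram matrix
`K`. -/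
def gauss (K : Matrix X X ℝ) : ((X → ℝ) → ℝ) → (X → ℝ) → ℝ :=
  bayes (multivariateGaussian (0 : EuclideanSpace ℝ X) K) (gaussLik K fun x ω => ω x)

lemma isLik_gauss (hK : K.PosSemidef) :
    IsLik (multivariateGaussian (0 : EuclideanSpace ℝ X) K) (gaussLik K fun x ω => ω x) :=
  (isGaussVec_multivariateGaussian hK).isLik

/-- Gaussian observations with the same Gram matrix are equivalent. -/
lemma bayes_gaussLik [IsProbabilityMeasure μ] (hg : IsGaussVec μ g K) {Φ : (X → ℝ) → ℝ}
    (hΦ : Measurable Φ) (u : X → ℝ) : bayes μ (gaussLik K g) Φ u = gauss K Φ u := by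
  have hm : Measurable fun ω => (WithLp.toLp 2 fun x => g x ω : EuclideanSpace ℝ X) :=
    (WithLp.measurable_toLp 2 _).comp (measurable_pi_lambda _ hg.measurable)
  rw [gauss, bayes, bayes, ← hg.map_eq, integral_map hm.aemeasurable]
  · simp [gaussLik]
  · refine (hΦ.comp (measurable_pi_lambda _ fun x => ?_)).aestronglyMeasurable
    unfold gaussLik
    fun_prop

variable {Φ : (X → ℝ) → ℝ} {u : X → ℝ}

lemma LinearGrowth.gauss (hΦ : LinearGrowth Φ) (hK : K.PosSemidef) :
    LinearGrowth (gauss K Φ) :=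
  hΦ.bayes (isLik_gauss hK)

/-- Two independent Gaussian observations amount to one with concatenated signals, so their Gram
matrices add. Every path of observations below relies on this semigroup property. -/
lemma gauss_add (hK : K.PosSemidef) (hK' : K'.PosSemidef) (hΦ : LinearGrowth Φ) (hu : 0 ≤ u) :
    gauss (K + K') Φ u = gauss K (gauss K' Φ) u := by
  have h := bayes_gaussLik ((isGaussVec_multivariateGaussian hK).prod
    (isGaussVec_multivariateGaussian hK')) hΦ.measurable u
  rw [← h]
  unfold gauss
  rw [← bayes_prod (isLik_gauss hK) (isLik_gauss hK') hΦ hu]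
  congr 1
  ext x p
  simp only [gaussLik, ← Real.exp_add, Matrix.add_apply]
  congr 1
  ring

lemma gauss_zero (hΦ : Measurable Φ) (u : X → ℝ) : gauss 0 Φ u = Φ u := by
  have h : IsGaussVec (Measure.dirac ()) (fun (_ : X) _ => (0 : ℝ)) 0 :=
    ⟨fun _ => measurable_const, Matrix.PosSemidef.zero, fun c => by simp⟩
  rw [← bayes_gaussLik h hΦ]
  simp [bayes, gaussLik]

end Gaussian

/-! ### Mutual information of Gaussian observations -/

section Mean

variable {Ω : Type*} [MeasurableSpace Ω] {μ : Measure Ω} {f f' : Ω → ℝ} {a a' : ℝ}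

/-- The function `f` is integrable with integral `a`. -/
def HasMean (μ : Measure Ω) (f : Ω → ℝ) (a : ℝ) : Prop := Integrable f μ ∧ ∫ ω, f ω ∂μ = a

lemma HasMean.add (h : HasMean μ f a) (h' : HasMean μ f' a') :
    HasMean μ (fun ω => f ω + f' ω) (a + a') :=
  ⟨h.1.add h'.1, by rw [integral_add h.1 h'.1, h.2, h'.2]⟩

lemma HasMean.sub (h : HasMean μ f a) (h' : HasMean μ f' a') :
    HasMean μ (fun ω => f ω - f' ω) (a - a') :=
  ⟨h.1.sub h'.1, by rw [integral_sub h.1 h'.1, h.2, h'.2]⟩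

lemma HasMean.const_mul (h : HasMean μ f a) (c : ℝ) : HasMean μ (fun ω => c * f ω) (c * a) :=
  ⟨h.1.const_mul c, by rw [integral_const_mul, h.2]⟩

lemma HasMean.sum {ι : Type*} {s : Finset ι} {f : ι → Ω → ℝ} {a : ι → ℝ}
    (h : ∀ i ∈ s, HasMean μ (f i) (a i)) : HasMean μ (fun ω => ∑ i ∈ s, f i ω) (∑ i ∈ s, a i) :=
  ⟨integrable_finsetSum _ fun i hi => (h i hi).1, by
    rw [integral_finsetSum _ fun i hi => (h i hi).1]
    exact Finset.sum_congr rfl fun i hi => (h i hi).2⟩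

end Mean

section Information

variable {X : Type*} [Fintype X] [DecidableEq X] {K K₀ K₁ K₂ : Matrix X X ℝ} {u : X → ℝ}

lemma mul_log_ge {a q : ℝ} (ha : 0 ≤ a) (hq : 0 < q) :
    a * Real.log q + a - q ≤ a * Real.log a := by
  rcases ha.eq_or_lt with rfl | ha
  · simp [hq.le]
  have h := Real.log_le_sub_one_of_pos (div_pos hq ha)
  rw [Real.log_div hq.ne' ha.ne'] at h
  have := mul_le_mul_of_nonneg_left h ha.le
  rw [mul_sub, mul_sub, mul_div_cancel₀ _ ha.ne'] at this
  linarith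

lemma mul_log_le {a q : ℝ} (ha : 0 ≤ a) (hq : 0 < q) :
    a * Real.log a ≤ a * Real.log q + a ^ 2 / q - a := by
  rcases ha.eq_or_lt with rfl | ha
  · simp
  have h := Real.log_le_sub_one_of_pos (div_pos ha hq)
  rw [Real.log_div ha.ne' hq.ne'] at h
  have := mul_le_mul_of_nonneg_left h ha.le
  rw [mul_sub, mul_sub, mul_one, mul_div_assoc'] at this
  rw [sq]
  linarith

/-- The marginal density `m` is compared with the density `q` of the observation of the posterior
mean signal. Replacing `m` by `q` in the logarithm gives exactly half the signal variance. The error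
is a Kullback-Leibler divergence, which is nonnegative (`mul_log_ge`, first bound) and at most the
chi-square divergence (`mul_log_le`, second bound). -/
lemma gaussLik_ent_bounds (hK : K.PosSemidef) {v : X → ℝ} (hv : 0 ≤ v) (hv1 : ∑ x, v x = 1) :
    ent v - spread K v / 2 ≤ gauss K ent v ∧
      gauss K ent v ≤ ent v - spread K v / 2
        + (∑ x, ∑ y, v x * v y * Real.exp (K x y - (K *ᵥ v) x - (K *ᵥ v) y + v ⬝ᵥ K *ᵥ v) - 1) := by
  set μ := multivariateGaussian (0 : EuclideanSpace ℝ X) K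
  set g : X → EuclideanSpace ℝ X → ℝ := fun x ω => ω x
  have hg : IsGaussVec μ g K := isGaussVec_multivariateGaussian hK
  set l := gaussLik K g with hl_def
  have hl : IsLik μ l := hg.isLik
  set κ := v ⬝ᵥ K *ᵥ v with hκ
  set m : EuclideanSpace ℝ X → ℝ := fun ω => ∑ x, v x * l x ω with hm
  set b : EuclideanSpace ℝ X → ℝ := fun ω => ∑ x, v x * g x ω with hb
  set q : EuclideanSpace ℝ X → ℝ := fun ω => Real.exp (b ω - κ / 2) with hq
  have hsymm : ∀ x y, K y x = K x y := fun x y => by simpa using hK.isHermitian.apply x y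
  have mean_l : ∀ x, HasMean μ (l x) 1 := fun x => ⟨hl.integrable x, hl.integral_eq_one x⟩
  have mean_m : HasMean μ m 1 := by
    rw [← hv1]
    simpa using HasMean.sum (s := Finset.univ) fun x _ => (mean_l x).const_mul (v x)
  have mean_gl : ∀ x y, HasMean μ (fun ω => g y ω * l x ω) (K x y) :=
    fun x y => integrable_mul_gaussLik_and_integral hg x y
  have mean_mb : HasMean μ (fun ω => m ω * b ω) κ := by
    have h := HasMean.sum (s := Finset.univ) fun x _ => HasMean.sum (s := Finset.univ)
      fun y _ => (mean_gl x y).const_mul (v x * v y)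
    convert h using 1
    · ext ω
      simp only [hm, hb, Finset.sum_mul_sum]
      exact Finset.sum_congr rfl fun x _ => Finset.sum_congr rfl fun y _ => by ring
    · simp only [hκ, dotProduct, Matrix.mulVec, Finset.mul_sum]
      exact Finset.sum_congr rfl fun x _ => Finset.sum_congr rfl fun y _ => by ring
  have mean_q : HasMean μ q 1 := by
    have h : q = fun ω => Real.exp (-(κ / 2)) * Real.exp (∑ x, v x * g x ω) := by
      ext ω
      rw [← Real.exp_add]
      simp only [hq, hb]
      congr 1
      ring
    rw [h]
    have := HasMean.const_mul ⟨hg.integrable_exp v, hg.integral_exp v⟩ (Real.exp (-(κ / 2)))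
    rwa [← Real.exp_add, neg_add_cancel, Real.exp_zero] at this
  -- The logarithm of the likelihood is affine in `g`, so everything except `m * log m` has an
  -- explicit mean.
  have hent : ∀ ω, ent (fun x => v x * l x ω) = (∑ x, (Real.negMulLog (v x) * l x ω
      - v x * (g x ω * l x ω) + v x * (K x x / 2) * l x ω)) + m ω * Real.log (m ω) := by
    intro ω
    simp only [ent, Real.negMulLog_mul]
    rw [sub_eq_add_neg]
    congr 1
    · refine Finset.sum_congr rfl fun x _ => ?_
      simp only [hl_def, gaussLik]
      rw [Real.negMulLog, Real.negMulLog, Real.log_exp]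
      ring
    · simp [Real.negMulLog, hm]
  have mean_A : HasMean μ (fun ω => ∑ x, (Real.negMulLog (v x) * l x ω
      - v x * (g x ω * l x ω) + v x * (K x x / 2) * l x ω)) (ent v - (∑ x, v x * K x x) / 2) := by
    convert HasMean.sum (s := Finset.univ) fun x _ => (((mean_l x).const_mul
      (Real.negMulLog (v x))).sub ((mean_gl x x).const_mul (v x))).add
        ((mean_l x).const_mul (v x * (K x x / 2))) using 1
    rw [Finset.sum_add_distrib, Finset.sum_sub_distrib]
    simp only [ent, hv1, mul_one, Real.negMulLog_one, sub_zero, ← mul_div_assoc, ← Finset.sum_div]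
    ring
  have hspread : spread K v = ∑ x, v x * K x x - κ := by
    simp only [spread, hv1, div_one, hκ, dotProduct, Matrix.mulVec, Finset.mul_sum]
    congr 1
    exact Finset.sum_congr rfl fun x _ => Finset.sum_congr rfl fun y _ => by ring
  have hint : Integrable (fun ω => ent fun x => v x * l x ω) μ :=
    ent_linearGrowth.integrable hl hv
  have hm0 : ∀ ω, 0 ≤ m ω := fun ω =>
    Finset.sum_nonneg fun x _ => mul_nonneg (hv x) (hl.nonneg x ω)
  have hq0 : ∀ ω, 0 < q ω := fun ω => Real.exp_pos _
  have hlogq : ∀ ω, Real.log (q ω) = b ω - κ / 2 := fun ω => Real.log_exp _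
  constructor
  · have h := ((mean_A.add (mean_mb.sub (mean_m.const_mul (κ / 2)))).add mean_m).sub mean_q
    have hle := integral_mono h.1 hint fun ω => by
      have := mul_log_ge (hm0 ω) (hq0 ω)
      simp only [hent, hlogq] at this ⊢
      linarith
    rw [h.2] at hle
    change _ ≤ ∫ ω, ent (fun x => v x * l x ω) ∂μ
    linarith
  · have mean_r : HasMean μ (fun ω => m ω ^ 2 / q ω) (∑ x, ∑ y, v x * v y *
        Real.exp (K x y - (K *ᵥ v) x - (K *ᵥ v) y + κ)) := by
      have h1 : ∀ x y, HasMean μ (fun ω => l x ω * l y ω / q ω)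
          (Real.exp (K x y - (K *ᵥ v) x - (K *ᵥ v) y + κ)) := by
        intro x y
        have h := HasMean.const_mul ⟨hg.integrable_exp (Pi.single x 1 + Pi.single y 1 - v),
          hg.integral_exp (Pi.single x 1 + Pi.single y 1 - v)⟩
          (Real.exp (-(K x x / 2) - K y y / 2 + κ / 2))
        convert h using 1
        · ext ω
          simp only [hl_def, gaussLik, hq, hb, ← Real.exp_add, ← Real.exp_sub, Pi.add_apply,
            Pi.sub_apply, add_mul, sub_mul, Finset.sum_add_distrib, Finset.sum_sub_distrib]
          congr 1
          simp [Pi.single_apply]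
          ring
        · rw [← Real.exp_add]
          congr 1
          have e1 : ∀ z, v ⬝ᵥ K.col z = (K *ᵥ v) z := fun z => by
            simp only [dotProduct, Matrix.mulVec, Matrix.col_apply]
            exact Finset.sum_congr rfl fun w _ => by rw [mul_comm, hsymm]
          simp only [Matrix.mulVec_add, Matrix.mulVec_sub, add_dotProduct, dotProduct_add,
            sub_dotProduct, dotProduct_sub, Matrix.mulVec_single, single_dotProduct,
            MulOpposite.op_one, one_smul, Matrix.col_apply, one_mul, e1, ← hκ]
          rw [hsymm x y]
          ring
      convert HasMean.sum (s := Finset.univ) fun x _ => HasMean.sum (s := Finset.univ)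
        fun y _ => (h1 x y).const_mul (v x * v y) using 1
      ext ω
      simp only [hm, sq, Finset.sum_mul_sum, Finset.sum_div]
      exact Finset.sum_congr rfl fun x _ => Finset.sum_congr rfl fun y _ => by ring
    have h := ((mean_A.add (mean_mb.sub (mean_m.const_mul (κ / 2)))).add mean_r).sub mean_m
    have hle := integral_mono hint h.1 fun ω => by
      have := mul_log_le (hm0 ω) (hq0 ω)
      simp only [hent, hlogq] at this ⊢
      linarith
    rw [h.2] at hle
    change ∫ ω, ent (fun x => v x * l x ω) ∂μ ≤ _
    linarith

lemma gauss_smul {Φ : (X → ℝ) → ℝ} (hΦ : ∀ (c : ℝ) (u : X → ℝ), Φ (c • u) = c * Φ u) (c : ℝ)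
    (u : X → ℝ) : gauss K Φ (c • u) = c * gauss K Φ u := by
  simp only [gauss, bayes, ← integral_const_mul, ← hΦ]
  refine integral_congr_ae (Eventually.of_forall fun ω => congrArg Φ ?_)
  ext x
  simp [mul_assoc]

/-- The mutual information of a Gaussian observation is at most half the signal variance. -/
lemma ent_sub_le_gauss_ent (hK : K.PosSemidef) (hu : 0 ≤ u) :
    ent u - spread K u / 2 ≤ gauss K ent u := by
  obtain ⟨v, huv, hv, hv1⟩ := smul_normalize hu
  rcases eq_or_ne (∑ x, u x) 0 with h | h
  · rw [eq_zero_of_sum_eq_zero hu h, ent_zero, spread_zero]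
    simp [gauss, bayes, show (fun _ : X => (0 : ℝ)) = 0 from rfl, ent_zero]
  have h1 := (gaussLik_ent_bounds hK hv (hv1 h)).1
  have hs : 0 ≤ ∑ x, u x := Finset.sum_nonneg fun x _ => hu x
  rw [huv, gauss_smul ent_smul, ent_smul, spread_smul_right, mul_div_assoc, ← mul_sub]
  exact mul_le_mul_of_nonneg_left h1 hs

/-- The mutual information of a weak Gaussian observation is at least half the signal variance, up
to a second order term. -/
lemma gauss_ent_le (hK : K.PosSemidef) {B : ℝ} (hB : ∀ x y, |K x y| ≤ B) (hB1 : 4 * B ≤ 1)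
    (hu : 0 ≤ u) : gauss K ent u ≤ ent u - spread K u / 2 + 16 * B ^ 2 * ∑ x, u x := by
  obtain ⟨v, huv, hv, hv1⟩ := smul_normalize hu
  rcases eq_or_ne (∑ x, u x) 0 with h | h
  · rw [eq_zero_of_sum_eq_zero hu h, ent_zero, spread_zero]
    simp [gauss, bayes, show (fun _ : X => (0 : ℝ)) = 0 from rfl, ent_zero]
  have hs : 0 ≤ ∑ x, u x := Finset.sum_nonneg fun x _ => hu x
  replace hv1 := hv1 h
  suffices h1 : gauss K ent v ≤ ent v - spread K v / 2 + 16 * B ^ 2 by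
    have h2 := mul_le_mul_of_nonneg_left h1 hs
    have e1 := gauss_smul (K := K) ent_smul (∑ x, u x) v
    have e2 := ent_smul (∑ x, u x) v
    have e3 := spread_smul_right K (∑ x, u x) v
    rw [← huv] at e1 e2 e3
    rw [e1, e2, e3]
    linarith
  refine (gaussLik_ent_bounds hK hv hv1).2.trans ?_
  have habs : ∀ x, |(K *ᵥ v) x| ≤ B := fun x => by
    calc |∑ y, K x y * v y| ≤ ∑ y, |K x y * v y| := Finset.abs_sum_le_sum_abs _ _
      _ ≤ ∑ y, B * v y := Finset.sum_le_sum fun y _ => by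
          rw [abs_mul, abs_of_nonneg (hv y)]
          exact mul_le_mul_of_nonneg_right (hB x y) (hv y)
      _ = B := by rw [← Finset.mul_sum, hv1, mul_one]
  have hκ : |v ⬝ᵥ K *ᵥ v| ≤ B := by
    calc |∑ y, v y * (K *ᵥ v) y| ≤ ∑ y, |v y * (K *ᵥ v) y| := Finset.abs_sum_le_sum_abs _ _
      _ ≤ ∑ y, v y * B := Finset.sum_le_sum fun y _ => by
          rw [abs_mul, abs_of_nonneg (hv y)]
          exact mul_le_mul_of_nonneg_left (habs y) (hv y)
      _ = B := by rw [← Finset.sum_mul, hv1, one_mul]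
  set κ := v ⬝ᵥ K *ᵥ v
  -- `exp t ≤ 1 + t + t²` for `|t| ≤ 1`, with `|t| ≤ 4 * B`. The linear part of the exponent
  -- averages to zero under `v ⊗ v`, so that only `16 * B ^ 2` survives.
  have hterm : ∀ x y, Real.exp (K x y - (K *ᵥ v) x - (K *ᵥ v) y + κ)
      ≤ 1 + (K x y - (K *ᵥ v) x - (K *ᵥ v) y + κ) + 16 * B ^ 2 := by
    intro x y
    have h1 := abs_le.1 (hB x y)
    have h2 := abs_le.1 (habs x)
    have h3 := abs_le.1 (habs y)
    have h4 := abs_le.1 hκ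
    have h5 : |K x y - (K *ᵥ v) x - (K *ᵥ v) y + κ| ≤ 4 * B :=
      abs_le.2 ⟨by linarith, by linarith⟩
    have h6 := (abs_le.1 (Real.abs_exp_sub_one_sub_id_le (h5.trans hB1))).2
    have h7 := sq_le_sq' (abs_le.1 h5).1 (abs_le.1 h5).2
    nlinarith
  have hsum : ∑ x, ∑ y, v x * v y * Real.exp (K x y - (K *ᵥ v) x - (K *ᵥ v) y + κ)
      ≤ 1 + 16 * B ^ 2 := by
    calc _ ≤ ∑ x, ∑ y, v x * v y * (1 + (K x y - (K *ᵥ v) x - (K *ᵥ v) y + κ) + 16 * B ^ 2) :=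
          Finset.sum_le_sum fun x _ => Finset.sum_le_sum fun y _ =>
            mul_le_mul_of_nonneg_left (hterm x y) (mul_nonneg (hv x) (hv y))
      _ = ∑ x, (v x * ((K *ᵥ v) x) + v x * (1 - (K *ᵥ v) x + 16 * B ^ 2)) := by
          refine Finset.sum_congr rfl fun x _ => ?_
          have e1 : ∑ y, v y * (K *ᵥ v) y = κ := rfl
          have e2 : ∑ y, K x y * v y = (K *ᵥ v) x := rfl
          have e3 : ∑ y, v x * v y * (1 + (K x y - (K *ᵥ v) x - (K *ᵥ v) y + κ) + 16 * B ^ 2)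
              = v x * ∑ y, K x y * v y - v x * ∑ y, v y * (K *ᵥ v) y
                + v x * (1 - (K *ᵥ v) x + κ + 16 * B ^ 2) * ∑ y, v y := by
            rw [Finset.mul_sum, Finset.mul_sum, Finset.mul_sum, ← Finset.sum_sub_distrib,
              ← Finset.sum_add_distrib]
            exact Finset.sum_congr rfl fun y _ => by ring
          rw [e3, e1, e2, hv1]
          ring
      _ = ∑ x, v x * (1 + 16 * B ^ 2) := Finset.sum_congr rfl fun x _ => by ring
      _ = _ := by rw [← Finset.sum_mul, hv1, one_mul]
  linarith

/-- The weak-observation bound `gauss_ent_le`, applied at each posterior left by the observation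
`K₀`. It is a one-sided derivative estimate with an explicit second order error; the opposite
estimate below has no error term. -/
lemma gauss_add_le_gauss_sub (hK₀ : K₀.PosSemidef) (hK : K.PosSemidef) {B : ℝ}
    (hB : ∀ x y, |K x y| ≤ B) {h : ℝ} (hh : 0 ≤ h) (hB1 : 4 * (h * B) ≤ 1) (hu : 0 ≤ u) :
    gauss (K₀ + h • K) ent u ≤ gauss K₀ ent u - h / 2 * gauss K₀ (spread K) u
      + 16 * (h * B) ^ 2 * ∑ x, u x := by
  have hl := isLik_gauss hK₀
  have hhK : (h • K).PosSemidef := hK.smul hh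
  have hlg : LinearGrowth fun v : X → ℝ => ent v - h / 2 * spread K v :=
    ent_linearGrowth.sub ((spread_linearGrowth K).const_mul _)
  rw [gauss_add hK₀ hhK ent_linearGrowth hu]
  calc gauss K₀ (gauss (h • K) ent) u
      ≤ gauss K₀ (fun v => (ent v - h / 2 * spread K v) + 16 * (h * B) ^ 2 * ∑ x, v x) u := by
        refine bayes_mono hl (ent_linearGrowth.gauss hhK)
          (hlg.add (LinearGrowth.mass.const_mul _)) (fun v hv => ?_) hu
        refine (gauss_ent_le hhK (B := h * B) (fun x y => ?_) hB1 hv).trans_eq ?_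
        · rw [Matrix.smul_apply, smul_eq_mul, abs_mul, abs_of_nonneg hh]
          exact mul_le_mul_of_nonneg_left (hB x y) hh
        · rw [spread_smul_left]; ring
    _ = _ := by
        unfold gauss
        rw [bayes_add hl hlg (LinearGrowth.mass.const_mul _) hu,
          bayes_sub hl ent_linearGrowth ((spread_linearGrowth K).const_mul _) hu,
          bayes_const_mul, bayes_const_mul, bayes_mass hl]

lemma gauss_sub_le_gauss_add (hK₀ : K₀.PosSemidef) (hK : K.PosSemidef) {h : ℝ} (hh : 0 ≤ h)
    (hu : 0 ≤ u) :
    gauss K₀ ent u - h / 2 * gauss K₀ (spread K) u ≤ gauss (K₀ + h • K) ent u := by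
  have hl := isLik_gauss hK₀
  have hhK : (h • K).PosSemidef := hK.smul hh
  have hlg := (spread_linearGrowth K).const_mul (h / 2)
  rw [gauss_add hK₀ hhK ent_linearGrowth hu]
  calc _ = gauss K₀ (fun v => ent v - h / 2 * spread K v) u := by
        unfold gauss
        rw [bayes_sub hl ent_linearGrowth hlg hu, bayes_const_mul]
    _ ≤ _ := by
        refine bayes_mono hl (ent_linearGrowth.sub hlg) (ent_linearGrowth.gauss hhK)
          (fun v hv => ?_) hu
        refine Eq.trans_le ?_ (ent_sub_le_gauss_ent hhK hv)
        rw [spread_smul_left]; ring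

lemma gauss_spread_le_of_add (hK₀ : K₀.PosSemidef) (hK₁ : K₁.PosSemidef) (hK : K.PosSemidef)
    (hu : 0 ≤ u) : gauss (K₀ + K₁) (spread K) u ≤ gauss K₀ (spread K) u := by
  rw [gauss_add hK₀ hK₁ (spread_linearGrowth K) hu]
  exact bayes_mono (isLik_gauss hK₀) ((spread_linearGrowth K).gauss hK₁) (spread_linearGrowth K)
    (fun v hv => bayes_spread_le (isLik_gauss hK₁) hK hv) hu

/-! ### Consequences of the weak-observation bounds, obtained in N small steps -/

lemma sub_le_of_forall_step {f : ℕ → ℝ} {N : ℕ} {δ : ℝ} (h : ∀ j < N, f j - f (j + 1) ≤ δ) :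
    f 0 - f N ≤ N * δ := by
  have := Finset.sum_le_sum fun j hj => h j (Finset.mem_range.1 hj)
  rw [Finset.sum_range_sub'] at this
  simpa using this

lemma le_of_forall_le_add_div {a b c C : ℝ} (h : ∀ N : ℕ, 0 < N → C ≤ N → a ≤ b + c / N) :
    a ≤ b := by
  have h1 : Tendsto (fun N : ℕ => b + c / N) atTop (𝓝 (b + 0)) :=
    tendsto_const_nhds.add (tendsto_const_div_atTop_nhds_zero_nat c)
  rw [add_zero] at h1
  refine ge_of_tendsto h1 ?_
  filter_upwards [eventually_gt_atTop 0, (tendsto_natCast_atTop_atTop (R := ℝ)).eventually_ge_atTop C]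
    with N hN hC using h N hN hC

lemma step_bound {N : ℕ} (hN : 0 < N) {B : ℝ} (h : 4 * B ≤ N) : 4 * (1 / N * B) ≤ 1 := by
  have : (0 : ℝ) < N := by exact_mod_cast hN
  rw [one_div, ← mul_assoc, mul_comm 4, mul_assoc, inv_mul_le_iff₀ this, mul_one]
  exact h

/-- The information gained from a Gaussian observation is at least half the remaining signal
variance. -/
lemma gauss_spread_le (hK : K.PosSemidef) (hu : 0 ≤ u) :
    gauss K (spread K) u / 2 ≤ ent u - gauss K ent u := by
  obtain ⟨B, hB0, hB⟩ := exists_abs_entry_le K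
  refine le_of_forall_le_add_div (c := 16 * B ^ 2 * ∑ x, u x) (C := 4 * B) fun N hN hC => ?_
  have hN' : (0 : ℝ) < N := by exact_mod_cast hN
  -- The observation is revealed in `N` equal portions. The spread before each portion is at least
  -- the spread at the end, and the errors of order `1/N²` sum to order `1/N`.
  have key := sub_le_of_forall_step (f := fun j : ℕ => -gauss ((j * (1 / N : ℝ)) • K) ent u) (N := N)
    (δ := -(1 / N / 2 * gauss K (spread K) u) + 16 * (1 / N * B) ^ 2 * ∑ x, u x) fun j hj => by
      have hj0 : (0 : ℝ) ≤ j * (1 / N) := by positivity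
      have hj1 : (j : ℝ) * (1 / N) ≤ 1 := by
        rw [mul_one_div, div_le_one hN']; exact_mod_cast hj.le
      have e : (((j + 1 : ℕ) : ℝ) * (1 / N : ℝ)) • K
          = ((j : ℝ) * (1 / N)) • K + (1 / N : ℝ) • K := by
        rw [← add_smul]; push_cast; ring_nf
      have h1 := gauss_add_le_gauss_sub (hK.smul hj0) hK hB (h := 1 / N) (by positivity)
        (step_bound hN hC) hu
      have h2 := gauss_spread_le_of_add (hK.smul hj0) (hK.smul (sub_nonneg.2 hj1)) hK hu
      rw [← add_smul, add_sub_cancel, one_smul] at h2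
      have h3 : (1 / N / 2 : ℝ) * gauss K (spread K) u
          ≤ 1 / N / 2 * gauss (((j : ℝ) * (1 / N)) • K) (spread K) u :=
        mul_le_mul_of_nonneg_left h2 (by positivity)
      simp only [e]
      linarith
  simp only [Nat.cast_zero, zero_mul, zero_smul, gauss_zero ent_linearGrowth.measurable] at key
  rw [mul_one_div, div_self hN'.ne', one_smul] at key
  have e2 : (N : ℝ) * (-(1 / N / 2 * gauss K (spread K) u) + 16 * (1 / N * B) ^ 2 * ∑ x, u x)
      = -(gauss K (spread K) u / 2) + 16 * B ^ 2 * (∑ x, u x) / N := by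
    field_simp
  rw [e2] at key
  linarith

/-- Independent Gaussian observations have subadditive mutual information. -/
lemma gauss_ent_add_le (hK₁ : K₁.PosSemidef) (hK₂ : K₂.PosSemidef) (hu : 0 ≤ u) :
    gauss K₁ ent u + gauss K₂ ent u ≤ gauss (K₁ + K₂) ent u + ent u := by
  obtain ⟨B, hB0, hB⟩ := exists_abs_entry_le K₂
  refine le_of_forall_le_add_div (c := 16 * B ^ 2 * ∑ x, u x) (C := 4 * B) fun N hN hC => ?_
  have hN' : (0 : ℝ) < N := by exact_mod_cast hN
  -- `K₂` is revealed in portions, with and without knowledge of `K₁`. A portion gains less when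
  -- `K₁` is known, because the remaining spread is smaller.
  have key := sub_le_of_forall_step (N := N) (f := fun j : ℕ =>
      gauss (K₁ + (j * (1 / N : ℝ)) • K₂) ent u - gauss ((j * (1 / N : ℝ)) • K₂) ent u)
    (δ := 16 * (1 / N * B) ^ 2 * ∑ x, u x) fun j hj => by
      have hj0 : (0 : ℝ) ≤ j * (1 / N) := by positivity
      have e : (((j + 1 : ℕ) : ℝ) * (1 / N : ℝ)) • K₂
          = ((j : ℝ) * (1 / N)) • K₂ + (1 / N : ℝ) • K₂ := by
        rw [← add_smul]; push_cast; ring_nf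
      have hj2 := hK₂.smul hj0
      have h1 := gauss_add_le_gauss_sub hj2 hK₂ hB (h := 1 / N) (by positivity)
        (step_bound hN hC) hu
      have h2 := gauss_sub_le_gauss_add (hK₁.add hj2) hK₂ (h := 1 / N) (by positivity) hu
      have h3 := gauss_spread_le_of_add hj2 hK₁ hK₂ hu
      rw [add_comm _ K₁] at h3
      have h4 := mul_le_mul_of_nonneg_left h3 (show (0 : ℝ) ≤ 1 / N / 2 by positivity)
      simp only [e, ← add_assoc]
      linarith
  simp only [Nat.cast_zero, zero_mul, zero_smul, gauss_zero ent_linearGrowth.measurable,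
    add_zero] at key
  rw [mul_one_div, div_self hN'.ne', one_smul] at key
  have e2 : (N : ℝ) * (16 * (1 / N * B) ^ 2 * ∑ x, u x) = 16 * B ^ 2 * (∑ x, u x) / N := by
    field_simp
  rw [e2] at key
  linarith

/-- Interpolation between two Gaussian observations, one of which has an almost larger Gram
matrix. -/
lemma gauss_ent_interpolation (hK₀ : K₀.PosSemidef) (hK₁ : K₁.PosSemidef) (hK₂ : K₂.PosSemidef)
    {c : ℝ} (hc : ∀ x y, K₂ x y - c ≤ K₁ x y) (hu : 0 ≤ u) :
    gauss (K₀ + K₂) ent u - (∑ x, u x * (K₁ x x - K₂ x x) + c * ∑ x, u x) / 2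
      ≤ gauss (K₀ + K₁) ent u := by
  obtain ⟨B, hB0, hB⟩ := exists_abs_entry_le K₂
  refine le_of_forall_le_add_div (c := 16 * B ^ 2 * ∑ x, u x) (C := 4 * B) fun N hN hC => ?_
  have hN' : (0 : ℝ) < N := by exact_mod_cast hN
  -- The diagonal terms of `spread` are linear in `v` and are kept exactly. In the terms with two
  -- independent posterior draws, the hypothesis bounds `K₂ - K₁` by `c` pointwise.
  have hspread : ∀ v : X → ℝ, 0 ≤ v →
      spread K₁ v - spread K₂ v ≤ ∑ x, v x * (K₁ x x - K₂ x x + c) := by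
    intro v hv
    rcases eq_or_ne (∑ x, v x) 0 with h | h
    · rw [eq_zero_of_sum_eq_zero hv h, spread_zero, spread_zero]; simp
    have hs : 0 < ∑ x, v x := lt_of_le_of_ne (Finset.sum_nonneg fun x _ => hv x) h.symm
    have h1 : (∑ x, ∑ y, v x * v y * K₂ x y) - c * (∑ x, v x) * ∑ x, v x
        ≤ ∑ x, ∑ y, v x * v y * K₁ x y := by
      rw [mul_assoc, Finset.sum_mul_sum, Finset.mul_sum, ← Finset.sum_sub_distrib]
      refine Finset.sum_le_sum fun x _ => ?_
      rw [Finset.mul_sum, ← Finset.sum_sub_distrib]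
      refine Finset.sum_le_sum fun y _ => ?_
      have := mul_le_mul_of_nonneg_left (hc x y) (mul_nonneg (hv x) (hv y))
      linarith
    have h2 := div_le_div_of_nonneg_right h1 hs.le
    rw [sub_div, mul_div_cancel_right₀ _ h] at h2
    have h3 : ∑ x, v x * (K₁ x x - K₂ x x + c)
        = ∑ x, v x * K₁ x x - ∑ x, v x * K₂ x x + c * ∑ x, v x := by
      rw [Finset.mul_sum, ← Finset.sum_sub_distrib, ← Finset.sum_add_distrib]
      exact Finset.sum_congr rfl fun x _ => by ring
    rw [h3]
    unfold spread
    linarith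
  -- The path `K₀ + t K₁ + (1 - t) K₂`. One step exchanges `(1/N) K₂` for `(1/N) K₁` on top of the
  -- common part `Kj`.
  have key := sub_le_of_forall_step (N := N) (f := fun j : ℕ =>
      gauss (K₀ + (j * (1 / N : ℝ)) • K₁ + (1 - j * (1 / N : ℝ)) • K₂) ent u)
    (δ := 1 / N / 2 * (∑ x, u x * (K₁ x x - K₂ x x + c)) + 16 * (1 / N * B) ^ 2 * ∑ x, u x)
    fun j hj => by
      have hj0 : (0 : ℝ) ≤ j * (1 / N) := by positivity
      have hj1 : 0 ≤ 1 - ((j + 1 : ℕ) : ℝ) * (1 / N) := by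
        rw [sub_nonneg, mul_one_div, div_le_one hN']; exact_mod_cast hj
      set Kj := K₀ + (j * (1 / N : ℝ)) • K₁ + (1 - ((j + 1 : ℕ) : ℝ) * (1 / N : ℝ)) • K₂ with hKj
      have hKj0 : Kj.PosSemidef := (hK₀.add (hK₁.smul hj0)).add (hK₂.smul hj1)
      have e1 : K₀ + (j * (1 / N : ℝ)) • K₁ + (1 - j * (1 / N : ℝ)) • K₂
          = Kj + (1 / N : ℝ) • K₂ := by
        rw [hKj, add_assoc _ _ ((1 / N : ℝ) • K₂), ← add_smul]; push_cast; ring_nf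
      have e2 : K₀ + (((j + 1 : ℕ) : ℝ) * (1 / N : ℝ)) • K₁
          + (1 - ((j + 1 : ℕ) : ℝ) * (1 / N : ℝ)) • K₂ = Kj + (1 / N : ℝ) • K₁ := by
        have : (((j + 1 : ℕ) : ℝ) * (1 / N : ℝ)) • K₁
            = (j * (1 / N : ℝ)) • K₁ + (1 / N : ℝ) • K₁ := by
          rw [← add_smul]; push_cast; ring_nf
        rw [hKj, this]; abel
      have h1 := gauss_add_le_gauss_sub hKj0 hK₂ hB (h := 1 / N) (by positivity)
        (step_bound hN hC) hu
      have h2 := gauss_sub_le_gauss_add hKj0 hK₁ (h := 1 / N) (by positivity) hu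
      have h3 : gauss Kj (spread K₁) u - gauss Kj (spread K₂) u
          ≤ ∑ x, u x * (K₁ x x - K₂ x x + c) := by
        have hl := isLik_gauss hKj0
        rw [← bayes_linear hl fun x => K₁ x x - K₂ x x + c]
        unfold gauss
        rw [← bayes_sub hl (spread_linearGrowth _) (spread_linearGrowth _) hu]
        exact bayes_mono hl ((spread_linearGrowth _).sub (spread_linearGrowth _))
          (LinearGrowth.linear _) hspread hu
      have h4 := mul_le_mul_of_nonneg_left h3 (show (0 : ℝ) ≤ 1 / N / 2 by positivity)
      rw [mul_sub] at h4
      simp only [e1, e2]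
      linarith
  simp only [Nat.cast_zero, zero_mul, zero_smul, sub_zero, one_smul, add_zero] at key
  rw [mul_one_div, div_self hN'.ne', one_smul, sub_self, zero_smul, add_zero] at key
  have e2 : (N : ℝ) * (1 / N / 2 * (∑ x, u x * (K₁ x x - K₂ x x + c))
      + 16 * (1 / N * B) ^ 2 * ∑ x, u x)
      = (∑ x, u x * (K₁ x x - K₂ x x + c)) / 2 + 16 * B ^ 2 * (∑ x, u x) / N := by
    field_simp
  have e3 : ∑ x, u x * (K₁ x x - K₂ x x + c)
      = ∑ x, u x * (K₁ x x - K₂ x x) + c * ∑ x, u x := by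
    rw [Finset.mul_sum, ← Finset.sum_add_distrib]
    exact Finset.sum_congr rfl fun x _ => by ring
  rw [e2, e3] at key
  linarith

end Information

/-! ### Bernoulli observations -/

section Bernoulli

variable {X : Type*} [Fintype X]

/-- The density, with respect to the counting measure, of a Bernoulli observation with success
probability `m x` for the parameter `x`. -/
def bernLik (m : X → ℝ) (x : X) (b : Bool) : ℝ := bif b then m x else 1 - m x

/-- The expected value of `Φ` at the posterior after a Bernoulli observation. -/
def bern (m : X → ℝ) : ((X → ℝ) → ℝ) → (X → ℝ) → ℝ := bayes Measure.count (bernLik m)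

lemma bern_eq (m : X → ℝ) (Φ : (X → ℝ) → ℝ) (u : X → ℝ) :
    bern m Φ u = Φ (fun x => u x * m x) + Φ (fun x => u x * (1 - m x)) := by
  simp [bern, bayes, bernLik, integral_countable]

lemma isLik_bern {m : X → ℝ} (h0 : ∀ x, 0 ≤ m x) (h1 : ∀ x, m x ≤ 1) :
    IsLik Measure.count (bernLik m) where
  measurable x := measurable_from_top
  nonneg x b := by cases b <;> simp [bernLik, h0, h1]
  integrable x := Integrable.of_finite
  integral_eq_one x := by simp [bernLik, integral_countable]

/-- The second derivative of the binary entropy is `-1 / (y * (1 - y)) ≥ -1 / c`, which the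
quadratic term compensates. Jensen's inequality then bounds the information in a Bernoulli
observation by a variance. -/
lemma convexOn_binEntropy_add_sq {a b c : ℝ} (ha : 0 < a) (hb : b < 1) (hc : 0 < c)
    (h : ∀ y ∈ Set.Icc a b, c ≤ y * (1 - y)) :
    ConvexOn ℝ (Set.Icc a b) fun y => Real.binEntropy y + y ^ 2 / (2 * c) := by
  refine convexOn_of_hasDerivWithinAt2_nonneg (convex_Icc a b)
    (f' := fun y => (Real.log (1 - y) - Real.log y) + (2 * y) / (2 * c))
    (f'' := fun y => (-1 / (1 - y) - 1 / y) + 2 / (2 * c)) (by fun_prop) ?_ ?_ ?_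
  · intro y hy
    rw [interior_Icc] at hy
    have hy0 : y ≠ 0 := (ha.trans hy.1).ne'
    have hy1 : y ≠ 1 := (hy.2.trans hb).ne
    have h2 := ((hasDerivAt_id y).pow 2).div_const (2 * c)
    exact (((Real.hasDerivAt_binEntropy hy0 hy1).add h2).congr_deriv (by simp)).hasDerivWithinAt
  · intro y hy
    rw [interior_Icc] at hy
    have hy0 : y ≠ 0 := (ha.trans hy.1).ne'
    have hy1 : 1 - y ≠ 0 := by have := hy.2.trans hb; linarith
    have h1 := (((hasDerivAt_id y).const_sub 1).log hy1).sub ((hasDerivAt_id y).log hy0)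
    have h2 := ((hasDerivAt_id y).const_mul 2).div_const (2 * c)
    exact ((h1.add h2).congr_deriv (by simp)).hasDerivWithinAt
  · intro y hy
    rw [interior_Icc] at hy
    have hy0 : 0 < y := ha.trans hy.1
    have hy1 : 0 < 1 - y := by have := hy.2.trans hb; linarith
    have h1 := h y ⟨hy.1.le, hy.2.le⟩
    have h2 : -1 / (1 - y) - 1 / y = -(1 / (y * (1 - y))) := by field_simp; ring
    have h3 : (2 : ℝ) / (2 * c) = 1 / c := by field_simp
    rw [h2, h3]
    have := one_div_le_one_div_of_le hc h1
    linarith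

lemma bern_smul {Φ : (X → ℝ) → ℝ} (hΦ : ∀ (c : ℝ) (u : X → ℝ), Φ (c • u) = c * Φ u)
    (m : X → ℝ) (c : ℝ) (u : X → ℝ) : bern m Φ (c • u) = c * bern m Φ u := by
  rw [bern_eq, bern_eq, mul_add, ← hΦ, ← hΦ]
  congr 2 <;> ext x <;> simp [mul_assoc]

/-- The mutual information of a Bernoulli observation is bounded by the variance of its mean. -/
lemma ent_sub_le_bern_ent {m : X → ℝ} {a b c : ℝ} (ha : 0 < a) (hb : b < 1) (hc : 0 < c)
    (h : ∀ y ∈ Set.Icc a b, c ≤ y * (1 - y)) (hm : ∀ x, m x ∈ Set.Icc a b) {u : X → ℝ}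
    (hu : 0 ≤ u) : ent u - spread (Matrix.vecMulVec m m) u / (2 * c) ≤ bern m ent u := by
  obtain ⟨v, huv, hv, hv1⟩ := smul_normalize hu
  rcases eq_or_ne (∑ x, u x) 0 with h0 | h0
  · rw [eq_zero_of_sum_eq_zero hu h0, ent_zero, spread_zero, bern_eq]
    simp [show (fun _ : X => (0 : ℝ)) = 0 from rfl, ent_zero]
  have hs : 0 ≤ ∑ x, u x := Finset.sum_nonneg fun x _ => hu x
  replace hv1 := hv1 h0
  rw [huv, bern_smul ent_smul, ent_smul, spread_smul_right, mul_div_assoc, ← mul_sub]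
  refine mul_le_mul_of_nonneg_left ?_ hs
  have hJ := (convexOn_binEntropy_add_sq ha hb hc h).map_sum_le (t := Finset.univ) (w := v)
    (p := m) (fun x _ => hv x) hv1 (fun x _ => hm x)
  simp only [smul_eq_mul, mul_add, Finset.sum_add_distrib] at hJ
  have hq1 : ∑ x, v x * (1 - m x) = 1 - ∑ x, v x * m x := by
    simp only [mul_sub, mul_one, Finset.sum_sub_distrib, hv1]
  have hE : bern m ent v = ent v + ∑ x, v x * Real.binEntropy (m x)
      - Real.binEntropy (∑ x, v x * m x) := by
    rw [bern_eq]
    simp only [ent, hq1, hv1, Real.negMulLog_one, sub_zero,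
      Real.binEntropy_eq_negMulLog_add_negMulLog_one_sub, Real.negMulLog_mul]
    have : ∑ x, (m x * Real.negMulLog (v x) + v x * Real.negMulLog (m x))
        + ∑ x, ((1 - m x) * Real.negMulLog (v x) + v x * Real.negMulLog (1 - m x))
        = ∑ x, Real.negMulLog (v x)
          + ∑ x, v x * (Real.negMulLog (m x) + Real.negMulLog (1 - m x)) := by
      rw [← Finset.sum_add_distrib, ← Finset.sum_add_distrib]
      exact Finset.sum_congr rfl fun x _ => by ring
    linarith
  rw [hE, spread_vecMulVec, hv1, div_one]
  have e1 : ∑ x, v x * (m x ^ 2 / (2 * c)) = (∑ x, v x * (m x * m x)) / (2 * c) := by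
    rw [Finset.sum_div]
    exact Finset.sum_congr rfl fun x _ => by ring
  rw [e1, sq] at hJ
  rw [sub_div]
  linarith

lemma spread_affine (α β : ℝ) (f u : X → ℝ) (hu : 0 ≤ u) :
    spread (Matrix.vecMulVec (fun x => α + β * f x) (fun x => α + β * f x)) u
      = β ^ 2 * spread (Matrix.vecMulVec f f) u := by
  rcases eq_or_ne (∑ x, u x) 0 with h | h
  · rw [eq_zero_of_sum_eq_zero hu h, spread_zero, spread_zero, mul_zero]
  rw [spread_vecMulVec, spread_vecMulVec]
  have e1 : ∑ x, u x * (α + β * f x) = α * ∑ x, u x + β * ∑ x, u x * f x := by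
    rw [Finset.mul_sum, Finset.mul_sum, ← Finset.sum_add_distrib]
    exact Finset.sum_congr rfl fun x _ => by ring
  have e2 : ∑ x, u x * ((α + β * f x) * (α + β * f x))
      = α ^ 2 * ∑ x, u x + 2 * α * β * ∑ x, u x * f x + β ^ 2 * ∑ x, u x * (f x * f x) := by
    rw [Finset.mul_sum, Finset.mul_sum, Finset.mul_sum, ← Finset.sum_add_distrib,
      ← Finset.sum_add_distrib]
    exact Finset.sum_congr rfl fun x _ => by ring
  rw [e1, e2]
  field_simp
  ring

variable {E : Type*} [DecidableEq E]

/-- The expected value of `Φ` at the posterior after independent Bernoulli observations with means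
`m e`, for `e ∈ s`. -/
def bernPow (m : E → X → ℝ) (s : Finset E) (Φ : (X → ℝ) → ℝ) (u : X → ℝ) : ℝ :=
  ∑ t ∈ s.powerset, Φ fun x => u x * ((∏ e ∈ t, m e x) * ∏ e ∈ s \ t, (1 - m e x))

lemma bernPow_empty (m : E → X → ℝ) (Φ : (X → ℝ) → ℝ) (u : X → ℝ) : bernPow m ∅ Φ u = Φ u := by
  simp [bernPow]

lemma bernPow_insert (m : E → X → ℝ) {s : Finset E} {e : E} (he : e ∉ s) (Φ : (X → ℝ) → ℝ)
    (u : X → ℝ) : bernPow m (insert e s) Φ u = bernPow m s (bern (m e) Φ) u := by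
  simp only [bernPow, bern_eq]
  rw [Finset.sum_powerset_insert he, ← Finset.sum_add_distrib]
  refine Finset.sum_congr rfl fun _ ht => ?_
  have het := fun h => he (Finset.mem_powerset.1 ht h)
  rw [add_comm]
  congr 2
  · ext x
    rw [Finset.prod_insert het, Finset.insert_sdiff_insert, Finset.sdiff_insert_of_notMem he]
    ring
  · ext x
    rw [Finset.insert_sdiff_of_notMem _ het, Finset.prod_insert (by simp [he])]
    ring

variable {m : E → X → ℝ} {s : Finset E} {Φ Ψ : (X → ℝ) → ℝ} {u : X → ℝ}

lemma bernPow_mono (h0 : ∀ e x, 0 ≤ m e x) (h1 : ∀ e x, m e x ≤ 1)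
    (h : ∀ u : X → ℝ, 0 ≤ u → Φ u ≤ Ψ u) (hu : 0 ≤ u) : bernPow m s Φ u ≤ bernPow m s Ψ u :=
  Finset.sum_le_sum fun _ _ => h _ fun x => mul_nonneg (hu x) (mul_nonneg
    (Finset.prod_nonneg fun e _ => h0 e x)
    (Finset.prod_nonneg fun e _ => sub_nonneg.2 (h1 e x)))

lemma bernPow_sub_mass (m : E → X → ℝ) (s : Finset E) (Φ : (X → ℝ) → ℝ) (c : ℝ) (u : X → ℝ) :
    bernPow m s (fun u => Φ u - c * ∑ x, u x) u = bernPow m s Φ u - c * ∑ x, u x := by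
  have h : bernPow m s (fun u => ∑ x, u x) u = ∑ x, u x := by
    induction s using Finset.induction_on with
    | empty => exact bernPow_empty _ _ _
    | insert e s he ih =>
      rw [bernPow_insert m he]
      convert ih using 2
      ext v
      rw [bern_eq, ← Finset.sum_add_distrib]
      exact Finset.sum_congr rfl fun x _ => by ring
  conv_rhs => rw [← h]
  simp only [bernPow, Finset.sum_sub_distrib, Finset.mul_sum]

variable [DecidableEq X]

/-- Bernoulli observations can be replaced one at a time by Gaussian observations. -/
lemma gauss_le_bernPow {K : Matrix X X ℝ} {Ke : E → Matrix X X ℝ} {η : ℝ}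
    (h0 : ∀ e x, 0 ≤ m e x) (h1 : ∀ e x, m e x ≤ 1) (hK : K.PosSemidef)
    (hKe : ∀ e, (Ke e).PosSemidef)
    (h : ∀ e, ∀ v : X → ℝ, 0 ≤ v → gauss (Ke e) ent v - η * ∑ x, v x ≤ bern (m e) ent v)
    (hu : 0 ≤ u) :
    gauss (K + ∑ e ∈ s, Ke e) ent u - s.card * η * ∑ x, u x ≤ bernPow m s (gauss K ent) u := by
  -- `K` varies because every edge that has been exchanged is added to the Gaussian part.
  induction s using Finset.induction_on generalizing K with
  | empty => simp [bernPow_empty]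
  | insert e s he ih =>
    have hlg : LinearGrowth fun v : X → ℝ => gauss (Ke e) ent v - η * ∑ x, v x :=
      (ent_linearGrowth.gauss (hKe e)).sub (LinearGrowth.mass.const_mul η)
    have hb := isLik_bern (h0 e) (h1 e)
    have step : ∀ v : X → ℝ, 0 ≤ v →
        gauss (K + Ke e) ent v - η * ∑ x, v x ≤ bern (m e) (gauss K ent) v := by
      intro v hv
      -- With the Gaussian observations made first, the one-edge hypothesis applies to each
      -- posterior that they produce.
      have e1 : bern (m e) (gauss K ent) v = gauss K (bern (m e) ent) v :=
        bayes_comm hb (isLik_gauss hK) ent_linearGrowth hv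
      have e2 : gauss K (fun v => gauss (Ke e) ent v - η * ∑ x, v x) v
          = gauss (K + Ke e) ent v - η * ∑ x, v x := by
        rw [gauss_add hK (hKe e) ent_linearGrowth hv]
        rw [show gauss K = bayes _ _ from rfl, bayes_sub (isLik_gauss hK) (ent_linearGrowth.gauss (hKe e))
          (LinearGrowth.mass.const_mul η) hv, bayes_const_mul, bayes_mass (isLik_gauss hK)]
      rw [e1, ← e2]
      exact bayes_mono (isLik_gauss hK) hlg (ent_linearGrowth.bayes hb) (h e) hv
    have h2 := ih (hK.add (hKe e))
    have h3 := bernPow_mono (s := s) h0 h1 step hu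
    rw [bernPow_sub_mass] at h3
    rw [bernPow_insert m he, Finset.sum_insert he, Finset.card_insert_of_notMem he, ← add_assoc]
    push_cast
    linarith

/-- A product of Bernoulli observations as a single observation. -/
lemma bayes_prod_bernLik [Fintype E] (m : E → X → ℝ) (Φ : (X → ℝ) → ℝ) (u : X → ℝ) :
    bayes (Measure.count : Measure (E → Bool)) (fun x g => ∏ e, bernLik (m e) x (g e)) Φ u
      = bernPow m Finset.univ Φ u := by
  have h : ∀ (g : E → Bool) x, ∏ e, bernLik (m e) x (g e)
      = (∏ e with g e = true, m e x) * ∏ e ∈ Finset.univ \ ({e | g e = true} : Finset E), (1 - m e x) := by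
    intro g x
    have : ∀ e, bernLik (m e) x (g e) = if g e = true then m e x else 1 - m e x := fun e => by
      cases g e <;> simp [bernLik]
    simp only [this, Finset.prod_ite]
    congr 1
    refine Finset.prod_congr ?_ fun _ _ => rfl
    ext e
    simp
  simp only [bayes, bernPow, integral_countable Integrable.of_finite, tsum_fintype, h]
  simp only [measureReal_def, Measure.count_singleton, ENNReal.toReal_one, one_smul]
  refine Finset.sum_bij' (fun g _ => ({e | g e = true} : Finset E))
    (fun t _ e => decide (e ∈ t)) ?_ ?_ ?_ ?_ ?_ <;> simp

end Bernoulli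

/-! ### Mutual information and conditional covariance in terms of posteriors -/

section Bridge

variable {X Ω Ω' β : Type*} [Fintype X] [MeasurableSpace Ω] [MeasurableSpace Ω']
  [MeasurableSpace β]

/-- The probability measure with density `l x`. -/
def lawOf (μ : Measure Ω) (l : X → Ω → ℝ) (x : X) : Measure Ω :=
  μ.withDensity fun ω => ENNReal.ofReal (l x ω)

/-- The joint law of `(e x, ω)` under `mixture w κ`. -/
def labelled (w : X → ℝ≥0∞) (κ : X → Measure Ω) (e : X → β) : Measure (β × Ω) :=
  ∑ x, w x • (κ x).map (Prod.mk (e x))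

variable {μ : Measure Ω} {l : X → Ω → ℝ} {w : X → ℝ≥0∞} {e : X → β}

lemma isProbabilityMeasure_lawOf (hl : IsLik μ l) (x : X) :
    IsProbabilityMeasure (lawOf μ l x) := ⟨by
  rw [lawOf, withDensity_apply _ MeasurableSet.univ, Measure.restrict_univ,
    ← ofReal_integral_eq_lintegral_ofReal (hl.integrable x) (Eventually.of_forall (hl.nonneg x)),
    hl.integral_eq_one, ENNReal.ofReal_one]⟩

lemma lintegral_lawOf (hl : IsLik μ l) (x : X) {F : Ω → ℝ≥0∞} (hF : Measurable F) :
    ∫⁻ ω, F ω ∂lawOf μ l x = ∫⁻ ω, F ω * ENNReal.ofReal (l x ω) ∂μ := by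
  rw [lawOf, lintegral_withDensity_eq_lintegral_mul _ (hl.measurable x).ennreal_ofReal hF]
  simp only [Pi.mul_apply, mul_comm]

lemma integrable_lawOf (hl : IsLik μ l) (x : X) (F : Ω → ℝ) :
    Integrable F (lawOf μ l x) ↔ Integrable (fun ω => F ω * l x ω) μ := by
  rw [lawOf, integrable_withDensity_iff (hl.measurable x).ennreal_ofReal
    (Eventually.of_forall fun ω => ENNReal.ofReal_lt_top)]
  simp only [ENNReal.toReal_ofReal (hl.nonneg x _)]

lemma integral_lawOf (hl : IsLik μ l) (x : X) (F : Ω → ℝ) :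
    ∫ ω, F ω ∂lawOf μ l x = ∫ ω, F ω * l x ω ∂μ := by
  rw [lawOf, integral_withDensity_eq_integral_toReal_smul (hl.measurable x).ennreal_ofReal
    (Eventually.of_forall fun ω => ENNReal.ofReal_lt_top)]
  simp only [ENNReal.toReal_ofReal (hl.nonneg x _), smul_eq_mul, mul_comm]

lemma lintegral_labelled (hl : IsLik μ l) {F : β × Ω → ℝ≥0∞} (hF : Measurable F) :
    ∫⁻ p, F p ∂labelled w (lawOf μ l) e
      = ∑ x, w x * ∫⁻ ω, F (e x, ω) * ENNReal.ofReal (l x ω) ∂μ := by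
  rw [labelled, lintegral_finsetSum_measure]
  refine Finset.sum_congr rfl fun x _ => ?_
  rw [lintegral_smul_measure, lintegral_map hF measurable_prodMk_left,
    lintegral_lawOf hl x (F := fun ω => F (e x, ω)) (hF.comp measurable_prodMk_left), smul_eq_mul]

lemma integrable_labelled_aux (hw : ∀ x, w x ≠ ∞) (hl : IsLik μ l) {F : β × Ω → ℝ}
    (hF : Measurable F)
    (hint : ∀ x, Integrable (fun ω => (w x).toReal * (F (e x, ω) * l x ω)) μ) (x : X) :
    Integrable F (w x • (lawOf μ l x).map (Prod.mk (e x))) := by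
  rcases eq_or_ne (w x) 0 with h | h
  · rw [h, zero_smul]; exact integrable_zero_measure
  refine Integrable.smul_measure ?_ (hw x)
  rw [integrable_map_measure hF.aestronglyMeasurable measurable_prodMk_left.aemeasurable,
    integrable_lawOf hl]
  have h' : (w x).toReal ≠ 0 := ENNReal.toReal_ne_zero.2 ⟨h, hw x⟩
  have := (hint x).const_mul (w x).toReal⁻¹
  simpa only [inv_mul_cancel_left₀ h', Function.comp_apply] using this

lemma integrable_labelled (hw : ∀ x, w x ≠ ∞) (hl : IsLik μ l) {F : β × Ω → ℝ}
    (hF : Measurable F)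
    (hint : ∀ x, Integrable (fun ω => (w x).toReal * (F (e x, ω) * l x ω)) μ) :
    Integrable F (labelled w (lawOf μ l) e) := by
  rw [labelled, integrable_finsetSum_measure]
  exact fun x _ => integrable_labelled_aux hw hl hF hint x

lemma integral_labelled (hw : ∀ x, w x ≠ ∞) (hl : IsLik μ l) {F : β × Ω → ℝ}
    (hF : Measurable F)
    (hint : ∀ x, Integrable (fun ω => (w x).toReal * (F (e x, ω) * l x ω)) μ) :
    ∫ p, F p ∂labelled w (lawOf μ l) e
      = ∫ ω, ∑ x, (w x).toReal * (F (e x, ω) * l x ω) ∂μ := by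
  rw [labelled, integral_finsetSum_measure fun x _ => integrable_labelled_aux hw hl hF hint x,
    integral_finsetSum _ fun x _ => hint x]
  refine Finset.sum_congr rfl fun x _ => ?_
  rw [integral_smul_measure, integral_map measurable_prodMk_left.aemeasurable
    hF.aestronglyMeasurable, integral_lawOf hl, integral_const_mul, smul_eq_mul]

lemma ent_eq_sum_mul_negMulLog {u : X → ℝ} (hu : 0 ≤ u) :
    ent u = ∑ x, (∑ y, u y) * Real.negMulLog (u x / ∑ y, u y) := by
  rcases eq_or_ne (∑ y, u y) 0 with h | h
  · rw [eq_zero_of_sum_eq_zero hu h, ent_zero]; simp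
  have h1 : ∀ x, Real.negMulLog (u x) = u x / (∑ y, u y) * Real.negMulLog (∑ y, u y)
      + (∑ y, u y) * Real.negMulLog (u x / ∑ y, u y) := fun x => by
    rw [← Real.negMulLog_mul, mul_div_cancel₀ _ h]
  rw [ent]
  simp only [h1, Finset.sum_add_distrib, ← Finset.sum_mul, ← Finset.sum_div, div_self h]
  ring

/-- With respect to the product of the marginals, the joint law has density `l x ω / m ω` at `(e x,
ω)`, where `m` is the marginal density. By Bayes' rule this is posterior over prior weight, so its
expected logarithm is a difference of entropies. Injectivity makes `e x` as informative as `x`. -/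
lemma toReal_klDiv_labelled [SigmaFinite μ] [MeasurableSingletonClass β] (hw : ∑ x, w x = 1)
    (hl : IsLik μ l) (he : Function.Injective e) :
    (InformationTheory.klDiv (labelled w (lawOf μ l) e)
      ((∑ x, w x • Measure.dirac (e x)).prod (∑ x, w x • lawOf μ l x))).toReal
      = ent (fun x => (w x).toReal) - bayes μ l ent fun x => (w x).toReal := by
  classical
  have hwt : ∀ x, w x ≠ ∞ := fun x => ne_top_of_le_ne_top ENNReal.one_ne_top
    (hw ▸ Finset.single_le_sum (fun _ _ => zero_le) (Finset.mem_univ x))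
  have hprob := isProbabilityMeasure_lawOf hl
  have hκ : IsProbabilityMeasure (∑ x, w x • lawOf μ l x) := ⟨by
    simp [Measure.finsetSum_apply, hw]⟩
  have hδ : IsProbabilityMeasure (∑ x, w x • Measure.dirac (e x)) := ⟨by
    simp [Measure.finsetSum_apply, hw]⟩
  have hJ : IsProbabilityMeasure (labelled w (lawOf μ l) e) := ⟨by
    have : ∀ x, ((lawOf μ l x).map (Prod.mk (e x))) Set.univ = 1 := fun x => by
      rw [Measure.map_apply measurable_prodMk_left MeasurableSet.univ]; simp
    simp [labelled, Measure.finsetSum_apply, hw, this]⟩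
  set Q := (∑ x, w x • Measure.dirac (e x)).prod (∑ x, w x • lawOf μ l x) with hQ
  set J := labelled w (lawOf μ l) e with hJ_def
  set m : Ω → ℝ≥0∞ := fun ω => ∑ x, w x * ENNReal.ofReal (l x ω) with hm
  have hmm : Measurable m :=
    Finset.measurable_sum _ fun x _ => (hl.measurable x).ennreal_ofReal.const_mul _
  have hmt : ∀ ω, m ω ≠ ∞ := fun ω =>
    (ENNReal.sum_lt_top.2 fun x _ => ENNReal.mul_lt_top (hwt x).lt_top ENNReal.ofReal_lt_top).ne
  -- The sum of indicators defines the density on all of `β × Ω` without an inverse of `e`. By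
  -- injectivity, one term remains at `(e x, ω)`.
  set ρ : β × Ω → ℝ≥0∞ := fun p =>
    ∑ x, (if p.1 = e x then 1 else 0) * (ENNReal.ofReal (l x p.2) / m p.2) with hρ
  have hρm : Measurable ρ := by
    refine Finset.measurable_sum _ fun x _ => Measurable.mul ?_ ?_
    · exact Measurable.ite (measurable_fst (measurableSet_singleton (e x))) measurable_const
        measurable_const
    · exact ((hl.measurable x).ennreal_ofReal.comp measurable_snd).div (hmm.comp measurable_snd)
  have hρe : ∀ x ω, ρ (e x, ω) = ENNReal.ofReal (l x ω) / m ω := fun x ω => by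
    simp only [hρ]
    rw [Finset.sum_eq_single x (fun y _ hy => by rw [if_neg (fun h => hy (he h).symm), zero_mul])
      (by simp)]
    simp
  have hJQ : J = Q.withDensity ρ := by
    ext s hs
    rw [withDensity_apply _ hs, ← lintegral_indicator hs,
      lintegral_prod _ (hρm.indicator hs).aemeasurable, lintegral_finsetSum_measure,
      ← lintegral_indicator_one hs, hJ_def, lintegral_labelled hl (measurable_one.indicator hs)]
    refine Finset.sum_congr rfl fun y _ => ?_
    rw [lintegral_smul_measure, lintegral_dirac' _
      (Measurable.lintegral_prod_right' (hρm.indicator hs)), lintegral_finsetSum_measure, smul_eq_mul]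
    rcases eq_or_ne (w y) 0 with hy | hy
    · simp [hy]
    congr 1
    have hmi : Measurable fun ω => s.indicator ρ (e y, ω) :=
      (hρm.indicator hs).comp measurable_prodMk_left
    have h1 : ∀ x, ∫⁻ ω, s.indicator ρ (e y, ω) ∂(w x • lawOf μ l x)
        = ∫⁻ ω, s.indicator ρ (e y, ω) * (w x * ENNReal.ofReal (l x ω)) ∂μ := fun x => by
      rw [lintegral_smul_measure, lintegral_lawOf hl x hmi, smul_eq_mul]
      exact (lintegral_const_mul (w x) (hmi.mul (hl.measurable x).ennreal_ofReal)).symm.trans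
        (lintegral_congr fun ω => by simp only [Pi.mul_apply]; ring)
    simp only [h1]
    have h2 := lintegral_finsetSum (μ := μ) Finset.univ
      (f := fun x ω => s.indicator ρ (e y, ω) * (w x * ENNReal.ofReal (l x ω)))
      fun x _ => hmi.mul ((hl.measurable x).ennreal_ofReal.const_mul (w x))
    rw [← h2]
    refine lintegral_congr fun ω => ?_
    rw [← Finset.mul_sum]
    change _ = _ * m ω
    by_cases hs' : (e y, ω) ∈ s
    · simp only [Set.indicator_of_mem hs', hρe, Pi.one_apply, one_mul]
      rcases eq_or_ne (m ω) 0 with h0 | h0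
      · have : w y * ENNReal.ofReal (l y ω) = 0 :=
          Finset.sum_eq_zero_iff.1 h0 y (Finset.mem_univ y)
        rw [h0, mul_zero]
        exact (mul_eq_zero.1 this).resolve_left hy
      · rw [ENNReal.div_mul_cancel h0 (hmt ω)]
    · simp [Set.indicator_of_notMem hs']
  have hac : J ≪ Q := hJQ ▸ withDensity_absolutelyContinuous _ _
  rw [InformationTheory.toReal_klDiv_of_measure_eq hac (by simp)]
  have hllr : llr J Q =ᵐ[J] fun p => Real.log (ρ p).toReal := by
    refine hac.ae_le ?_
    filter_upwards [Measure.rnDeriv_withDensity Q hρm] with p hp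
    rw [llr, hJQ, hp]
  rw [integral_congr_ae hllr]
  set u : X → ℝ := fun x => (w x).toReal with hu_def
  have hu : 0 ≤ u := fun x => ENNReal.toReal_nonneg
  have hu1 : ∑ x, u x = 1 := by
    rw [hu_def, ← ENNReal.toReal_sum fun x _ => hwt x, hw, ENNReal.toReal_one]
  set M : Ω → ℝ := fun ω => ∑ x, u x * l x ω with hM
  have hmM : ∀ ω, (m ω).toReal = M ω := fun ω => by
    rw [hm, ENNReal.toReal_sum fun x _ => ENNReal.mul_ne_top (hwt x) ENNReal.ofReal_ne_top]
    exact Finset.sum_congr rfl fun x _ => by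
      rw [ENNReal.toReal_mul, ENNReal.toReal_ofReal (hl.nonneg x ω)]
  -- `u x * l x ω / M ω` is the posterior weight of `x`. When `u x` or `l x ω` is zero, both sides
  -- vanish by the conventions for `log 0` and `negMulLog 0`.
  have hterm : ∀ x ω, u x * (Real.log (ρ (e x, ω)).toReal * l x ω)
      = l x ω * Real.negMulLog (u x) - M ω * Real.negMulLog (u x * l x ω / M ω) := by
    intro x ω
    rw [hρe, ENNReal.toReal_div, hmM, ENNReal.toReal_ofReal (hl.nonneg x ω)]
    rcases (hu x).eq_or_lt with h0 | h0
    · simp [← h0]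
    rcases (hl.nonneg x ω).eq_or_lt with h1 | h1
    · simp [← h1]
    have h2 : 0 < M ω := lt_of_lt_of_le (mul_pos h0 h1) (Finset.single_le_sum
      (f := fun x => u x * l x ω) (fun y _ => mul_nonneg (hu y) (hl.nonneg y ω)) (Finset.mem_univ x))
    simp only [Pi.zero_apply] at h0
    rw [Real.negMulLog, Real.negMulLog, Real.log_div (mul_pos h0 h1).ne' h2.ne',
      Real.log_mul h0.ne' h1.ne', Real.log_div h1.ne' h2.ne']
    field_simp
    ring
  have hMm : Measurable M := Finset.measurable_sum _ fun x _ => (hl.measurable x).const_mul _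
  have hMint : Integrable M μ := integrable_finsetSum _ fun x _ => (hl.integrable x).const_mul _
  have hint1 : ∀ x, Integrable (fun ω => M ω * Real.negMulLog (u x * l x ω / M ω)) μ := by
    intro x
    refine hMint.mono' (hMm.mul (Real.continuous_negMulLog.measurable.comp
      (((hl.measurable x).const_mul _).div hMm))).aestronglyMeasurable
      (Eventually.of_forall fun ω => ?_)
    have hM0 : 0 ≤ M ω := Finset.sum_nonneg fun y _ => mul_nonneg (hu y) (hl.nonneg y ω)
    have ht0 : 0 ≤ u x * l x ω / M ω := div_nonneg (mul_nonneg (hu x) (hl.nonneg x ω)) hM0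
    have ht1 : u x * l x ω / M ω ≤ 1 := div_le_one_of_le₀ (Finset.single_le_sum
      (f := fun x => u x * l x ω) (fun y _ => mul_nonneg (hu y) (hl.nonneg y ω))
      (Finset.mem_univ x)) hM0
    rw [Real.norm_eq_abs, abs_mul, abs_of_nonneg hM0,
      abs_of_nonneg (Real.negMulLog_nonneg ht0 ht1)]
    refine mul_le_of_le_one_right hM0 ?_
    have := Real.negMulLog_le_one_sub_self ht0
    linarith
  have hint : ∀ x, Integrable (fun ω => u x * (Real.log (ρ (e x, ω)).toReal * l x ω)) μ := by
    intro x
    simp only [hterm]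
    exact ((hl.integrable x).mul_const _).sub (hint1 x)
  rw [hJ_def, integral_labelled hwt hl hρm.ennreal_toReal.log hint]
  have hpt : ∀ ω, ∑ x, u x * (Real.log (ρ (e x, ω)).toReal * l x ω)
      = ∑ x, l x ω * Real.negMulLog (u x) - ent fun x => u x * l x ω := by
    intro ω
    rw [ent_eq_sum_mul_negMulLog (hl.mul_nonneg hu ω), ← Finset.sum_sub_distrib]
    exact Finset.sum_congr rfl fun x _ => hterm x ω
  change ∫ ω, ∑ x, u x * (Real.log (ρ (e x, ω)).toReal * l x ω) ∂μ = _
  simp only [hpt]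
  rw [integral_sub (integrable_finsetSum _ fun x _ => (hl.integrable x).mul_const _)
    (ent_linearGrowth.integrable hl hu),
    integral_finsetSum _ fun x _ => (hl.integrable x).mul_const _]
  congr 1
  rw [ent, hu1, Real.negMulLog_one, sub_zero]
  refine Finset.sum_congr rfl fun x _ => ?_
  rw [integral_mul_const, hl.integral_eq_one, one_mul]

/-- The mutual information is the expected decrease of the entropy of the posterior. -/
lemma mutualInfo_mixture [MeasurableSpace X] [SigmaFinite μ] [MeasurableSingletonClass β]
    (hw : ∑ x, w x = 1) (hl : IsLik μ l) (he : Function.Injective e) (hem : Measurable e)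
    {κ : X → Measure Ω'} [∀ x, IsProbabilityMeasure (κ x)] {V : Ω' → Ω} (hV : Measurable V)
    (hκ : ∀ x, (κ x).map V = lawOf μ l x) :
    mutualInfo (mixture w κ) (fun p => e p.1) (fun p => V p.2)
      = ent (fun x => (w x).toReal) - bayes μ l ent fun x => (w x).toReal := by
  have h1 : (mixture w κ).map (fun p => (e p.1, V p.2)) = labelled w (lawOf μ l) e := by
    rw [mixture, Measure.map_finset_sum (by fun_prop), labelled]
    refine Finset.sum_congr rfl fun x _ => ?_
    rw [Measure.map_smul, Measure.map_map (by fun_prop) (by fun_prop), ← hκ,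
      Measure.map_map (by fun_prop) hV]
    rfl
  have h2 : (mixture w κ).map (fun p => e p.1) = ∑ x, w x • Measure.dirac (e x) := by
    rw [mixture, Measure.map_finset_sum (by fun_prop)]
    refine Finset.sum_congr rfl fun x _ => ?_
    rw [Measure.map_smul, Measure.map_map (by fun_prop) (by fun_prop)]
    congr 1
    simp [Function.comp_def]
  have h3 : (mixture w κ).map (fun p => V p.2) = ∑ x, w x • lawOf μ l x := by
    rw [mixture, Measure.map_finset_sum (by fun_prop)]
    refine Finset.sum_congr rfl fun x _ => ?_
    rw [Measure.map_smul, Measure.map_map (by fun_prop) (by fun_prop), ← hκ]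
    rfl
  rw [mutualInfo, h1, h2, h3, toReal_klDiv_labelled hw hl he]

lemma mixture_eq_labelled [MeasurableSpace X] (w : X → ℝ≥0∞) (κ : X → Measure Ω) :
    mixture w κ = labelled w κ fun x => x := rfl

/-- The expected conditional covariance in terms of the posterior. -/
lemma expCondCov_mixture [MeasurableSpace X] [MeasurableSingletonClass X] {d : ℕ}
    (hw : ∑ x, w x = 1) (hl : IsLik μ l) (f : X → Fin d → ℝ) (a b : Fin d) :
    expCondCov (mixture w (lawOf μ l)) (fun p => f p.1) (fun p => p.2) a b
      = bayes μ l (spread (Matrix.vecMulVec (fun x => f x a) (fun x => f x b)))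
          fun x => (w x).toReal := by
  have hwt : ∀ x, w x ≠ ∞ := fun x => ne_top_of_le_ne_top ENNReal.one_ne_top
    (hw ▸ Finset.single_le_sum (fun _ _ => zero_le) (Finset.mem_univ x))
  have hprob := isProbabilityMeasure_lawOf hl
  set u : X → ℝ := fun x => (w x).toReal with hu_def
  have hu : 0 ≤ u := fun x => ENNReal.toReal_nonneg
  set P := mixture w (lawOf μ l) with hP
  have : IsProbabilityMeasure P := ⟨by
    have : ∀ x, ((lawOf μ l x).map (Prod.mk x)) Set.univ = 1 := fun x => by
      rw [Measure.map_apply measurable_prodMk_left MeasurableSet.univ]; simp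
    simp [hP, mixture, Measure.finsetSum_apply, hw, this]⟩
  set M : Ω → ℝ := fun ω => ∑ x, u x * l x ω with hM
  -- The posterior mean of coordinate `a`. It is 0 by convention where `M` vanishes, which is
  -- harmless because all weights vanish there.
  set F : Fin d → Ω → ℝ := fun a ω => (∑ x, u x * l x ω * f x a) / M ω with hF
  have hMm : Measurable M := Finset.measurable_sum _ fun x _ => (hl.measurable x).const_mul _
  have hFm : ∀ a, Measurable (F a) := fun a =>
    (Finset.measurable_sum _ fun x _ => ((hl.measurable x).const_mul _).mul_const _).div hMm
  have hM0 : ∀ ω, 0 ≤ M ω := fun ω =>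
    Finset.sum_nonneg fun y _ => mul_nonneg (hu y) (hl.nonneg y ω)
  have hfm : ∀ a, Measurable fun p : X × Ω => f p.1 a := fun a =>
    (measurable_of_countable fun x => f x a).comp measurable_fst
  have hFb : ∀ a, ∃ C, ∀ ω, |F a ω| ≤ C := by
    intro a
    refine ⟨∑ x, |f x a|, fun ω => ?_⟩
    rw [hF, abs_div, abs_of_nonneg (hM0 ω)]
    refine div_le_of_le_mul₀ (hM0 ω) (by positivity) ?_
    refine (Finset.abs_sum_le_sum_abs _ _).trans ?_
    rw [hM, Finset.mul_sum]
    refine Finset.sum_le_sum fun x _ => ?_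
    rw [abs_mul, abs_of_nonneg (mul_nonneg (hu x) (hl.nonneg x ω)), mul_comm]
    exact mul_le_mul_of_nonneg_right (Finset.single_le_sum (f := fun y => |f y a|)
      (fun _ _ => abs_nonneg _) (Finset.mem_univ x)) (mul_nonneg (hu x) (hl.nonneg x ω))
  have hint : ∀ G : X × Ω → ℝ, Measurable G → (∃ C, ∀ p, |G p| ≤ C) → ∀ x,
      Integrable (fun ω => u x * (G (x, ω) * l x ω)) μ := by
    rintro G hG ⟨C, hC⟩ x
    refine Integrable.const_mul ?_ _
    exact (hl.integrable x).bdd_mul (hG.comp measurable_prodMk_left).aestronglyMeasurable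
      (Eventually.of_forall fun ω => hC (x, ω))
  have hfb : ∀ a, ∃ C, ∀ p : X × Ω, |f p.1 a| ≤ C := fun a =>
    ⟨∑ x, |f x a|, fun p => Finset.single_le_sum (f := fun y => |f y a|)
      (fun _ _ => abs_nonneg _) (Finset.mem_univ p.1)⟩
  have hfint : ∀ a, Integrable (fun p : X × Ω => f p.1 a) P := fun a =>
    integrable_labelled hwt hl (hfm a) (hint _ (hfm a) (hfb a))
  have hFm' : ∀ a, Measurable fun p : X × Ω => F a p.2 := fun a => (hFm a).comp measurable_snd
  have hFb' : ∀ a, ∃ C, ∀ p : X × Ω, |F a p.2| ≤ C := fun a => by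
    obtain ⟨C, hC⟩ := hFb a
    exact ⟨C, fun p => hC p.2⟩
  have hm : MeasurableSpace.comap (fun p : X × Ω => p.2) inferInstance
      ≤ (inferInstance : MeasurableSpace (X × Ω)) :=
    measurable_snd.comap_le
  have hpost : ∀ a ω, (∑ x, u x * l x ω * f x a) = ∑ x, u x * (F a ω * l x ω) := by
    intro a ω
    have : ∑ x, u x * (F a ω * l x ω) = F a ω * M ω := by
      rw [hM, Finset.mul_sum]; exact Finset.sum_congr rfl fun x _ => by ring
    rw [this]
    rcases eq_or_ne (M ω) 0 with h | h
    · rw [h, mul_zero]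
      have h2 := eq_zero_of_sum_eq_zero (hl.mul_nonneg hu ω) h
      refine Finset.sum_eq_zero fun x _ => ?_
      rw [show u x * l x ω = 0 from congrFun h2 x, zero_mul]
    · rw [hF, div_mul_cancel₀ _ h]
  have hcond : ∀ a, (fun p : X × Ω => F a p.2)
      =ᵐ[P] P[fun p => f p.1 a | MeasurableSpace.comap (fun p : X × Ω => p.2) inferInstance] := by
    intro a
    have hFint := integrable_labelled hwt hl (hFm' a) (hint _ (hFm' a) (hFb' a))
    refine ae_eq_condExp_of_forall_setIntegral_eq hm (hfint a)
      (fun s _ _ => hFint.integrableOn) ?_ ?_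
    · rintro _ ⟨t, ht, rfl⟩ _
      have hs : MeasurableSet ((fun p : X × Ω => p.2) ⁻¹' t) := measurable_snd ht
      have key : ∀ G : X × Ω → ℝ, Measurable G → (∃ C, ∀ p, |G p| ≤ C) →
          ∫ p in (fun p : X × Ω => p.2) ⁻¹' t, G p ∂P
            = ∫ ω, t.indicator (fun ω => ∑ x, u x * (G (x, ω) * l x ω)) ω ∂μ := by
        intro G hG hGb
        rw [← integral_indicator hs, hP, mixture_eq_labelled,
          integral_labelled hwt hl (hG.indicator hs)]
        · refine integral_congr_ae (Eventually.of_forall fun ω => ?_)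
          by_cases h : ω ∈ t
          · simp [h]; rfl
          · simp [h]
        · refine hint _ (hG.indicator hs) ?_
          obtain ⟨C, hC⟩ := hGb
          exact ⟨C, fun p => by
            by_cases h : p.2 ∈ t <;> simp [h, hC, (abs_nonneg _).trans (hC p)]⟩
      rw [key _ (hFm' a) (hFb' a), key _ (hfm a) (hfb a)]
      congr 1
      ext ω
      congr 1
      ext ω
      rw [← hpost]
      exact Finset.sum_congr rfl fun x _ => by ring
    · exact ((hFm a).comp (comap_measurable _)).aestronglyMeasurable
  have hgoal : expCondCov P (fun p => f p.1) (fun p => p.2) a b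
      = ∫ p, (f p.1 a - F a p.2) * (f p.1 b - F b p.2) ∂P := by
    rw [expCondCov, Matrix.of_apply]
    unfold condCov
    rw [integral_condExp hm]
    refine integral_congr_ae ?_
    filter_upwards [hcond a, hcond b] with p ha hb
    simp only [Pi.mul_apply, Pi.sub_apply]
    rw [← ha, ← hb]
  have hGm : Measurable fun p : X × Ω => (f p.1 a - F a p.2) * (f p.1 b - F b p.2) :=
    ((hfm a).sub (hFm' a)).mul ((hfm b).sub (hFm' b))
  rw [hgoal, hP, mixture_eq_labelled, integral_labelled hwt hl hGm]
  · refine integral_congr_ae (Eventually.of_forall fun ω => ?_)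
    simp only
    rw [spread_vecMulVec]
    have h1 := hpost a ω
    have h2 := hpost b ω
    change _ = ∑ x, u x * l x ω * (f x a * f x b) - (∑ x, u x * l x ω * f x a)
      * (∑ x, u x * l x ω * f x b) / M ω
    rw [mul_div_assoc]
    change _ = _ - _ * F b ω
    -- The product is expanded so that the last bracket is the mass-weighted posterior mean of the
    -- centred coordinate `b`, which is zero.
    have e1 : ∑ x, (w x).toReal * ((f x a - F a ω) * (f x b - F b ω) * l x ω)
        = ∑ x, u x * l x ω * (f x a * f x b) - (∑ x, u x * l x ω * f x a) * F b ω
          - F a ω * (∑ x, u x * l x ω * f x b - ∑ x, u x * (F b ω * l x ω)) := by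
      rw [← Finset.sum_sub_distrib, Finset.mul_sum, Finset.sum_mul, ← Finset.sum_sub_distrib,
        ← Finset.sum_sub_distrib]
      exact Finset.sum_congr rfl fun x _ => by ring
    rw [e1, h2, sub_self, mul_zero, sub_zero]
  · refine hint _ hGm ?_
    obtain ⟨C, hC⟩ := hfb a
    obtain ⟨C', hC'⟩ := hfb b
    obtain ⟨D, hD⟩ := hFb' a
    obtain ⟨D', hD'⟩ := hFb' b
    refine ⟨(C + D) * (C' + D'), fun p => ?_⟩
    rw [abs_mul]
    have h3 := (abs_nonneg _).trans (hC p)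
    have h4 := (abs_nonneg _).trans (hD p)
    exact mul_le_mul ((abs_sub _ _).trans (add_le_add (hC p) (hD p)))
      ((abs_sub _ _).trans (add_le_add (hC' p) (hD' p))) (abs_nonneg _) (by positivity)

end Bridge

/-! ### Product experiments -/

section Product

variable {ι : Type*} [Fintype ι]

lemma pi_withDensity {Ω : ι → Type*} [∀ i, MeasurableSpace (Ω i)] {μ : ∀ i, Measure (Ω i)}
    [∀ i, SigmaFinite (μ i)] {f : ∀ i, Ω i → ℝ} (h0 : ∀ i ω, 0 ≤ f i ω) (hf : ∀ i, Integrable (f i) (μ i)) :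
    Measure.pi (fun i => (μ i).withDensity fun ω => ENNReal.ofReal (f i ω))
      = (Measure.pi μ).withDensity fun ω => ENNReal.ofReal (∏ i, f i (ω i)) := by
  refine Measure.pi_eq fun s hs => ?_
  rw [withDensity_apply _ (MeasurableSet.univ_pi hs), Measure.restrict_pi_pi,
    ← ofReal_integral_eq_lintegral_ofReal, integral_fintype_prod_eq_prod,
    ENNReal.ofReal_prod_of_nonneg fun i _ => integral_nonneg (h0 i)]
  · refine Finset.prod_congr rfl fun i _ => ?_
    rw [withDensity_apply _ (hs i), ← ofReal_integral_eq_lintegral_ofReal (hf i).restrict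
      (Eventually.of_forall (h0 i))]
  · exact Integrable.fintype_prod_dep fun i => (hf i).restrict
  · exact Eventually.of_forall fun ω => Finset.prod_nonneg fun i _ => h0 i _

variable {X : Type*}

lemma IsLik.pi {Ω : ι → Type*} [∀ i, MeasurableSpace (Ω i)] {μ : ∀ i, Measure (Ω i)}
    [∀ i, SigmaFinite (μ i)] {Y : ι → Type*} {l : ∀ i, Y i → Ω i → ℝ}
    (hl : ∀ i, IsLik (μ i) (l i)) (π : ∀ i, X → Y i) :
    IsLik (Measure.pi μ) fun x ω => ∏ i, l i (π i x) (ω i) where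
  measurable x := Finset.measurable_prod _ fun i _ =>
    ((hl i).measurable (π i x)).comp (measurable_pi_apply i)
  nonneg x ω := Finset.prod_nonneg fun i _ => (hl i).nonneg _ _
  integrable x := Integrable.fintype_prod_dep fun i => (hl i).integrable _
  integral_eq_one x := by
    rw [integral_fintype_prod_eq_prod]
    exact Finset.prod_eq_one fun i _ => (hl i).integral_eq_one _

lemma lawOf_pi {Ω : ι → Type*} [∀ i, MeasurableSpace (Ω i)] {μ : ∀ i, Measure (Ω i)}
    [∀ i, SigmaFinite (μ i)] {Y : ι → Type*} {l : ∀ i, Y i → Ω i → ℝ}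
    (hl : ∀ i, IsLik (μ i) (l i)) (π : ∀ i, X → Y i) (x : X) :
    lawOf (Measure.pi μ) (fun x ω => ∏ i, l i (π i x) (ω i)) x
      = Measure.pi fun i => lawOf (μ i) (l i) (π i x) :=
  (pi_withDensity (fun i => (hl i).nonneg _)
    (fun i => (hl i).integrable _)).symm

lemma lawOf_prod {Ω Ω' : Type*} [MeasurableSpace Ω] [MeasurableSpace Ω'] {μ : Measure Ω}
    {ν : Measure Ω'} [SigmaFinite μ] [SigmaFinite ν] {l : X → Ω → ℝ} {l' : X → Ω' → ℝ}
    (hl : IsLik μ l) (hl' : IsLik ν l') (x : X) :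
    lawOf (μ.prod ν) (fun x p => l x p.1 * l' x p.2) x = (lawOf μ l x).prod (lawOf ν l' x) := by
  rw [lawOf, lawOf, lawOf, prod_withDensity (hl.measurable x).ennreal_ofReal
    (hl'.measurable x).ennreal_ofReal]
  congr 1
  ext p
  rw [ENNReal.ofReal_mul (hl.nonneg x _)]

lemma negMulLog_prod [DecidableEq ι] (s : Finset ι) (t : ι → ℝ) :
    Real.negMulLog (∏ j ∈ s, t j)
      = ∑ i ∈ s, ∏ j ∈ s, if j = i then Real.negMulLog (t j) else t j := by
  induction s using Finset.induction_on with
  | empty => simp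
  | insert a s ha ih =>
    rw [Finset.prod_insert ha, Real.negMulLog_mul, ih, Finset.sum_insert ha,
      Finset.prod_insert ha, if_pos rfl, Finset.mul_sum, mul_comm]
    congr 1
    · congr 1
      exact Finset.prod_congr rfl fun j hj => by
        rw [if_neg]; rintro rfl; exact ha hj
    · refine Finset.sum_congr rfl fun i hi => ?_
      rw [Finset.prod_insert ha, if_neg]
      rintro rfl
      exact ha hi

variable [Fintype X]

/-- By the Leibniz rule `negMulLog_prod`, each summand applies `negMulLog` to one factor only. The
masses of the other factors remain because the weights are not normalized. -/
lemma ent_prod [DecidableEq ι] (v : ι → X → ℝ) :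
    ent (fun x : ι → X => ∏ i, v i (x i))
      = ∑ i, ∏ j, if j = i then ent (v j) else ∑ y, v j y := by
  have h : ∀ F : ι → X → ℝ, ∑ x : ι → X, ∏ i, F i (x i) = ∏ i, ∑ y, F i y := fun F => by
    rw [Finset.prod_univ_sum, Fintype.piFinset_univ]
  have e1 : ∀ i, ∑ x : ι → X, ∏ j, (if j = i then Real.negMulLog (v j (x j)) else v j (x j))
      = ∏ j, if j = i then ∑ y, Real.negMulLog (v j y) else ∑ y, v j y := fun i => by
    rw [h fun j y => if j = i then Real.negMulLog (v j y) else v j y]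
    refine Finset.prod_congr rfl fun j _ => ?_
    split_ifs <;> rfl
  rw [ent, h]
  simp only [negMulLog_prod]
  rw [Finset.sum_comm, ← Finset.sum_sub_distrib]
  refine Finset.sum_congr rfl fun i _ => ?_
  rw [e1, ← Finset.mul_prod_erase Finset.univ _ (Finset.mem_univ i),
    ← Finset.mul_prod_erase Finset.univ (fun j => if j = i then Real.negMulLog (∑ y, v j y)
      else ∑ y, v j y) (Finset.mem_univ i),
    ← Finset.mul_prod_erase Finset.univ (fun j => if j = i then ent (v j)
      else ∑ y, v j y) (Finset.mem_univ i)]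
  have e2 : ∀ f : ι → ℝ, ∏ j ∈ Finset.univ.erase i, (if j = i then f j else ∑ y, v j y)
      = ∏ j ∈ Finset.univ.erase i, ∑ y, v j y := fun f =>
    Finset.prod_congr rfl fun j hj => if_neg (Finset.ne_of_mem_erase hj)
  rw [e2, e2, e2, if_pos rfl, if_pos rfl, if_pos rfl, ent, sub_mul]

/-- Additivity of the conditional entropy over independent observations of independent labels. -/
lemma bayes_pi_ent [DecidableEq ι] {Ω : Type*} [MeasurableSpace Ω] {μ : Measure Ω} [SigmaFinite μ]
    {l : X → Ω → ℝ} (hl : IsLik μ l) {p : X → ℝ} (hp : 0 ≤ p) (hp1 : ∑ a, p a = 1) :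
    bayes (Measure.pi fun _ : ι => μ) (fun (x : ι → X) ω => ∏ i, l (x i) (ω i)) ent
      (fun x => ∏ i, p (x i)) = Fintype.card ι * bayes μ l ent p := by
  simp only [bayes, ← Finset.prod_mul_distrib]
  have h1 : ∀ ω : ι → Ω, ent (fun x : ι → X => ∏ i, p (x i) * l (x i) (ω i))
      = ∑ i, ∏ j, (if j = i then ent else fun u => ∑ y, u y) fun y => p y * l y (ω j) := by
    intro ω
    rw [ent_prod fun i y => p y * l y (ω i)]
    refine Finset.sum_congr rfl fun i _ => Finset.prod_congr rfl fun j _ => ?_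
    split_ifs <;> rfl
  have hlg : ∀ i j : ι, LinearGrowth (if j = i then ent else fun u : X → ℝ => ∑ y, u y) := by
    intro i j
    split_ifs
    exacts [ent_linearGrowth, LinearGrowth.mass]
  simp only [h1]
  rw [integral_finsetSum _ fun i _ => Integrable.fintype_prod_dep
    fun j => (hlg i j).integrable hl hp]
  have h2 : ∀ i : ι, ∫ ω : ι → Ω, ∏ j, (if j = i then ent else fun u : X → ℝ => ∑ y, u y)
      (fun y => p y * l y (ω j)) ∂Measure.pi (fun _ => μ) = bayes μ l ent p := by
    intro i
    rw [integral_fintype_prod_eq_prod (fun j ω => (if j = i then ent else fun u : X → ℝ =>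
      ∑ y, u y) (fun y => p y * l y ω)), Finset.prod_eq_single i]
    · rw [if_pos rfl]; rfl
    · intro j _ hj
      rw [if_neg hj]
      exact (bayes_mass hl p).trans hp1
    · simp
  simp only [h2, Finset.sum_const, Finset.card_univ, nsmul_eq_mul, bayes]

/-- Independent Gaussian vectors. -/
lemma IsGaussVec.pi {Y : Type*} [Fintype Y] {Ω : Type*} [MeasurableSpace Ω] {μ : Measure Ω}
    [IsProbabilityMeasure μ] {g : Y → Ω → ℝ} {K : Matrix Y Y ℝ} (hg : IsGaussVec μ g K)
    (π : ι → X → Y) :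
    IsGaussVec (Measure.pi fun _ : ι => μ) (fun x ω => ∑ i, g (π i x) (ω i))
      (∑ i, K.submatrix (π i) (π i)) where
  measurable x := Finset.measurable_sum _ fun i _ =>
    (hg.measurable (π i x)).comp (measurable_pi_apply i)
  posSemidef := Matrix.posSemidef_sum _ fun i _ => hg.posSemidef.submatrix _
  charFun c := by
    classical
    have h1 : ∀ i : ι, ∫ ω, Complex.exp (((∑ x, c x * g (π i x) ω : ℝ) : ℂ) * Complex.I) ∂μ
        = Complex.exp ((-(c ⬝ᵥ K.submatrix (π i) (π i) *ᵥ c) / 2 : ℝ) : ℂ) := by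
      intro i
      -- The coefficients are collected over the fibres of `π i`, since several parameters may share
      -- the same signal in component `i`.
      set c' : Y → ℝ := fun y => ∑ x with π i x = y, c x with hc'
      have key : ∀ f : Y → ℝ, ∑ x, c x * f (π i x) = ∑ y, c' y * f y := by
        intro f
        simp only [hc', Finset.sum_mul]
        rw [← Finset.sum_fiberwise Finset.univ (π i)]
        refine Finset.sum_congr rfl fun y _ => Finset.sum_congr rfl fun x hx => ?_
        rw [(Finset.mem_filter.1 hx).2]
      have h := hg.charFun c'
      have e2 : c ⬝ᵥ K.submatrix (π i) (π i) *ᵥ c = c' ⬝ᵥ K *ᵥ c' := by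
        have e3 : ∀ y, ∑ x, K y (π i x) * c x = (K *ᵥ c') y := fun y => by
          rw [Matrix.mulVec, dotProduct]
          simp only [mul_comm (K y _)]
          exact key fun z => K y z
        simp only [dotProduct, Matrix.mulVec, Matrix.submatrix_apply]
        rw [← key fun y => ∑ z, K y z * c' z]
        exact Finset.sum_congr rfl fun x _ => by rw [e3]; rfl
      rw [e2, ← h]
      refine integral_congr_ae (Eventually.of_forall fun ω => ?_)
      simp only
      rw [key fun y => g y ω]
    have h2 : ∀ ω : ι → Ω, Complex.exp (((∑ x, c x * ∑ i, g (π i x) (ω i) : ℝ) : ℂ) * Complex.I)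
        = ∏ i, Complex.exp (((∑ x, c x * g (π i x) (ω i) : ℝ) : ℂ) * Complex.I) := by
      intro ω
      rw [← Complex.exp_sum, ← Finset.sum_mul, ← Complex.ofReal_sum, Finset.sum_comm]
      simp only [Finset.mul_sum]
    simp only [h2]
    rw [integral_fintype_prod_eq_prod (fun i ω =>
      Complex.exp (((∑ x, c x * g (π i x) ω : ℝ) : ℂ) * Complex.I))]
    simp only [h1]
    rw [← Complex.exp_sum, ← Complex.ofReal_sum]
    congr 2
    rw [Matrix.sum_mulVec, dotProduct_sum, ← Finset.sum_div, Finset.sum_neg_distrib]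

lemma pi_count {α : ι → Type*} [∀ i, Fintype (α i)] [∀ i, MeasurableSpace (α i)]
    [∀ i, MeasurableSingletonClass (α i)] :
    Measure.pi (fun i => (Measure.count : Measure (α i))) = Measure.count := by
  refine Measure.ext_of_singleton fun f => ?_
  rw [Measure.pi_singleton]
  simp

end Product

/-! ### The observations of the model as experiments -/

section StandardNormal

variable {ι Y : Type*} [Fintype ι] [Fintype Y]

lemma isGaussVec_stdNormal (b : Y → ι → ℝ) :
    IsGaussVec (Measure.pi fun _ : ι => gaussianReal 0 1) (fun y z => b y ⬝ᵥ z)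
      (Matrix.of fun y y' => b y ⬝ᵥ b y') where
  measurable y := by unfold dotProduct; fun_prop
  posSemidef := by
    have h := Matrix.posSemidef_self_mul_conjTranspose (Matrix.of b)
    convert h using 1
    ext y y'
    simp [Matrix.mul_apply, dotProduct]
  charFun c := by
    set a : ι → ℝ := fun i => ∑ y, c y * b y i with ha
    have h1 : ∀ z : ι → ℝ, Complex.exp (((∑ y, c y * (b y ⬝ᵥ z) : ℝ) : ℂ) * Complex.I)
        = ∏ i, Complex.exp (((a i * z i : ℝ) : ℂ) * Complex.I) := by
      intro z
      rw [← Complex.exp_sum, ← Finset.sum_mul, ← Complex.ofReal_sum]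
      congr 3
      simp only [dotProduct, ha, Finset.mul_sum, Finset.sum_mul]
      rw [Finset.sum_comm]
      exact Finset.sum_congr rfl fun i _ => Finset.sum_congr rfl fun y _ => by ring
    simp only [h1]
    rw [integral_fintype_prod_eq_prod (fun i t => Complex.exp (((a i * t : ℝ) : ℂ) * Complex.I))]
    have h2 : ∀ i, ∫ t, Complex.exp (((a i * t : ℝ) : ℂ) * Complex.I) ∂gaussianReal 0 1
        = Complex.exp ((-(a i * a i) / 2 : ℝ) : ℂ) := by
      intro i
      have := charFun_gaussianReal (μ := 0) (v := 1) (a i)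
      rw [charFun_apply_real] at this
      push_cast
      rw [this]
      congr 1
      simp
      ring
    simp only [h2]
    rw [← Complex.exp_sum, ← Complex.ofReal_sum]
    congr 2
    rw [← Finset.sum_div, Finset.sum_neg_distrib]
    congr 2
    simp only [dotProduct, Matrix.mulVec, Matrix.of_apply, ha, Finset.mul_sum,
      Finset.sum_mul]
    rw [Finset.sum_comm]
    refine Finset.sum_congr rfl fun y _ => ?_
    rw [Finset.sum_comm]
    exact Finset.sum_congr rfl fun y' _ => Finset.sum_congr rfl fun i _ => by ring

/-- Completing the square: the Cameron-Martin formula in dimension one. It makes the law of the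
noise a reference measure common to all labels. -/
lemma gaussianReal_withDensity_exp (c : ℝ) :
    (gaussianReal 0 1).withDensity (fun t => ENNReal.ofReal (Real.exp (c * t - c * c / 2)))
      = gaussianReal c 1 := by
  rw [gaussianReal_of_var_ne_zero _ one_ne_zero, gaussianReal_of_var_ne_zero _ one_ne_zero,
    ← withDensity_mul _ (measurable_gaussianPDF 0 1) (by fun_prop)]
  congr 1
  ext t
  simp only [Pi.mul_apply, gaussianPDF]
  rw [← ENNReal.ofReal_mul (gaussianPDFReal_nonneg 0 1 t)]
  congr 1
  simp only [gaussianPDFReal, mul_assoc, ← Real.exp_add]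
  congr 2
  simp
  ring

lemma lawOf_stdNormal (b : Y → ι → ℝ) (y : Y) :
    lawOf (Measure.pi fun _ : ι => gaussianReal 0 1)
      (gaussLik (Matrix.of fun y y' => b y ⬝ᵥ b y') fun y z => b y ⬝ᵥ z) y
      = (Measure.pi fun _ : ι => gaussianReal 0 1).map fun z => b y + z := by
  have h1 : (Measure.pi fun _ : ι => gaussianReal 0 1).map (fun z => b y + z)
      = Measure.pi fun i => gaussianReal (b y i) 1 := by
    have h := Measure.pi_map_pi (μ := fun _ : ι => gaussianReal 0 1)
      (f := fun i t => b y i + t) fun i => by fun_prop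
    simp only [gaussianReal_map_const_add, zero_add] at h
    exact h
  have hexp : ∀ c : ℝ, Integrable (fun t => Real.exp (c * t - c * c / 2)) (gaussianReal 0 1) := by
    intro c
    simp only [sub_eq_add_neg, Real.exp_add]
    exact (integrable_exp_mul_gaussianReal c).mul_const _
  rw [h1]
  simp only [← gaussianReal_withDensity_exp (b y _)]
  rw [pi_withDensity (fun i t => (Real.exp_pos _).le) (fun i => hexp (b y i)), lawOf]
  congr 1
  ext z
  simp only [gaussLik, Matrix.of_apply, dotProduct, ← Real.exp_sum, Finset.sum_sub_distrib,
    Finset.sum_div]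

end StandardNormal

namespace LabelModel

variable {k L : ℕ} {𝒴 : Type*} [MeasurableSpace 𝒴] (M : LabelModel k 𝒴)

instance (a : Fin k) : IsProbabilityMeasure (M.cov a) := M.isProb a

/-- A measure that dominates the conditional laws of the covariate. -/
def covRef : Measure 𝒴 := ∑ a, M.cov a

instance : IsFiniteMeasure M.covRef := by unfold covRef; infer_instance

/-- The densities of the conditional laws of the covariate. -/
def covLik (a : Fin k) (y : 𝒴) : ℝ := ((M.cov a).rnDeriv M.covRef y).toReal

lemma cov_absolutelyContinuous (a : Fin k) : M.cov a ≪ M.covRef :=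
  Measure.absolutelyContinuous_of_le
    (Finset.single_le_sum (f := M.cov) (fun _ _ => Measure.zero_le _) (Finset.mem_univ a))

lemma lawOf_cov (a : Fin k) : lawOf M.covRef M.covLik a = M.cov a := by
  conv_rhs => rw [← Measure.withDensity_rnDeriv_eq _ _ (M.cov_absolutelyContinuous a)]
  refine withDensity_congr_ae ?_
  filter_upwards [Measure.rnDeriv_lt_top (M.cov a) M.covRef] with y hy
  rw [covLik, ENNReal.ofReal_toReal hy.ne]

lemma isLik_cov : IsLik M.covRef M.covLik where
  measurable a := (Measure.measurable_rnDeriv _ _).ennreal_toReal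
  nonneg a y := ENNReal.toReal_nonneg
  integrable a := Measure.integrable_toReal_rnDeriv
  integral_eq_one a := by
    unfold covLik
    rw [Measure.integral_toReal_rnDeriv (M.cov_absolutelyContinuous a)]
    simp

/-- The Gram matrix `μ_aᵀ S μ_b` of the label embeddings. -/
def gram (S : Matrix (Fin (k - 1)) (Fin (k - 1)) ℝ) : Matrix (Fin k) (Fin k) ℝ :=
  Matrix.of fun a b => M.emb a ⬝ᵥ S *ᵥ M.emb b

lemma gram_apply (S : Matrix (Fin (k - 1)) (Fin (k - 1)) ℝ) (a b : Fin k) :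
    M.gram S a b = M.emb a ⬝ᵥ S *ᵥ M.emb b := rfl

lemma gram_add (S T : Matrix (Fin (k - 1)) (Fin (k - 1)) ℝ) :
    M.gram (S + T) = M.gram S + M.gram T := by
  ext a b
  simp [gram_apply, Matrix.add_mulVec]

lemma gram_smul (c : ℝ) (S : Matrix (Fin (k - 1)) (Fin (k - 1)) ℝ) :
    M.gram (c • S) = c • M.gram S := by
  ext a b
  simp [gram_apply, Matrix.smul_mulVec]

lemma gram_posSemidef {S : Matrix (Fin (k - 1)) (Fin (k - 1)) ℝ} (hS : S.PosSemidef) :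
    (M.gram S).PosSemidef := by
  convert hS.mul_mul_conjTranspose_same (Matrix.of M.emb) using 1
  ext a b
  rw [gram_apply, Matrix.mul_assoc, Matrix.mul_apply]
  simp [dotProduct, Matrix.mul_apply, Matrix.mulVec]

open scoped MatrixOrder Matrix.Norms.L2Operator in
lemma gram_eq_sqrt {S : Matrix (Fin (k - 1)) (Fin (k - 1)) ℝ} (hS : S.PosSemidef) :
    M.gram S = Matrix.of fun a b => (CFC.sqrt S *ᵥ M.emb a) ⬝ᵥ (CFC.sqrt S *ᵥ M.emb b) := by
  have h1 : (CFC.sqrt S).IsHermitian := (Matrix.nonneg_iff_posSemidef.1 (CFC.sqrt_nonneg S)).isHermitian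
  have h2 : CFC.sqrt S * CFC.sqrt S = S := CFC.sqrt_mul_sqrt_self S hS.nonneg
  have h3 : (CFC.sqrt S)ᵀ = CFC.sqrt S := by simpa [Matrix.IsHermitian] using h1
  ext a b
  rw [gram_apply, Matrix.of_apply, Matrix.dotProduct_mulVec (CFC.sqrt S *ᵥ M.emb a),
    ← Matrix.mulVec_transpose, h3, Matrix.mulVec_mulVec, h2, Matrix.dotProduct_mulVec,
    ← Matrix.mulVec_transpose, show Sᵀ = S by simpa [Matrix.IsHermitian] using hS.isHermitian]

open scoped MatrixOrder in
/-- The inner product of the Gaussian noise with the signal for the label `a`. -/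
def signal (S : Matrix (Fin (k - 1)) (Fin (k - 1)) ℝ) (a : Fin k) (z : Fin (k - 1) → ℝ) : ℝ :=
  (CFC.sqrt S *ᵥ M.emb a) ⬝ᵥ z

/-- The law of the Gaussian noise. -/
def noise (k : ℕ) : Measure (Fin (k - 1) → ℝ) := Measure.pi fun _ => gaussianReal 0 1

instance : IsProbabilityMeasure (noise k) := by unfold noise; infer_instance

lemma isGaussVec_signal {S : Matrix (Fin (k - 1)) (Fin (k - 1)) ℝ} (hS : S.PosSemidef) :
    IsGaussVec (noise k) (M.signal S) (M.gram S) := by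
  rw [M.gram_eq_sqrt hS]
  exact isGaussVec_stdNormal _

lemma lawOf_signal {S : Matrix (Fin (k - 1)) (Fin (k - 1)) ℝ} (hS : S.PosSemidef) (a : Fin k) :
    lawOf (noise k) (gaussLik (M.gram S) (M.signal S)) a = M.gaussLaw S a := by
  rw [M.gram_eq_sqrt hS]
  exact lawOf_stdNormal _ a

/-- The prior of a label. -/
def weight (a : Fin k) : ℝ := (M.p a).toReal

lemma weight_nonneg : 0 ≤ M.weight := fun _ => ENNReal.toReal_nonneg

lemma sum_p : ∑ a, M.p a = 1 := by rw [← M.p.tsum_coe, tsum_fintype]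

lemma sum_weight : ∑ a, M.weight a = 1 := by
  unfold weight
  rw [← ENNReal.toReal_sum fun a _ => M.p.apply_ne_top a, M.sum_p, ENNReal.toReal_one]

/-- The matrix `F` with rows `(1, emb a)` is square, since there are `k` points in dimension `k -
1`. Normalization, centring and whitening say together that the weighted transpose `G` is a left
inverse of `F`. Hence `F` is invertible and its rows are distinct. -/
lemma emb_injective : Function.Injective M.emb := by
  intro a b hab
  by_contra hne
  have hk : Fintype.card (Option (Fin (k - 1))) = Fintype.card (Fin k) := by
    have := a.pos
    simp
    omega
  set F : Matrix (Fin k) (Option (Fin (k - 1))) ℝ :=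
    Matrix.of fun a o => o.elim 1 (M.emb a) with hF
  set G : Matrix (Option (Fin (k - 1))) (Fin k) ℝ :=
    Matrix.of fun o a => M.weight a * F a o with hG
  have hc : ∀ i, ∑ a, M.weight a * M.emb a i = 0 := fun i => by
    have := congrFun M.centered i
    simpa [weight] using this
  have hw : ∀ i j, ∑ a, M.weight a * (M.emb a i * M.emb a j)
      = (1 : Matrix (Fin (k - 1)) (Fin (k - 1)) ℝ) i j := fun i j => by
    have := congrFun (congrFun M.whitened i) j
    simpa [weight, Matrix.sum_apply, Matrix.vecMulVec_apply] using this
  have h1 : G * F = 1 := by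
    ext o o'
    rw [Matrix.mul_apply]
    rcases o with _ | i <;> rcases o' with _ | j
    · simp [hG, hF, M.sum_weight]
    · simpa [hG, hF] using hc j
    · simpa [hG, hF] using hc i
    · have := hw i j
      simp only [hG, hF, Matrix.of_apply, Option.elim_some, mul_assoc]
      rw [this]
      simp [Matrix.one_apply]
  have h2 : F * G = 1 := (Matrix.mul_eq_one_comm_of_card_eq _ _ _ hk.symm).2 h1
  have h3 : (F * G) a a = (F * G) b a := by
    simp only [Matrix.mul_apply]
    refine Finset.sum_congr rfl fun o _ => ?_
    congr 1
    simp only [hF, Matrix.of_apply, hab]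
  rw [h2, Matrix.one_apply_eq, Matrix.one_apply_ne (Ne.symm hne)] at h3
  exact one_ne_zero h3

/-- The conditional entropy of a label given its covariates. -/
def nodeEnt (S : Matrix (Fin (k - 1)) (Fin (k - 1)) ℝ) : ℝ :=
  bayes M.covRef M.covLik (gauss (M.gram S) ent) M.weight

lemma info_eq {S : Matrix (Fin (k - 1)) (Fin (k - 1)) ℝ} (hS : S.PosSemidef) :
    M.info S = ent M.weight - M.nodeEnt S := by
  have hg := M.isGaussVec_signal hS
  have hκ : ∀ a, (M.cov a).prod (M.gaussLaw S a) = lawOf (M.covRef.prod (noise k))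
      (fun a ω => M.covLik a ω.1 * gaussLik (M.gram S) (M.signal S) a ω.2) a := fun a => by
    rw [lawOf_prod M.isLik_cov hg.isLik, M.lawOf_cov, M.lawOf_signal hS]
  have : ∀ a, IsProbabilityMeasure ((M.cov a).prod (M.gaussLaw S a)) := fun a => by
    rw [hκ]; exact isProbabilityMeasure_lawOf (M.isLik_cov.prod hg.isLik) a
  have h := mutualInfo_mixture (κ := fun a => (M.cov a).prod (M.gaussLaw S a)) M.sum_p
    (M.isLik_cov.prod hg.isLik) M.emb_injective (measurable_of_countable _) measurable_id
    (fun a => by rw [Measure.map_id, hκ])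
  refine h.trans ?_
  change ent M.weight - bayes _ _ ent M.weight = _
  rw [bayes_prod M.isLik_cov hg.isLik ent_linearGrowth M.weight_nonneg, nodeEnt]
  congr 1
  exact congrArg (bayes _ _ · _) (funext fun u => bayes_gaussLik hg ent_linearGrowth.measurable u)

end LabelModel

/-! ### The networks -/

namespace LabelModel

variable {k L : ℕ} {𝒴 : Type*} [MeasurableSpace 𝒴] (M : LabelModel k 𝒴)
  (d : Fin L → ℕ → ℝ) (R : Fin L → Matrix (Fin (k - 1)) (Fin (k - 1)) ℝ) (n : ℕ)

/-- The prior of the labels. -/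
def prior (x : Fin n → Fin k) : ℝ := ∏ i, M.weight (x i)

/-- The densities of the conditional laws of the covariates. -/
def covsLik (x : Fin n → Fin k) (y : Fin n → 𝒴) : ℝ := ∏ i, M.covLik (x i) (y i)

/-- The Gram matrix of the Gaussian observations of all nodes. -/
def nodesGram (S : Matrix (Fin (k - 1)) (Fin (k - 1)) ℝ) :
    Matrix (Fin n → Fin k) (Fin n → Fin k) ℝ :=
  ∑ i, (M.gram S).submatrix (fun x => x i) fun x => x i

/-- The inner product of the Gaussian noise with the signal for the labels `x`. -/
def nodesSignal (S : Matrix (Fin (k - 1)) (Fin (k - 1)) ℝ) (x : Fin n → Fin k)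
    (z : Fin n → Fin (k - 1) → ℝ) : ℝ := ∑ i, M.signal S (x i) (z i)

/-- The conditional probability of an edge given the labels. -/
def edgeMean (e : Fin L × NodePair n) (x : Fin n → Fin k) : ℝ :=
  Set.projIcc (0 : ℝ) 1 zero_le_one (M.edgeProb n (d e.1 n) (R e.1) (x e.2.1.1) (x e.2.1.2))

/-- The probability mass function of the networks. -/
def netLik (x : Fin n → Fin k) (g : Fin L → Network n) : ℝ :=
  ∏ ℓ, ∏ e, bernLik (M.edgeMean d R n (ℓ, e)) x (g ℓ e)

/-- The counting measure on networks. -/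
def netRef (L n : ℕ) : Measure (Fin L → Network n) :=
  Measure.pi fun _ => Measure.pi fun _ => Measure.count

instance : SigmaFinite (netRef L n) := by unfold netRef; infer_instance

/-- The expected value of `Φ` at the posterior of the labels, given covariates and networks. -/
def base (Φ : ((Fin n → Fin k) → ℝ) → ℝ) : ℝ :=
  bayes (Measure.pi fun _ => M.covRef) (M.covsLik n) (bernPow (M.edgeMean d R n) Finset.univ Φ)
    (M.prior n)

lemma prior_nonneg : 0 ≤ M.prior n := fun _ => Finset.prod_nonneg fun _ _ => M.weight_nonneg _

lemma sum_prod_p : ∑ x : Fin n → Fin k, ∏ i, M.p (x i) = 1 := by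
  rw [← Fintype.piFinset_univ, ← Finset.prod_univ_sum]
  exact Finset.prod_eq_one fun _ _ => M.sum_p

lemma toReal_prod_p : (fun x : Fin n → Fin k => (∏ i, M.p (x i)).toReal) = M.prior n := by
  ext x
  rw [ENNReal.toReal_prod]
  rfl

lemma sum_prior : ∑ x, M.prior n x = 1 := by
  unfold prior
  rw [← Fintype.piFinset_univ, ← Finset.prod_univ_sum]
  exact Finset.prod_eq_one fun _ _ => M.sum_weight

lemma isLik_covs : IsLik (Measure.pi fun _ : Fin n => M.covRef) (M.covsLik n) :=
  IsLik.pi (fun _ => M.isLik_cov) fun i (x : Fin n → Fin k) => x i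

lemma lawOf_covs (x : Fin n → Fin k) :
    lawOf (Measure.pi fun _ : Fin n => M.covRef) (M.covsLik n) x
      = Measure.pi fun i => M.cov (x i) := by
  refine (lawOf_pi (fun _ => M.isLik_cov) (fun i (x : Fin n → Fin k) => x i) x).trans ?_
  simp only [M.lawOf_cov]

variable {S : Matrix (Fin (k - 1)) (Fin (k - 1)) ℝ}

lemma isGaussVec_nodes (hS : S.PosSemidef) :
    IsGaussVec (Measure.pi fun _ : Fin n => noise k) (M.nodesSignal n S) (M.nodesGram n S) :=
  (M.isGaussVec_signal hS).pi fun i (x : Fin n → Fin k) => x i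

lemma gaussLik_nodes (x : Fin n → Fin k) (z : Fin n → Fin (k - 1) → ℝ) :
    gaussLik (M.nodesGram n S) (M.nodesSignal n S) x z
      = ∏ i, gaussLik (M.gram S) (M.signal S) (x i) (z i) := by
  simp only [gaussLik, ← Real.exp_sum, Finset.sum_sub_distrib, ← Finset.sum_div, nodesGram,
    nodesSignal, Matrix.sum_apply, Matrix.submatrix_apply]

lemma lawOf_nodes (hS : S.PosSemidef) (x : Fin n → Fin k) :
    lawOf (Measure.pi fun _ : Fin n => noise k) (gaussLik (M.nodesGram n S) (M.nodesSignal n S)) x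
      = Measure.pi fun i => M.gaussLaw S (x i) := by
  have h := lawOf_pi (fun _ => (M.isGaussVec_signal hS).isLik)
    (fun i (x : Fin n → Fin k) => x i) x
  simp only [M.lawOf_signal hS] at h
  rw [← h]
  congr 1
  ext x z
  exact M.gaussLik_nodes n x z

lemma edgeMean_nonneg (e : Fin L × NodePair n) (x : Fin n → Fin k) : 0 ≤ M.edgeMean d R n e x :=
  (Set.projIcc (0 : ℝ) 1 zero_le_one _).2.1

lemma edgeMean_le_one (e : Fin L × NodePair n) (x : Fin n → Fin k) : M.edgeMean d R n e x ≤ 1 :=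
  (Set.projIcc (0 : ℝ) 1 zero_le_one _).2.2

lemma isLik_edge (e : Fin L × NodePair n) :
    IsLik Measure.count (bernLik (M.edgeMean d R n e)) :=
  isLik_bern (M.edgeMean_nonneg d R n e) (M.edgeMean_le_one d R n e)

lemma isLik_network (ℓ : Fin L) :
    IsLik (Measure.pi fun _ : NodePair n => Measure.count)
      fun x g => ∏ e, bernLik (M.edgeMean d R n (ℓ, e)) x (g e) :=
  IsLik.pi (fun e => M.isLik_edge d R n (ℓ, e)) fun _ x => x

lemma isLik_net : IsLik (netRef L n) (M.netLik d R n) :=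
  IsLik.pi (fun ℓ => M.isLik_network d R n ℓ) fun _ x => x

lemma lawOf_bernLik {X : Type*} [Fintype X] (m : X → ℝ) (x : X) (q : unitInterval)
    (h : m x = q) : lawOf Measure.count (bernLik m) x = bernoulliMeasure true false q := by
  refine Measure.ext_of_singleton fun b => ?_
  rw [lawOf, withDensity_apply _ (measurableSet_singleton b), Measure.restrict_singleton,
    lintegral_smul_measure, lintegral_dirac, Measure.count_singleton, one_smul,
    bernoulliMeasure_apply _ (measurableSet_singleton b)]
  cases b <;> simp [bernLik, h, ENNReal.ofReal, unitInterval.toNNReal, Real.toNNReal_of_nonneg,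
    q.2.1, q.2.2] <;> rfl

lemma lawOf_net (x : Fin n → Fin k) :
    lawOf (netRef L n) (M.netLik d R n) x
      = Measure.pi fun ℓ => M.networkLaw n (d ℓ n) (R ℓ) x := by
  refine (lawOf_pi (fun ℓ => M.isLik_network d R n ℓ) (fun _ x => x) x).trans ?_
  congr 1
  ext1 ℓ
  refine (lawOf_pi (fun e => M.isLik_edge d R n (ℓ, e)) (fun _ x => x) x).trans ?_
  unfold networkLaw
  congr 1
  ext1 e
  exact lawOf_bernLik _ _ _ rfl

lemma bayes_net (Φ : ((Fin n → Fin k) → ℝ) → ℝ) (u : (Fin n → Fin k) → ℝ) :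
    bayes (netRef L n) (M.netLik d R n) Φ u
      = bernPow (M.edgeMean d R n) Finset.univ Φ u := by
  have h : netRef L n = Measure.count := by
    rw [netRef, pi_count, pi_count]
  rw [← bayes_prod_bernLik, h]
  simp only [bayes, integral_countable Integrable.of_finite, tsum_fintype]
  simp only [measureReal_def, Measure.count_singleton, ENNReal.toReal_one, one_smul]
  refine Fintype.sum_equiv (Equiv.curry (Fin L) (NodePair n) Bool).symm _ _ fun g => ?_
  congr 1
  ext x
  rw [netLik, Fintype.prod_prod_type]
  rfl

lemma obsLaw_eq (hS : S.PosSemidef) (x : Fin n → Fin k) :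
    M.obsLaw d R n S x = lawOf ((Measure.pi fun _ : Fin n => M.covRef).prod
      ((Measure.pi fun _ : Fin n => noise k).prod (netRef L n)))
      (fun x ω => M.covsLik n x ω.1 * (gaussLik (M.nodesGram n S) (M.nodesSignal n S) x ω.2.1
        * M.netLik d R n x ω.2.2)) x := by
  have hg := (M.isGaussVec_nodes n hS).isLik
  rw [lawOf_prod (M.isLik_covs n) (hg.prod (M.isLik_net d R n)),
    lawOf_prod hg (M.isLik_net d R n), M.lawOf_covs, M.lawOf_nodes n hS, M.lawOf_net]
  rfl

/-- Given the labels, the Gaussian and the network observations are independent, so the Gaussian one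
can be made last. Side information therefore enters as `gauss` inside `base`. -/
lemma base_gauss (hS : S.PosSemidef) {Φ : ((Fin n → Fin k) → ℝ) → ℝ} (hΦ : LinearGrowth Φ) :
    bayes ((Measure.pi fun _ : Fin n => M.covRef).prod
      ((Measure.pi fun _ : Fin n => noise k).prod (netRef L n)))
      (fun x ω => M.covsLik n x ω.1 * (gaussLik (M.nodesGram n S) (M.nodesSignal n S) x ω.2.1
        * M.netLik d R n x ω.2.2)) Φ (M.prior n)
      = M.base d R n (gauss (M.nodesGram n S) Φ) := by
  have hg := (M.isGaussVec_nodes n hS).isLik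
  have hn := M.isLik_net d R n
  rw [bayes_prod (M.isLik_covs n) (hg.prod hn) hΦ (M.prior_nonneg n), base]
  refine bayes_congr (M.isLik_covs n) (fun u hu => ?_) (M.prior_nonneg n)
  rw [bayes_prod hg hn hΦ hu, bayes_comm hg hn hΦ hu, ← M.bayes_net]
  refine bayes_congr hn (fun v _ => ?_) hu
  exact bayes_gaussLik (M.isGaussVec_nodes n hS) hΦ.measurable v

lemma networkInfo_eq : M.networkInfo d R n = ent (M.prior n) - M.base d R n ent := by
  have hc := M.isLik_covs n
  have hn := M.isLik_net d R n
  have hobs : ∀ x, IsProbabilityMeasure (M.obsLaw d R n 0 x) := fun x => by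
    rw [M.obsLaw_eq d R n Matrix.PosSemidef.zero]
    exact isProbabilityMeasure_lawOf (hc.prod ((M.isGaussVec_nodes n
      Matrix.PosSemidef.zero).isLik.prod hn)) x
  have hg := (M.isGaussVec_nodes n Matrix.PosSemidef.zero).isLik
  have h := mutualInfo_mixture (κ := M.obsLaw d R n 0) (M.sum_prod_p n) (hc.prod hn)
    (e := fun x i => M.emb (x i)) (V := fun ω => (ω.1, ω.2.2))
    (fun x y hxy => funext fun i => M.emb_injective (congrFun hxy i))
    (measurable_of_countable _) (by fun_prop) (fun x => by
      have h1 := isProbabilityMeasure_lawOf hg x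
      have h2 := isProbabilityMeasure_lawOf hn x
      have h3 := isProbabilityMeasure_lawOf hc x
      rw [M.obsLaw_eq d R n Matrix.PosSemidef.zero, lawOf_prod hc (hg.prod hn),
        lawOf_prod hg hn, lawOf_prod hc hn]
      -- `Ỹ` is a separate factor of the law given the labels; projecting it away integrates out a
      -- probability measure.
      have e1 : (fun ω : (Fin n → 𝒴) × (Fin n → Fin (k - 1) → ℝ) × (Fin L → Network n) =>
          (ω.1, ω.2.2)) = Prod.map id Prod.snd := rfl
      rw [e1, ← Measure.map_prod_map _ _ measurable_id measurable_snd, Measure.map_id,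
        ← Measure.snd, Measure.snd_prod])
  refine h.trans ?_
  rw [M.toReal_prod_p, bayes_prod hc hn ent_linearGrowth (M.prior_nonneg n), base]
  congr 1
  exact congrArg (bayes _ _ · _) (funext fun u => M.bayes_net d R n ent u)

lemma jointLaw_eq (hS : S.PosSemidef) :
    M.jointLaw d R n S = mixture (fun x => ∏ i, M.p (x i))
      (lawOf ((Measure.pi fun _ : Fin n => M.covRef).prod
      ((Measure.pi fun _ : Fin n => noise k).prod (netRef L n)))
      (fun x ω => M.covsLik n x ω.1 * (gaussLik (M.nodesGram n S) (M.nodesSignal n S) x ω.2.1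
        * M.netLik d R n x ω.2.2))) := by
  rw [jointLaw]
  congr 1
  ext1 x
  exact M.obsLaw_eq d R n hS x

lemma expCondCov_eq (hS : S.PosSemidef) (i : Fin n) (a b : Fin (k - 1)) :
    expCondCov (M.jointLaw d R n S) (fun ω => M.emb (ω.1 i)) (fun ω => ω.2) a b
      = M.base d R n (gauss (M.nodesGram n S) (spread (Matrix.vecMulVec
        (fun x : Fin n → Fin k => M.emb (x i) a) fun x => M.emb (x i) b))) := by
  rw [M.jointLaw_eq d R n hS]
  refine (expCondCov_mixture (M.sum_prod_p n) ((M.isLik_covs n).prod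
    ((M.isGaussVec_nodes n hS).isLik.prod (M.isLik_net d R n)))
    (fun x : Fin n → Fin k => M.emb (x i)) a b).trans ?_
  rw [M.toReal_prod_p, M.base_gauss d R n hS (spread_linearGrowth _)]

/-! ### Averages over covariates and networks, and the MMSE matrix -/

variable {Φ Ψ : ((Fin n → Fin k) → ℝ) → ℝ}

lemma linearGrowth_bernPow (hΦ : LinearGrowth Φ) :
    LinearGrowth (bernPow (M.edgeMean d R n) Finset.univ Φ) := by
  rw [← funext (M.bayes_net d R n Φ)]
  exact hΦ.bayes (M.isLik_net d R n)

lemma base_mono (hΦ : LinearGrowth Φ) (hΨ : LinearGrowth Ψ)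
    (h : ∀ u : (Fin n → Fin k) → ℝ, 0 ≤ u → Φ u ≤ Ψ u) : M.base d R n Φ ≤ M.base d R n Ψ :=
  bayes_mono (M.isLik_covs n) (M.linearGrowth_bernPow d R n hΦ)
    (M.linearGrowth_bernPow d R n hΨ)
    (fun _ hu => bernPow_mono (M.edgeMean_nonneg d R n) (M.edgeMean_le_one d R n) h hu)
    (M.prior_nonneg n)

lemma base_eq_bayes (Φ : ((Fin n → Fin k) → ℝ) → ℝ) : M.base d R n Φ
    = bayes (Measure.pi fun _ => M.covRef) (M.covsLik n)
      (bayes (netRef L n) (M.netLik d R n) Φ) (M.prior n) := by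
  rw [base, ← funext (M.bayes_net d R n Φ)]

lemma base_sub (hΦ : LinearGrowth Φ) (hΨ : LinearGrowth Ψ) :
    M.base d R n (fun u => Φ u - Ψ u) = M.base d R n Φ - M.base d R n Ψ := by
  have hn := M.isLik_net d R n
  simp only [base_eq_bayes]
  rw [← bayes_sub (M.isLik_covs n) (hΦ.bayes hn) (hΨ.bayes hn) (M.prior_nonneg n)]
  exact bayes_congr (M.isLik_covs n) (fun u hu => bayes_sub hn hΦ hΨ hu) (M.prior_nonneg n)

lemma base_sum {ι : Type*} (s : Finset ι) {Φ : ι → ((Fin n → Fin k) → ℝ) → ℝ}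
    (hΦ : ∀ i ∈ s, LinearGrowth (Φ i)) :
    M.base d R n (fun u => ∑ i ∈ s, Φ i u) = ∑ i ∈ s, M.base d R n (Φ i) := by
  have hn := M.isLik_net d R n
  simp only [base_eq_bayes]
  rw [← bayes_sum s (M.isLik_covs n) (fun i hi => (hΦ i hi).bayes hn) (M.prior_nonneg n)]
  exact bayes_congr (M.isLik_covs n) (fun u hu => bayes_sum s hn hΦ hu) (M.prior_nonneg n)

lemma base_const_mul (c : ℝ) : M.base d R n (fun u => c * Φ u) = c * M.base d R n Φ := by
  simp only [base_eq_bayes]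
  rw [← bayes_const_mul]
  exact congrArg (bayes _ _ · _) (funext fun u => bayes_const_mul c)

lemma base_linear (a : (Fin n → Fin k) → ℝ) :
    M.base d R n (fun u => ∑ x, u x * a x) = ∑ x, M.prior n x * a x := by
  rw [base_eq_bayes, funext (bayes_linear (M.isLik_net d R n) a), bayes_linear (M.isLik_covs n)]

lemma nodesGram_posSemidef (hS : S.PosSemidef) : (M.nodesGram n S).PosSemidef :=
  (M.isGaussVec_nodes n hS).posSemidef

/-- The quadratic form of the MMSE matrix. -/
lemma dotProduct_mmse_mulVec (hS : S.PosSemidef) (v : Fin (k - 1) → ℝ) :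
    v ⬝ᵥ M.mmse d R n S *ᵥ v = 1 / n * M.base d R n (gauss (M.nodesGram n S)
      (spread (M.nodesGram n (Matrix.vecMulVec v v)))) := by
  have hK := M.nodesGram_posSemidef n hS
  have hgl := isLik_gauss hK
  have e1 : M.nodesGram n (Matrix.vecMulVec v v) = ∑ i, ∑ a, ∑ b, (v a * v b) •
      Matrix.vecMulVec (fun x : Fin n → Fin k => M.emb (x i) a) fun x => M.emb (x i) b := by
    ext x y
    simp only [nodesGram, Matrix.sum_apply, Matrix.submatrix_apply, gram_apply,
      Matrix.smul_apply, Matrix.vecMulVec_apply, smul_eq_mul, dotProduct, Matrix.mulVec,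
      Finset.mul_sum]
    exact Finset.sum_congr rfl fun i _ => Finset.sum_congr rfl fun a _ =>
      Finset.sum_congr rfl fun b _ => by ring
  have e2 : M.base d R n (gauss (M.nodesGram n S) (spread (M.nodesGram n (Matrix.vecMulVec v v))))
      = ∑ i, ∑ a, ∑ b, v a * v b * M.base d R n (gauss (M.nodesGram n S) (spread
        (Matrix.vecMulVec (fun x : Fin n → Fin k => M.emb (x i) a) fun x => M.emb (x i) b))) := by
    rw [e1]
    simp only [← base_const_mul]
    have hlg : ∀ (i : Fin n) (a b : Fin (k - 1)), LinearGrowth (spread (Matrix.vecMulVec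
        (fun x : Fin n → Fin k => M.emb (x i) a) fun x => M.emb (x i) b)) :=
      fun i a b => spread_linearGrowth _
    have hlg1 := fun i a b => ((hlg i a b).gauss hK).const_mul (v a * v b)
    have hlg2 := fun i a => LinearGrowth.sum Finset.univ fun b _ => hlg1 i a b
    have hlg3 := fun i => LinearGrowth.sum Finset.univ fun a _ => hlg2 i a
    simp only [← M.base_sum d R n Finset.univ fun b _ => hlg1 _ _ b]
    simp only [← M.base_sum d R n Finset.univ fun a _ => hlg2 _ a]
    rw [← M.base_sum d R n Finset.univ fun i _ => hlg3 i]
    refine bayes_congr (M.isLik_covs n) (fun u hu => ?_) (M.prior_nonneg n)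
    rw [← M.bayes_net, ← M.bayes_net]
    refine bayes_congr (M.isLik_net d R n) (fun w hw => ?_) hu
    simp only [spread_sum, spread_smul_left, gauss, funext (spread_sum _ _)]
    rw [bayes_sum _ hgl (fun i _ => LinearGrowth.sum _ fun a _ => LinearGrowth.sum _ fun b _ =>
      (hlg i a b).const_mul _) hw]
    refine Finset.sum_congr rfl fun i _ => ?_
    rw [bayes_sum _ hgl (fun a _ => LinearGrowth.sum _ fun b _ => (hlg i a b).const_mul _) hw]
    refine Finset.sum_congr rfl fun a _ => ?_
    rw [bayes_sum _ hgl (fun b _ => (hlg i a b).const_mul _) hw]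
    exact Finset.sum_congr rfl fun b _ => bayes_const_mul _
  rw [e2]
  simp only [mmse, Matrix.smul_mulVec, dotProduct_smul, smul_eq_mul, Matrix.sum_mulVec,
    dotProduct_sum]
  congr 1
  refine Finset.sum_congr rfl fun i _ => ?_
  simp only [dotProduct, Matrix.mulVec, Finset.mul_sum]
  refine Finset.sum_congr rfl fun a _ => Finset.sum_congr rfl fun b _ => ?_
  rw [M.expCondCov_eq d R n hS]
  ring

lemma mmse_isSymm (hS : S.PosSemidef) : (M.mmse d R n S).IsSymm := by
  ext a b
  simp only [mmse, Matrix.transpose_apply, Matrix.smul_apply, Matrix.sum_apply]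
  congr 1
  refine Finset.sum_congr rfl fun i _ => ?_
  rw [M.expCondCov_eq d R n hS, M.expCondCov_eq d R n hS]
  congr 2
  ext u
  simp only [spread_vecMulVec, mul_comm]

/-- Without networks, the nodes decouple. -/
lemma bayes_covs_gauss_ent (hS : S.PosSemidef) :
    bayes (Measure.pi fun _ => M.covRef) (M.covsLik n) (gauss (M.nodesGram n S) ent) (M.prior n)
      = n * M.nodeEnt S := by
  have hg := M.isGaussVec_signal hS
  have hgn := M.isGaussVec_nodes n hS
  have h := bayes_pi_ent (ι := Fin n) (M.isLik_cov.prod hg.isLik) M.weight_nonneg M.sum_weight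
  rw [Fintype.card_fin, bayes_prod M.isLik_cov hg.isLik ent_linearGrowth M.weight_nonneg,
    funext (bayes_gaussLik hg ent_linearGrowth.measurable)] at h
  rw [nodeEnt, ← h, ← funext (bayes_gaussLik hgn ent_linearGrowth.measurable),
    ← bayes_prod (M.isLik_covs n) hgn.isLik ent_linearGrowth (M.prior_nonneg n)]
  -- Regroups one pair of observations per node into a pair of families, so that additivity over
  -- independent nodes applies.
  rw [bayes, ← (measurePreserving_arrowProdEquivProdArrow 𝒴 (Fin (k - 1) → ℝ) (Fin n)
    (fun _ => M.covRef) fun _ => noise k).integral_comp']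
  refine integral_congr_ae (Eventually.of_forall fun ω => ?_)
  simp only
  congr 1
  ext x
  rw [gaussLik_nodes, Finset.prod_mul_distrib]
  rfl

end LabelModel

/-! ### Edges as Gaussian observations -/

section Edge

variable {X : Type*} [Fintype X] [DecidableEq X]

lemma posSemidef_vecMulVec_self {X : Type*} [Fintype X] (v : X → ℝ) :
    (Matrix.vecMulVec v v).PosSemidef := by
  simpa using Matrix.posSemidef_vecMulVec_self_star v

/-- A Bernoulli observation whose mean is close to `q` is less informative than a Gaussian
observation with the same signal-to-noise ratio, up to a small error. -/
lemma gauss_sub_le_bern {θ : X → ℝ} {B q δ κ : ℝ} (hB : 0 ≤ B) (hθ : ∀ x, |θ x| ≤ B) (hδ : 0 ≤ δ)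
    (h0 : 0 < q - δ * B) (h1 : q + δ * B < 1) (hκ : 0 ≤ κ) (hκ1 : 4 * (κ * B ^ 2) ≤ 1) {u : X → ℝ}
    (hu : 0 ≤ u) :
    gauss (κ • Matrix.vecMulVec θ θ) ent u
      - (|δ ^ 2 / ((q - δ * B) * (1 - q - δ * B)) - κ| * B ^ 2 + 16 * (κ * B ^ 2) ^ 2) * ∑ x, u x
      ≤ bern (fun x => q + δ * θ x) ent u := by
  have h1' : 0 < 1 - q - δ * B := by linarith
  have hc := mul_pos h0 h1'
  set c := (q - δ * B) * (1 - q - δ * B)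
  have hs : 0 ≤ ∑ x, u x := Finset.sum_nonneg fun x _ => hu x
  have hPSD := posSemidef_vecMulVec_self θ
  have hθθ : ∀ x y, |Matrix.vecMulVec θ θ x y| ≤ B ^ 2 := fun x y => by
    rw [Matrix.vecMulVec_apply, abs_mul, sq]
    exact mul_le_mul (hθ x) (hθ y) (abs_nonneg _) hB
  -- On `[q - δB, q + δB]` the variance `y * (1 - y)` is at least `c`, the least value of `y` times
  -- the least value of `1 - y`.
  have e1 := ent_sub_le_bern_ent (m := fun x => q + δ * θ x) h0 h1 hc (fun y hy => by
      exact mul_le_mul hy.1 (by linarith [hy.2]) h1'.le (h0.le.trans hy.1)) (fun x => by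
      have := abs_le.1 (hθ x)
      constructor <;> nlinarith) hu
  rw [spread_affine _ _ _ _ hu] at e1
  have e2 := gauss_ent_le (hPSD.smul hκ) (B := κ * B ^ 2) (fun x y => by
    rw [Matrix.smul_apply, smul_eq_mul, abs_mul, abs_of_nonneg hκ]
    exact mul_le_mul_of_nonneg_left (hθθ x y) hκ) hκ1 hu
  rw [spread_smul_left] at e2
  have e3 := abs_spread_le hθθ hu
  rw [abs_of_nonneg (spread_nonneg hPSD hu)] at e3
  have e4 : (δ ^ 2 / c - κ) * spread (Matrix.vecMulVec θ θ) u
      ≤ |δ ^ 2 / c - κ| * (2 * B ^ 2 * ∑ x, u x) :=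
    mul_le_mul (le_abs_self _) e3 (spread_nonneg hPSD hu) (abs_nonneg _)
  have e5 : δ ^ 2 * spread (Matrix.vecMulVec θ θ) u / (2 * c)
      = δ ^ 2 / c * spread (Matrix.vecMulVec θ θ) u / 2 := by field_simp
  rw [e5] at e1
  nlinarith

/-- The squares of the two ratios are `1 / d - 1 / n` and `1 / (n - d) - 1 / n`. Divergence of `d`
and `n - d` thus makes the edge probabilities depend on the labels only to a vanishing relative
degree, both for edges and for non-edges. -/
lemma tendsto_edge_ratio {d : ℕ → ℝ} (hd : Tendsto d atTop atTop)
    (hd' : Tendsto (fun n : ℕ => (n : ℝ) - d n) atTop atTop) :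
    Tendsto (fun n : ℕ => √(d n * (1 - d n / n)) / n / (d n / n)) atTop (𝓝 0) ∧
      Tendsto (fun n : ℕ => √(d n * (1 - d n / n)) / n / (1 - d n / n)) atTop (𝓝 0) := by
  have hn : Tendsto (fun n : ℕ => (n : ℝ)⁻¹) atTop (𝓝 0) := tendsto_inv_atTop_nhds_zero_nat
  have hev : ∀ᶠ n : ℕ in atTop, 0 < (n : ℝ) ∧ 0 < d n ∧ 0 < (n : ℝ) - d n := by
    filter_upwards [eventually_gt_atTop 0, hd.eventually_gt_atTop 0,
      hd'.eventually_gt_atTop 0] with n h1 h2 h3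
    exact ⟨by exact_mod_cast h1, h2, h3⟩
  constructor
  · have h := (Real.continuous_sqrt.tendsto _).comp ((tendsto_inv_atTop_zero.comp hd).sub hn)
    rw [sub_zero, Real.sqrt_zero] at h
    refine h.congr' ?_
    filter_upwards [hev] with n ⟨h1, h2, h3⟩
    have h4 : 0 < 1 - d n / n := by rw [sub_pos, div_lt_one h1]; linarith
    simp only [Function.comp]
    rw [Real.sqrt_eq_iff_mul_self_eq_of_pos (by positivity), div_div_div_cancel_right₀ h1.ne',
      div_mul_div_comm, Real.mul_self_sqrt (by positivity)]
    field_simp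
  · have h := (Real.continuous_sqrt.tendsto _).comp ((tendsto_inv_atTop_zero.comp hd').sub hn)
    rw [sub_zero, Real.sqrt_zero] at h
    refine h.congr' ?_
    filter_upwards [hev] with n ⟨h1, h2, h3⟩
    have h4 : 0 < 1 - d n / n := by rw [sub_pos, div_lt_one h1]; linarith
    simp only [Function.comp]
    rw [Real.sqrt_eq_iff_mul_self_eq_of_pos (by positivity), div_mul_div_comm, div_mul_div_comm,
      Real.mul_self_sqrt (by positivity)]
    have h5 : (1 - d n / n) = (n - d n) / n := by field_simp
    rw [h5]
    field_simp
    ring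

/-- With `q = d / n` and `δ` the coefficient of the signal, `δ² / (q (1 - q)) = 1 / n` exactly. The
error `η` does not depend on the signal or the parameter set, and `n * η n → 0` is what a sum over
order `n²` edges requires for a total of `o(n)`. -/
lemma exists_edge_comparison {d : ℕ → ℝ} (hd : Tendsto d atTop atTop)
    (hd' : Tendsto (fun n : ℕ => (n : ℝ) - d n) atTop atTop) {B : ℝ} (hB : 0 ≤ B) :
    ∃ η : ℕ → ℝ, Tendsto (fun n : ℕ => n * η n) atTop (𝓝 0) ∧ (∀ n, 0 ≤ η n) ∧
      ∀ᶠ n : ℕ in atTop, ∀ {X : Type} [Fintype X] [DecidableEq X] {θ : X → ℝ},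
        (∀ x, |θ x| ≤ B) → ∀ {u : X → ℝ}, 0 ≤ u →
        gauss ((1 / n : ℝ) • Matrix.vecMulVec θ θ) ent u - η n * ∑ x, u x
          ≤ bern (fun x => Set.projIcc (0 : ℝ) 1 zero_le_one
            (d n / n + √(d n * (1 - d n / n)) / n * θ x)) ent u := by
  obtain ⟨hr, hr'⟩ := tendsto_edge_ratio hd hd'
  have hn : Tendsto (fun n : ℕ => (n : ℝ)⁻¹) atTop (𝓝 0) := tendsto_inv_atTop_nhds_zero_nat
  set q : ℕ → ℝ := fun n => d n / n
  set δ : ℕ → ℝ := fun n => √(d n * (1 - d n / n)) / n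
  have hδ0 : ∀ n, 0 ≤ δ n := fun n => by positivity
  -- The error of `gauss_sub_le_bern` at `κ = 1 / n`. The first term is the mismatch between `1 / n`
  -- and the signal-to-noise ratio at the worst variance, the second is the quadratic Gaussian
  -- error, of order `1 / n²`.
  refine ⟨fun n => |δ n ^ 2 / ((q n - δ n * B) * (1 - q n - δ n * B)) - 1 / n| * B ^ 2
    + 16 * (1 / n * B ^ 2) ^ 2, ?_, fun n => by positivity, ?_⟩
  · have h1 : Tendsto (fun n : ℕ => |((1 - δ n / q n * B) * (1 - δ n / (1 - q n) * B))⁻¹ - 1| * B ^ 2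
        + 16 * B ^ 4 * (n : ℝ)⁻¹) atTop
        (𝓝 (|((1 - 0 * B) * (1 - 0 * B))⁻¹ - 1| * B ^ 2 + 16 * B ^ 4 * 0)) := by
      refine Tendsto.add (Tendsto.mul_const _ (Tendsto.abs (Tendsto.sub_const
        (Tendsto.inv₀ ?_ (by norm_num)) _))) (hn.const_mul _)
      exact ((hr.mul_const B).const_sub 1).mul ((hr'.mul_const B).const_sub 1)
    simp only [zero_mul, sub_zero, mul_one, inv_one, sub_self, abs_zero, mul_zero, add_zero] at h1
    refine h1.congr' ?_
    filter_upwards [eventually_gt_atTop 0, hd.eventually_gt_atTop 0,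
      hd'.eventually_gt_atTop 0] with n h1 h2 h3
    have h1 : (0 : ℝ) < n := by exact_mod_cast h1
    have h4 : 0 < 1 - q n := by simp only [q]; rw [sub_pos, div_lt_one h1]; linarith
    have h5 : 0 < q n := div_pos h2 h1
    have h6 : n * δ n ^ 2 = q n * (1 - q n) := by
      simp only [δ, div_pow]
      rw [Real.sq_sqrt (mul_nonneg h2.le h4.le)]
      simp only [q]
      field_simp
    have h7 : n * |δ n ^ 2 / ((q n - δ n * B) * (1 - q n - δ n * B)) - 1 / n|
        = |((1 - δ n / q n * B) * (1 - δ n / (1 - q n) * B))⁻¹ - 1| := by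
      have e0 (y : ℝ) : n * |y| = |n * y| := by rw [abs_mul, abs_of_pos h1]
      rw [e0, mul_sub, mul_one_div_cancel h1.ne', ← mul_div_assoc, h6]
      congr 2
      have e1 : q n - δ n * B = q n * (1 - δ n / q n * B) := by field_simp
      have e2 : 1 - q n - δ n * B = (1 - q n) * (1 - δ n / (1 - q n) * B) := by field_simp
      conv_lhs => rw [e1, e2, mul_mul_mul_comm]
      rw [div_mul_eq_div_div, div_self (by positivity), one_div]
    rw [mul_add, ← mul_assoc, h7]
    congr 1
    field_simp
  · have a1 : ∀ᶠ n in atTop, δ n / q n * B < 1 :=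
      (hr.mul_const B).eventually_lt_const (by simp)
    have a2 : ∀ᶠ n in atTop, δ n / (1 - q n) * B < 1 :=
      (hr'.mul_const B).eventually_lt_const (by simp)
    have a3 : ∀ᶠ n : ℕ in atTop, 4 * ((n : ℝ)⁻¹ * B ^ 2) < 1 :=
      ((hn.mul_const (B ^ 2)).const_mul 4).eventually_lt_const (by simp)
    filter_upwards [eventually_gt_atTop 0, hd.eventually_gt_atTop 0,
      hd'.eventually_gt_atTop 0, a1, a2, a3] with n h1 h2 h3 a1 a2 a3 X _ _ θ hθ u hu
    have h1 : (0 : ℝ) < n := by exact_mod_cast h1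
    have h4 : 0 < 1 - q n := by simp only [q]; rw [sub_pos, div_lt_one h1]; linarith
    have h5 : 0 < q n := div_pos h2 h1
    rw [div_mul_eq_mul_div, div_lt_one h5] at a1
    rw [div_mul_eq_mul_div, div_lt_one h4] at a2
    have h := gauss_sub_le_bern hB hθ (hδ0 n) (q := q n) (κ := 1 / n) (by linarith) (by linarith)
      (by positivity) (by rw [one_div]; exact a3.le) hu
    refine h.trans_eq ?_
    congr 1
    ext x
    have := abs_le.1 (hθ x)
    rw [Set.projIcc_of_mem]
    constructor <;> nlinarith [hδ0 n]

end Edge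

/-! ### The networks as side information -/

lemma sum_nodePair {n : ℕ} (f : Fin n → Fin n → ℝ) (hf : ∀ i j, f i j = f j i) :
    ∑ e : NodePair n, f e.1.1 e.1.2 = (∑ i, ∑ j, f i j - ∑ i, f i i) / 2 := by
  have h0 : ∑ e : NodePair n, f e.1.1 e.1.2 = ∑ i, ∑ j, if i < j then f i j else 0 := by
    rw [← Finset.sum_subtype (Finset.univ.filter fun e : Fin n × Fin n => e.1 < e.2) (by simp)
      fun e => f e.1 e.2, Finset.sum_filter, Fintype.sum_prod_type]
  have h1 : ∑ i, ∑ j, (if i < j then f i j else 0) = ∑ i, ∑ j, if j < i then f i j else 0 := by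
    rw [Finset.sum_comm]
    exact Finset.sum_congr rfl fun i _ => Finset.sum_congr rfl fun j _ => by rw [hf]
  have h2 : ∑ i, ∑ j, f i j = ∑ i, ∑ j, (if i < j then f i j else 0)
      + ∑ i, ∑ j, (if j < i then f i j else 0) + ∑ i, f i i := by
    simp only [← Finset.sum_add_distrib]
    refine Finset.sum_congr rfl fun i _ => ?_
    have : f i i = ∑ j, if i = j then f i j else 0 := by simp
    rw [this, ← Finset.sum_add_distrib]
    refine Finset.sum_congr rfl fun j _ => ?_
    rcases lt_trichotomy i j with h | h | h
    · simp [h, h.not_gt, h.ne]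
    · simp [h]
    · simp [h, h.not_gt, h.ne']
  linarith

/-- `R` occurs twice, so its sign cancels and it may be taken positive definite. The trace is then
that of a product of two positive semidefinite matrices, `R` and `A R Aᵀ`. -/
lemma trace_definite_nonneg {m : ℕ} {R : Matrix (Fin m) (Fin m) ℝ} (hR : R.PosDef ∨ (-R).PosDef)
    (A : Matrix (Fin m) (Fin m) ℝ) : 0 ≤ (R * A * R * Aᵀ).trace := by
  have key : ∀ {R : Matrix (Fin m) (Fin m) ℝ}, R.PosDef → 0 ≤ (R * A * R * Aᵀ).trace := by
    intro R hR
    obtain ⟨B, hB⟩ := exists_eq_sum_vecMulVec hR.posSemidef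
    have h1 := (hR.posSemidef.mul_mul_conjTranspose_same A)
    rw [Matrix.mul_assoc, Matrix.mul_assoc, ← Matrix.mul_assoc A]
    rw [show R * (A * R * Aᵀ) = (∑ i, Matrix.vecMulVec (B i) (B i)) * (A * R * Aᵀ) from
      congrArg (· * (A * R * Aᵀ)) hB, Finset.sum_mul, Matrix.trace_sum]
    refine Finset.sum_nonneg fun i _ => ?_
    rw [Matrix.vecMulVec_mul, Matrix.trace_vecMulVec, ← Matrix.mulVec_transpose]
    have h2 := h1.dotProduct_mulVec_nonneg (B i)
    rw [star_trivial, Matrix.conjTranspose_eq_transpose_of_trivial] at h2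
    have h3 : (A * R * Aᵀ)ᵀ = A * R * Aᵀ := by simpa [Matrix.IsHermitian] using h1.isHermitian
    rw [h3]
    exact h2
  rcases hR with hR | hR
  · exact key hR
  · simpa using key hR

lemma isSymm_of_definite {m : ℕ} {R : Matrix (Fin m) (Fin m) ℝ} (hR : R.PosDef ∨ (-R).PosDef) :
    Rᵀ = R := by
  rcases hR with hR | hR
  · simpa [Matrix.IsHermitian] using hR.isHermitian
  · have := hR.isHermitian
    rw [Matrix.IsHermitian, Matrix.conjTranspose_eq_transpose_of_trivial, Matrix.transpose_neg] at this
    exact neg_injective this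

namespace LabelModel

variable {k L : ℕ} {𝒴 : Type*} [MeasurableSpace 𝒴] (M : LabelModel k 𝒴)

/-- Whitening, inserted under the trace. -/
lemma sum_weight_quadratic (T : Matrix (Fin (k - 1)) (Fin (k - 1)) ℝ) :
    ∑ a, M.weight a * (M.emb a ⬝ᵥ T *ᵥ M.emb a) = T.trace := by
  have h := congrArg (fun A => (T * A).trace) M.whitened
  simp only [mul_one] at h
  rw [← h, Finset.mul_sum, Matrix.trace_sum]
  refine Finset.sum_congr rfl fun a _ => ?_
  rw [Matrix.mul_smul, Matrix.trace_smul, Matrix.mul_vecMulVec, Matrix.trace_vecMulVec,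
    dotProduct_comm, smul_eq_mul]
  rfl

lemma sum_weight_bilinear_sq {R : Matrix (Fin (k - 1)) (Fin (k - 1)) ℝ} (hR : Rᵀ = R) :
    ∑ a, ∑ b, M.weight a * (M.weight b * (M.emb a ⬝ᵥ R *ᵥ M.emb b) ^ 2) = (R ^ 2).trace := by
  rw [← M.sum_weight_quadratic]
  refine Finset.sum_congr rfl fun a _ => ?_
  rw [← Finset.mul_sum]
  congr 1
  have h := M.sum_weight_quadratic (Matrix.vecMulVec (R *ᵥ M.emb a) (R *ᵥ M.emb a))
  have e : ∀ w v : Fin (k - 1) → ℝ, w ⬝ᵥ R *ᵥ v = (R *ᵥ w) ⬝ᵥ v := fun w v => by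
    rw [Matrix.dotProduct_mulVec, ← Matrix.mulVec_transpose, hR]
  rw [Matrix.trace_vecMulVec] at h
  rw [sq R, ← Matrix.mulVec_mulVec, e, ← h]
  refine Finset.sum_congr rfl fun b _ => ?_
  rw [e, Matrix.vecMulVec_mulVec, dotProduct_smul, sq, dotProduct_comm (M.emb b)]
  simp

variable (n : ℕ)

lemma sum_prior_mul {i j : Fin n} (hij : i ≠ j) (f g : Fin k → ℝ) :
    ∑ x, M.prior n x * (f (x i) * g (x j))
      = (∑ a, M.weight a * f a) * ∑ a, M.weight a * g a := by
  have h1 : ∀ x : Fin n → Fin k, M.prior n x * (f (x i) * g (x j))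
      = ∏ l, M.weight (x l) * ((if l = i then f (x l) else 1) * if l = j then g (x l) else 1) := by
    intro x
    rw [Finset.prod_mul_distrib, Finset.prod_mul_distrib, Finset.prod_ite_eq', Finset.prod_ite_eq']
    simp [prior]
  simp only [h1]
  rw [← Fintype.piFinset_univ, ← Finset.prod_univ_sum (fun _ => Finset.univ)
    fun l a => M.weight a * ((if l = i then f a else 1) * if l = j then g a else 1)]
  have h2 : ∀ l, ∑ a, M.weight a * ((if l = i then f a else 1) * if l = j then g a else 1)
      = (if l = i then ∑ a, M.weight a * f a else 1) * if l = j then ∑ a, M.weight a * g a else 1 := by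
    intro l
    by_cases h1 : l = i <;> by_cases h2 : l = j <;> simp [h1, h2, hij, hij.symm, M.sum_weight]
  simp only [h2]
  rw [Finset.prod_mul_distrib, Finset.prod_ite_eq', Finset.prod_ite_eq']
  simp

lemma sum_prior_single (i : Fin n) (f : Fin k → ℝ) :
    ∑ x, M.prior n x * f (x i) = ∑ a, M.weight a * f a := by
  have h1 : ∀ x : Fin n → Fin k, M.prior n x * f (x i)
      = ∏ l, M.weight (x l) * (if l = i then f (x l) else 1) := by
    intro x
    rw [Finset.prod_mul_distrib, Finset.prod_ite_eq']
    simp [prior]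
  simp only [h1]
  rw [← Fintype.piFinset_univ, ← Finset.prod_univ_sum (fun _ => Finset.univ)
    fun l a => M.weight a * (if l = i then f a else 1)]
  have h2 : ∀ l, ∑ a, M.weight a * (if l = i then f a else 1)
      = if l = i then ∑ a, M.weight a * f a else 1 := by
    intro l
    by_cases h1 : l = i <;> simp [h1, M.sum_weight]
  simp only [h2]
  rw [Finset.prod_ite_eq']
  simp

lemma sum_prior_pair {i j : Fin n} (hij : i ≠ j) (f : Fin k → Fin k → ℝ) :
    ∑ x, M.prior n x * f (x i) (x j) = ∑ a, ∑ b, M.weight a * (M.weight b * f a b) := by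
  have h : ∀ x : Fin n → Fin k, M.prior n x * f (x i) (x j)
      = ∑ a, M.prior n x * ((if x i = a then 1 else 0) * f a (x j)) := by
    intro x
    rw [← Finset.mul_sum]
    simp
  simp only [h]
  rw [Finset.sum_comm]
  refine Finset.sum_congr rfl fun a _ => ?_
  rw [M.sum_prior_mul n hij (fun c => if c = a then 1 else 0) (f a), ← Finset.mul_sum]
  simp

/-- The signal of the edge `e` when the labels are `x`. -/
def edgeSignal (R : Fin L → Matrix (Fin (k - 1)) (Fin (k - 1)) ℝ) (e : Fin L × NodePair n)
    (x : Fin n → Fin k) : ℝ := M.emb (x e.2.1.1) ⬝ᵥ R e.1 *ᵥ M.emb (x e.2.1.2)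

/-- The Gram matrix of a Gaussian observation with the signal-to-noise ratio of the edge `e`. -/
def edgeGram (R : Fin L → Matrix (Fin (k - 1)) (Fin (k - 1)) ℝ) (e : Fin L × NodePair n) :
    Matrix (Fin n → Fin k) (Fin n → Fin k) ℝ :=
  (1 / n : ℝ) • Matrix.vecMulVec (M.edgeSignal n R e) (M.edgeSignal n R e)

variable {n} {R : Fin L → Matrix (Fin (k - 1)) (Fin (k - 1)) ℝ}

lemma edgeGram_posSemidef (e : Fin L × NodePair n) : (M.edgeGram n R e).PosSemidef :=
  (posSemidef_vecMulVec_self (M.edgeSignal n R e)).smul (by positivity)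

lemma exists_abs_signal_le (R : Fin L → Matrix (Fin (k - 1)) (Fin (k - 1)) ℝ) :
    ∃ B, 0 ≤ B ∧ ∀ ℓ a b, |M.emb a ⬝ᵥ R ℓ *ᵥ M.emb b| ≤ B := by
  refine ⟨∑ ℓ, ∑ a, ∑ b, |M.emb a ⬝ᵥ R ℓ *ᵥ M.emb b|, by positivity, fun ℓ a b => ?_⟩
  exact (Finset.single_le_sum (f := fun b => |M.emb a ⬝ᵥ R ℓ *ᵥ M.emb b|)
    (fun _ _ => abs_nonneg _) (Finset.mem_univ b)).trans
    ((Finset.single_le_sum (f := fun a => ∑ b, |M.emb a ⬝ᵥ R ℓ *ᵥ M.emb b|)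
    (fun _ _ => by positivity) (Finset.mem_univ a)).trans
    (Finset.single_le_sum (f := fun ℓ => ∑ a, ∑ b, |M.emb a ⬝ᵥ R ℓ *ᵥ M.emb b|)
    (fun _ _ => by positivity) (Finset.mem_univ ℓ)))

/-- Definite connectivity matrices make the overlap term of the interpolation a square. -/
lemma overlap_bound {R W : Matrix (Fin (k - 1)) (Fin (k - 1)) ℝ} (hR : R.PosDef ∨ (-R).PosDef)
    (hW : Wᵀ = W) {B : ℝ} (hB0 : 0 ≤ B) (hB : ∀ a b, |M.emb a ⬝ᵥ R *ᵥ M.emb b| ≤ B) (hn : 0 < n)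
    (x y : Fin n → Fin k) :
    ∑ i, (M.emb (x i) ⬝ᵥ (R * W * R) *ᵥ M.emb (y i)) - (n / 2 * ((R * W) ^ 2).trace + B ^ 2 / 2)
      ≤ 1 / n * ∑ e : NodePair n, (M.emb (x e.1.1) ⬝ᵥ R *ᵥ M.emb (x e.1.2))
        * (M.emb (y e.1.1) ⬝ᵥ R *ᵥ M.emb (y e.1.2)) := by
  have hn' : (0 : ℝ) < n := by exact_mod_cast hn
  have hRs := isSymm_of_definite hR
  have hsymm : ∀ u v : Fin (k - 1) → ℝ, u ⬝ᵥ R *ᵥ v = v ⬝ᵥ R *ᵥ u := fun u v => by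
    rw [Matrix.dotProduct_mulVec, ← Matrix.mulVec_transpose, hRs, dotProduct_comm]
  rw [sum_nodePair (fun i j => (M.emb (x i) ⬝ᵥ R *ᵥ M.emb (x j))
    * (M.emb (y i) ⬝ᵥ R *ᵥ M.emb (y j))) fun i j => by rw [hsymm, hsymm (M.emb (y i))]]
  -- The overlap of the two configurations. The node term is linear in `A`, and the edge term is
  -- quadratic up to the diagonal `i = j`.
  set A : Matrix (Fin (k - 1)) (Fin (k - 1)) ℝ :=
    ∑ i, Matrix.vecMulVec (M.emb (x i)) (M.emb (y i)) with hA
  have hAT : Aᵀ = ∑ i, Matrix.vecMulVec (M.emb (y i)) (M.emb (x i)) := by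
    simp [hA, Matrix.transpose_sum, Matrix.transpose_vecMulVec]
  have e1 : ∑ i, (M.emb (x i) ⬝ᵥ (R * W * R) *ᵥ M.emb (y i)) = (R * W * R * Aᵀ).trace := by
    rw [hAT, Finset.mul_sum, Matrix.trace_sum]
    refine Finset.sum_congr rfl fun i _ => ?_
    rw [Matrix.mul_vecMulVec, Matrix.trace_vecMulVec, dotProduct_comm]
  have e2 : ∑ i, ∑ j, (M.emb (x i) ⬝ᵥ R *ᵥ M.emb (x j)) * (M.emb (y i) ⬝ᵥ R *ᵥ M.emb (y j))
      = (R * A * R * Aᵀ).trace := by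
    rw [hAT, Finset.mul_sum, Matrix.trace_sum]
    refine Finset.sum_congr rfl fun i _ => ?_
    rw [hA, Finset.mul_sum, Finset.sum_mul, Finset.sum_mul, Matrix.trace_sum]
    refine Finset.sum_congr rfl fun j _ => ?_
    rw [Matrix.mul_vecMulVec, Matrix.trace_vecMulVec, ← Matrix.mulVec_mulVec,
      ← Matrix.mulVec_mulVec, Matrix.vecMulVec_mulVec, Matrix.mulVec_smul, op_smul_eq_smul,
      smul_dotProduct, smul_eq_mul, hsymm (M.emb (y i)), mul_comm, dotProduct_comm (M.emb (x i))]
  have e3 : ∑ i, (M.emb (x i) ⬝ᵥ R *ᵥ M.emb (x i)) * (M.emb (y i) ⬝ᵥ R *ᵥ M.emb (y i))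
      ≤ n * B ^ 2 := by
    calc _ ≤ ∑ i : Fin n, B ^ 2 := Finset.sum_le_sum fun i _ => by
          refine (le_abs_self _).trans ?_
          rw [abs_mul, sq]
          exact mul_le_mul (hB _ _) (hB _ _) (abs_nonneg _) hB0
      _ = _ := by simp
  -- Completing the square at `A = n W`: the slack of the inequality is this trace divided by `2 *
  -- n`, once the diagonal has been bounded by `n * B ^ 2`.
  have e4 := trace_definite_nonneg hR (A - (n : ℝ) • W)
  have e5 : (R * A * R * W).trace = (R * W * R * Aᵀ).trace := by
    rw [← Matrix.trace_transpose]
    simp only [Matrix.transpose_mul, hRs, hW]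
    rw [← Matrix.mul_assoc, ← Matrix.mul_assoc, Matrix.trace_mul_comm]
    simp only [Matrix.mul_assoc]
  have e6 : (R * (A - (n : ℝ) • W) * R * (A - (n : ℝ) • W)ᵀ).trace
      = (R * A * R * Aᵀ).trace - 2 * n * (R * W * R * Aᵀ).trace + n ^ 2 * ((R * W) ^ 2).trace := by
    have : R * (A - (n : ℝ) • W) * R * (A - (n : ℝ) • W)ᵀ = R * A * R * Aᵀ
        - (n : ℝ) • (R * A * R * W) - (n : ℝ) • (R * W * R * Aᵀ) + (n : ℝ) ^ 2 • ((R * W) ^ 2) := by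
      rw [Matrix.transpose_sub, Matrix.transpose_smul, hW, sq (R * W)]
      simp only [Matrix.mul_sub, Matrix.sub_mul, Matrix.mul_smul, Matrix.smul_mul, smul_smul,
        Matrix.mul_assoc, smul_sub]
      rw [sq]
      abel
    rw [this, Matrix.trace_add, Matrix.trace_sub, Matrix.trace_sub, Matrix.trace_smul,
      Matrix.trace_smul, Matrix.trace_smul, e5]
    simp only [smul_eq_mul]
    ring
  rw [e6] at e4
  rw [e1, e2]
  have e7 : (1 / n : ℝ) * (((R * A * R * Aᵀ).trace - n * B ^ 2) / 2)
      ≤ 1 / n * (((R * A * R * Aᵀ).trace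
        - ∑ i, (M.emb (x i) ⬝ᵥ R *ᵥ M.emb (x i)) * (M.emb (y i) ⬝ᵥ R *ᵥ M.emb (y i))) / 2) := by
    gcongr
  refine le_trans ?_ e7
  have e8 : (1 / n : ℝ) * (((R * A * R * Aᵀ).trace - n * B ^ 2) / 2)
      - ((R * W * R * Aᵀ).trace - (n / 2 * ((R * W) ^ 2).trace + B ^ 2 / 2))
      = ((R * A * R * Aᵀ).trace - 2 * n * (R * W * R * Aᵀ).trace + n ^ 2 * ((R * W) ^ 2).trace)
        / (2 * n) := by
    field_simp
    ring
  have := div_nonneg e4 (by positivity : (0 : ℝ) ≤ 2 * n)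
  rw [← e8] at this
  linarith

end LabelModel

/-! ### Interpolation from the networks to Gaussian side information about nodes -/

namespace LabelModel

variable {k L : ℕ} {𝒴 : Type*} [MeasurableSpace 𝒴] (M : LabelModel k 𝒴) {n : ℕ}
  {R : Fin L → Matrix (Fin (k - 1)) (Fin (k - 1)) ℝ}

lemma nodesGram_add (S T : Matrix (Fin (k - 1)) (Fin (k - 1)) ℝ) :
    M.nodesGram n (S + T) = M.nodesGram n S + M.nodesGram n T := by
  simp only [nodesGram, gram_add, Matrix.submatrix_add, Pi.add_apply, Finset.sum_add_distrib]

lemma nodesGram_smul (c : ℝ) (S : Matrix (Fin (k - 1)) (Fin (k - 1)) ℝ) :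
    M.nodesGram n (c • S) = c • M.nodesGram n S := by
  simp only [nodesGram, gram_smul, Matrix.submatrix_smul, Pi.smul_apply, Finset.smul_sum]

lemma nodesGram_apply (S : Matrix (Fin (k - 1)) (Fin (k - 1)) ℝ) (x y : Fin n → Fin k) :
    M.nodesGram n S x y = ∑ i, (M.emb (x i) ⬝ᵥ S *ᵥ M.emb (y i)) := by
  simp only [nodesGram, Matrix.sum_apply, Matrix.submatrix_apply, gram_apply]

lemma sum_prior_nodesGram (S : Matrix (Fin (k - 1)) (Fin (k - 1)) ℝ) :
    ∑ x, M.prior n x * M.nodesGram n S x x = n * S.trace := by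
  simp only [nodesGram_apply, Finset.mul_sum]
  rw [Finset.sum_comm]
  simp only [M.sum_prior_single n _ fun a => M.emb a ⬝ᵥ S *ᵥ M.emb a, M.sum_weight_quadratic]
  simp

lemma card_nodePair (n : ℕ) : (Fintype.card (NodePair n) : ℝ) = ((n : ℝ) * n - n) / 2 := by
  have h := sum_nodePair (n := n) (fun _ _ => 1) fun _ _ => rfl
  simpa using h

/-- The endpoints of an edge have independent whitened labels, so each edge contributes `tr(R²) /
n`, and each network has `n (n - 1) / 2` pairs. -/
lemma sum_prior_edgeGram (hR : ∀ ℓ, (R ℓ)ᵀ = R ℓ) (hn : 0 < n) :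
    ∑ x, M.prior n x * (∑ e, M.edgeGram n R e) x x
      = ((n : ℝ) - 1) / 2 * ∑ ℓ, ((R ℓ) ^ 2).trace := by
  have hn' : (0 : ℝ) < n := by exact_mod_cast hn
  have h : ∀ e : Fin L × NodePair n, ∑ x, M.prior n x * M.edgeGram n R e x x
      = 1 / n * ((R e.1) ^ 2).trace := by
    intro e
    rw [← M.sum_weight_bilinear_sq (hR e.1), ← M.sum_prior_pair n e.2.2.ne fun a b =>
      (M.emb a ⬝ᵥ R e.1 *ᵥ M.emb b) ^ 2, Finset.mul_sum]
    refine Finset.sum_congr rfl fun x _ => ?_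
    simp only [edgeGram, Matrix.smul_apply, Matrix.vecMulVec_apply, edgeSignal, smul_eq_mul]
    ring
  simp only [Matrix.sum_apply, Finset.mul_sum]
  rw [Finset.sum_comm]
  simp only [h, Fintype.sum_prod_type, Finset.sum_const, Finset.card_univ, nsmul_eq_mul,
    card_nodePair]
  refine Finset.sum_congr rfl fun ℓ _ => ?_
  field_simp

lemma sum_conj_posSemidef (hR : ∀ ℓ, (R ℓ)ᵀ = R ℓ) {W : Matrix (Fin (k - 1)) (Fin (k - 1)) ℝ}
    (hW : W.PosSemidef) : (∑ ℓ, R ℓ * W * R ℓ).PosSemidef :=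
  Matrix.posSemidef_sum _ fun ℓ _ => by
    simpa [hR ℓ] using hW.mul_mul_conjTranspose_same (R ℓ)

/-- `overlap_bound` summed over the networks. This is the hypothesis of `gauss_ent_interpolation`
with the edges as `K₁` and the side information about nodes as `K₂`. -/
lemma nodesGram_sub_le_edgeGram (hR : ∀ ℓ, (R ℓ).PosDef ∨ (-R ℓ).PosDef)
    {W : Matrix (Fin (k - 1)) (Fin (k - 1)) ℝ} (hW : Wᵀ = W) {B : ℝ} (hB0 : 0 ≤ B)
    (hB : ∀ ℓ a b, |M.emb a ⬝ᵥ R ℓ *ᵥ M.emb b| ≤ B) (hn : 0 < n) (x y : Fin n → Fin k) :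
    M.nodesGram n (∑ ℓ, R ℓ * W * R ℓ) x y - ∑ ℓ, (n / 2 * ((R ℓ * W) ^ 2).trace + B ^ 2 / 2)
      ≤ (∑ e, M.edgeGram n R e) x y := by
  rw [nodesGram_apply]
  simp only [Matrix.sum_mulVec, dotProduct_sum, Matrix.sum_apply]
  rw [Finset.sum_comm, ← Finset.sum_sub_distrib, Fintype.sum_prod_type]
  refine Finset.sum_le_sum fun ℓ _ => ?_
  refine (M.overlap_bound (hR ℓ) hW hB0 (hB ℓ) hn x y).trans_eq ?_
  rw [Finset.mul_sum]
  rfl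

/-- The networks are at most as informative about the labels as Gaussian side information. -/
lemma exists_le_base_gauss_ent {d : Fin L → ℕ → ℝ}
    (hd : ∀ ℓ, Tendsto (d ℓ) atTop atTop ∧ Tendsto (fun n : ℕ => (n : ℝ) - d ℓ n) atTop atTop)
    (hR : ∀ ℓ, (R ℓ).PosDef ∨ (-R ℓ).PosDef) {U : Matrix (Fin (k - 1)) (Fin (k - 1)) ℝ}
    (hU : U ∈ loewnerInterval (k - 1)) :
    ∃ ε : ℕ → ℝ, Tendsto ε atTop (𝓝 0) ∧ ∀ᶠ n : ℕ in atTop,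
      ∀ {S : Matrix (Fin (k - 1)) (Fin (k - 1)) ℝ}, S.PosSemidef →
      n * (M.nodeEnt (S + ∑ ℓ, R ℓ * (1 - U) * R ℓ) - 1 / 4 * ∑ ℓ, ((R ℓ * U) ^ 2).trace - ε n)
        ≤ M.base d R n (gauss (M.nodesGram n S) ent) := by
  obtain ⟨B, hB0, hB⟩ := M.exists_abs_signal_le R
  choose η hη hη0 hη1 using fun ℓ => exists_edge_comparison (hd ℓ).1 (hd ℓ).2 hB0
  have hRs := fun ℓ => isSymm_of_definite (hR ℓ)
  set W := 1 - U with hWdef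
  have hW : W.PosSemidef := hU.2
  have hWs : Wᵀ = W := by simpa [Matrix.IsHermitian] using hW.isHermitian
  have hΔ := sum_conj_posSemidef hRs hW
  set Δ := ∑ ℓ, R ℓ * W * R ℓ with hΔdef
  -- The first term pays for the diagonal in the overlap, the second for exchanging at most `L n²`
  -- edges at cost `κ` each. Neither depends on `S`.
  refine ⟨fun n => L * B ^ 2 / 4 * (n : ℝ)⁻¹ + L * ∑ ℓ, n * η ℓ n, ?_, ?_⟩
  · have h1 := (tendsto_inv_atTop_nhds_zero_nat (𝕜 := ℝ)).const_mul (L * B ^ 2 / 4)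
    have h2 := (tendsto_finsetSum Finset.univ fun ℓ _ => hη ℓ).const_mul (L : ℝ)
    simpa using h1.add h2
  filter_upwards [eventually_gt_atTop 0, eventually_all.2 hη1] with n hn hcomp S hS
  have hn' : (0 : ℝ) < n := by exact_mod_cast hn
  set κ := ∑ ℓ, η ℓ n with hκ
  have hκ0 : 0 ≤ κ := Finset.sum_nonneg fun ℓ _ => hη0 ℓ n
  have hKS := M.nodesGram_posSemidef n hS
  have hKΔ := M.nodesGram_posSemidef n hΔ
  have hKE : (∑ e, M.edgeGram n R e).PosSemidef :=
    Matrix.posSemidef_sum Finset.univ fun e _ => M.edgeGram_posSemidef e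
  set N : ℝ := ((Finset.univ : Finset (Fin L × NodePair n)).card : ℝ) with hN
  set c : ℝ := ∑ ℓ, (n / 2 * ((R ℓ * W) ^ 2).trace + B ^ 2 / 2) with hc
  have hedge : ∀ e, ∀ w : (Fin n → Fin k) → ℝ, 0 ≤ w →
      gauss (M.edgeGram n R e) ent w - κ * ∑ x, w x ≤ bern (M.edgeMean d R n e) ent w := by
    intro e w hw
    have hle : η e.1 n ≤ κ :=
      Finset.single_le_sum (f := fun ℓ => η ℓ n) (fun ℓ _ => hη0 ℓ n) (Finset.mem_univ e.1)
    have h := hcomp e.1 (θ := M.edgeSignal n R e) (fun x => hB e.1 (x e.2.1.1) (x e.2.1.2)) hw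
    refine le_trans (sub_le_sub_left (mul_le_mul_of_nonneg_right hle
      (Finset.sum_nonneg fun x _ => hw x)) _) ?_
    unfold edgeGram edgeMean edgeProb
    exact h
  have hsplit : ∀ (v D : (Fin n → Fin k) → ℝ) (c t : ℝ),
      ∑ x, v x * ((D x + c) / 2 + t) = (∑ x, v x * D x + c * ∑ x, v x) / 2 + t * ∑ x, v x := by
    intro v D c t
    rw [Finset.mul_sum, Finset.mul_sum, ← Finset.sum_add_distrib, Finset.sum_div,
      ← Finset.sum_add_distrib]
    exact Finset.sum_congr rfl fun x _ => by ring
  have step : ∀ v : (Fin n → Fin k) → ℝ, 0 ≤ v →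
      gauss (M.nodesGram n (S + Δ)) ent v
        - ∑ x, v x * (((∑ e, M.edgeGram n R e) x x - M.nodesGram n Δ x x + c) / 2 + N * κ)
      ≤ bernPow (M.edgeMean d R n) Finset.univ (gauss (M.nodesGram n S) ent) v := by
    intro v hv
    -- Bernoulli edges become Gaussian edges in `h1`, and Gaussian edges become side information at
    -- level `Δ` in `h2`.
    have h1 := gauss_le_bernPow (s := Finset.univ) (M.edgeMean_nonneg d R n)
      (M.edgeMean_le_one d R n) hKS (fun e => M.edgeGram_posSemidef e) hedge hv
    have h2 := gauss_ent_interpolation hKS hKE hKΔ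
      (M.nodesGram_sub_le_edgeGram hR hWs hB0 hB hn) hv
    rw [← nodesGram_add] at h2
    refine le_trans (le_of_eq ?_) ((sub_le_sub_right h2 _).trans h1)
    rw [hsplit v, sub_sub]
  have hlg : LinearGrowth (gauss (M.nodesGram n (S + Δ)) ent) :=
    ent_linearGrowth.gauss (M.nodesGram_posSemidef n (hS.add hΔ))
  have hlg2 := LinearGrowth.linear fun x =>
    ((∑ e, M.edgeGram n R e) x x - M.nodesGram n Δ x x + c) / 2 + N * κ
  have main := bayes_mono (M.isLik_covs n) (hlg.sub hlg2)
    (M.linearGrowth_bernPow d R n (ent_linearGrowth.gauss hKS)) step (M.prior_nonneg n)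
  rw [bayes_sub (M.isLik_covs n) hlg hlg2 (M.prior_nonneg n), M.bayes_covs_gauss_ent n (hS.add hΔ),
    bayes_linear (M.isLik_covs n)] at main
  refine le_trans ?_ main
  have e1 : ∑ x, M.prior n x * (((∑ e, M.edgeGram n R e) x x - M.nodesGram n Δ x x + c) / 2 + N * κ)
      = (((n : ℝ) - 1) / 2 * ∑ ℓ, ((R ℓ) ^ 2).trace - n * Δ.trace + c) / 2 + N * κ := by
    rw [← M.sum_prior_edgeGram hRs hn, ← M.sum_prior_nodesGram]
    rw [hsplit (M.prior n) fun x => (∑ e, M.edgeGram n R e) x x - M.nodesGram n Δ x x]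
    simp only [mul_sub, Finset.sum_sub_distrib, M.sum_prior, mul_one]
  -- The trace terms left by the interpolation assemble into the quadratic term of the potential.
  have e2 : ∑ ℓ, ((R ℓ * U) ^ 2).trace
      = ∑ ℓ, ((R ℓ) ^ 2).trace - 2 * Δ.trace + ∑ ℓ, ((R ℓ * W) ^ 2).trace := by
    rw [hΔdef, Matrix.trace_sum, Finset.mul_sum, ← Finset.sum_sub_distrib, ← Finset.sum_add_distrib]
    refine Finset.sum_congr rfl fun ℓ _ => ?_
    have : U = 1 - W := by rw [hWdef]; abel
    rw [this]
    have e : (R ℓ * (1 - W)) ^ 2 = R ℓ ^ 2 - R ℓ * (R ℓ * W) - R ℓ * W * R ℓ + (R ℓ * W) ^ 2 := by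
      noncomm_ring
    rw [e, Matrix.trace_add, Matrix.trace_sub, Matrix.trace_sub, Matrix.trace_mul_comm (R ℓ)]
    ring
  have e3 : N ≤ L * (n : ℝ) ^ 2 := by
    rw [hN, Finset.card_univ, Fintype.card_prod, Fintype.card_fin]
    push_cast
    rw [card_nodePair]
    refine mul_le_mul_of_nonneg_left ?_ (by positivity)
    nlinarith
  have e4 : N * κ ≤ n * (L * ∑ ℓ, n * η ℓ n) := by
    refine (mul_le_mul_of_nonneg_right e3 hκ0).trans_eq ?_
    rw [← Finset.mul_sum]
    ring
  -- The prior average of the edges carries the factor `n - 1` rather than `n`; the missing term has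
  -- a favourable sign.
  have e5 : 0 ≤ ∑ ℓ, ((R ℓ) ^ 2).trace := Finset.sum_nonneg fun ℓ _ => by
    have := (Matrix.posSemidef_self_mul_conjTranspose (R ℓ)).trace_nonneg
    rwa [Matrix.conjTranspose_eq_transpose_of_trivial, hRs, ← sq] at this
  have e6 : c = n / 2 * ∑ ℓ, ((R ℓ * W) ^ 2).trace + L * (B ^ 2 / 2) := by
    rw [hc, Finset.sum_add_distrib, ← Finset.mul_sum]
    simp
  have e7 : n * (L * B ^ 2 / 4 * (n : ℝ)⁻¹ + L * ∑ ℓ, n * η ℓ n)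
      = L * B ^ 2 / 4 + n * (L * ∑ ℓ, n * η ℓ n) := by
    field_simp
  rw [e1, e2, e6, mul_sub, e7]
  linarith

end LabelModel

/-! ### Stationarity of the potential at its minimizers -/

lemma spread_le_diag {X : Type*} [Fintype X] {K : Matrix X X ℝ} (hK : K.PosSemidef) {u : X → ℝ}
    (hu : 0 ≤ u) : spread K u ≤ ∑ x, u x * K x x := by
  refine sub_le_self _ (div_nonneg ?_ (Finset.sum_nonneg fun x _ => hu x))
  have h := hK.dotProduct_mulVec_nonneg u
  rw [star_trivial] at h
  convert h using 1
  simp only [dotProduct, Matrix.mulVec, Finset.mul_sum]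
  exact Finset.sum_congr rfl fun x _ => Finset.sum_congr rfl fun y _ => by ring

/-- The equality case of `trace_definite_nonneg`: first `A R Aᵀ = 0`, by definiteness of the outer
`R`, then `A = 0`, by definiteness of the inner one. -/
lemma eq_zero_of_trace_eq_zero {m : ℕ} {R A : Matrix (Fin m) (Fin m) ℝ}
    (hR : R.PosDef ∨ (-R).PosDef) (h : (R * A * R * Aᵀ).trace = 0) : A = 0 := by
  have key : ∀ {R : Matrix (Fin m) (Fin m) ℝ}, R.PosDef → (R * A * R * Aᵀ).trace = 0 → A = 0 := by
    intro R hR h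
    have h1 := hR.posSemidef.mul_mul_conjTranspose_same A
    rw [Matrix.conjTranspose_eq_transpose_of_trivial] at h1
    obtain ⟨f, hf⟩ := exists_eq_sum_vecMulVec h1
    have h0 : A * R * Aᵀ = 0 := by
      rw [Matrix.mul_assoc, Matrix.mul_assoc, ← Matrix.mul_assoc A, hf, Finset.mul_sum,
        Matrix.trace_sum, Finset.sum_eq_zero_iff_of_nonneg fun i _ => by
          rw [Matrix.mul_vecMulVec, Matrix.trace_vecMulVec, dotProduct_comm]
          simpa using hR.posSemidef.dotProduct_mulVec_nonneg (f i)] at h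
      rw [hf]
      refine Finset.sum_eq_zero fun i hi => ?_
      have h2 := h i hi
      rw [Matrix.mul_vecMulVec, Matrix.trace_vecMulVec, dotProduct_comm] at h2
      have h3 : f i = 0 := by
        by_contra hne
        have := hR.dotProduct_mulVec_pos hne
        rw [star_trivial] at this
        exact this.ne' h2
      simp [h3]
    have h4 : ∀ v, Aᵀ *ᵥ v = 0 := by
      intro v
      by_contra hne
      have h5 := hR.dotProduct_mulVec_pos hne
      rw [star_trivial, Matrix.mulVec_mulVec, ← Matrix.vecMul_transpose, Matrix.transpose_transpose,
        ← Matrix.dotProduct_mulVec, Matrix.mulVec_mulVec, ← Matrix.mul_assoc, h0] at h5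
      simp at h5
    have h6 : Aᵀ = 0 := Matrix.ext_of_mulVec_single fun i => by rw [h4, Matrix.zero_mulVec]
    simpa using congrArg Matrix.transpose h6
  rcases hR with hR | hR
  · exact key hR h
  · exact key hR (by simpa using h)

namespace LabelModel

variable {k L : ℕ} {𝒴 : Type*} [MeasurableSpace 𝒴] (M : LabelModel k 𝒴)
  {S T A B : Matrix (Fin (k - 1)) (Fin (k - 1)) ℝ}

/-- The expected posterior covariance of a label given its covariates. -/
def postCov (S : Matrix (Fin (k - 1)) (Fin (k - 1)) ℝ) : Matrix (Fin (k - 1)) (Fin (k - 1)) ℝ :=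
  Matrix.of fun i j => bayes M.covRef M.covLik (gauss (M.gram S)
    (spread (Matrix.vecMulVec (fun a => M.emb a j) fun a => M.emb a i))) M.weight

lemma trace_postCov_mul (hS : S.PosSemidef) (T : Matrix (Fin (k - 1)) (Fin (k - 1)) ℝ) :
    (M.postCov S * T).trace
      = bayes M.covRef M.covLik (gauss (M.gram S) (spread (M.gram T))) M.weight := by
  have hK := M.gram_posSemidef hS
  have hl := isLik_gauss hK
  have e1 : M.gram T = ∑ i, ∑ j, T j i • Matrix.vecMulVec
      (fun a => M.emb a j) fun a => M.emb a i := by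
    ext a b
    simp only [gram_apply, Matrix.sum_apply, Matrix.smul_apply, Matrix.vecMulVec_apply,
      smul_eq_mul, dotProduct, Matrix.mulVec, Finset.mul_sum]
    rw [Finset.sum_comm]
    exact Finset.sum_congr rfl fun i _ => Finset.sum_congr rfl fun j _ => by ring
  have e2 : ∀ v, 0 ≤ v → gauss (M.gram S) (spread (M.gram T)) v = ∑ i, ∑ j, T j i *
      gauss (M.gram S) (spread (Matrix.vecMulVec (fun a => M.emb a j) fun a => M.emb a i)) v := by
    intro v hv
    rw [e1]
    simp only [funext (spread_sum _ _), spread_sum, spread_smul_left, gauss]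
    rw [bayes_sum _ hl (fun i _ => LinearGrowth.sum _ fun j _ =>
      (spread_linearGrowth _).const_mul _) hv]
    refine Finset.sum_congr rfl fun i _ => ?_
    rw [bayes_sum _ hl (fun j _ => (spread_linearGrowth _).const_mul _) hv]
    exact Finset.sum_congr rfl fun j _ => bayes_const_mul _
  have hlg : ∀ i j, LinearGrowth fun v => T j i * gauss (M.gram S)
      (spread (Matrix.vecMulVec (fun a => M.emb a j) fun a => M.emb a i)) v := fun i j =>
    ((spread_linearGrowth _).gauss hK).const_mul _
  rw [bayes_congr M.isLik_cov e2 M.weight_nonneg,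
    bayes_sum _ M.isLik_cov (fun i _ => LinearGrowth.sum _ fun j _ => hlg i j) M.weight_nonneg]
  refine Finset.sum_congr rfl fun i _ => ?_
  rw [bayes_sum _ M.isLik_cov (fun j _ => hlg i j) M.weight_nonneg, Matrix.diag_apply,
    Matrix.mul_apply]
  refine Finset.sum_congr rfl fun j _ => ?_
  rw [bayes_const_mul, postCov, Matrix.of_apply, mul_comm]

lemma dotProduct_postCov_mulVec (hS : S.PosSemidef) (v : Fin (k - 1) → ℝ) :
    v ⬝ᵥ M.postCov S *ᵥ v = bayes M.covRef M.covLik (gauss (M.gram S)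
      (spread (M.gram (Matrix.vecMulVec v v)))) M.weight := by
  rw [← M.trace_postCov_mul hS, Matrix.mul_vecMulVec, Matrix.trace_vecMulVec, dotProduct_comm]

lemma postCov_isHermitian (S : Matrix (Fin (k - 1)) (Fin (k - 1)) ℝ) :
    (M.postCov S).IsHermitian := by
  ext i j
  simp only [Matrix.conjTranspose_apply, star_trivial, postCov, Matrix.of_apply]
  congr 2
  ext u
  simp only [spread_vecMulVec, mul_comm]

lemma postCov_mem (hS : S.PosSemidef) : M.postCov S ∈ loewnerInterval (k - 1) := by
  have hK := M.gram_posSemidef hS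
  have hl := isLik_gauss hK
  constructor
  · refine .of_dotProduct_mulVec_nonneg (M.postCov_isHermitian S) fun v => ?_
    rw [star_trivial, M.dotProduct_postCov_mulVec hS]
    exact integral_nonneg fun ω => integral_nonneg fun ω' =>
      spread_nonneg (M.gram_posSemidef (posSemidef_vecMulVec_self v))
        (hl.mul_nonneg (M.isLik_cov.mul_nonneg M.weight_nonneg ω) ω')
  · refine .of_dotProduct_mulVec_nonneg
      (Matrix.isHermitian_one.sub (M.postCov_isHermitian S)) fun v => ?_
    have hV := M.gram_posSemidef (posSemidef_vecMulVec_self v)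
    have h1 : bayes M.covRef M.covLik (gauss (M.gram S)
        (spread (M.gram (Matrix.vecMulVec v v)))) M.weight
        ≤ ∑ a, M.weight a * M.gram (Matrix.vecMulVec v v) a a := by
      rw [← bayes_linear M.isLik_cov]
      refine bayes_mono M.isLik_cov ((spread_linearGrowth _).gauss hK) (LinearGrowth.linear _)
        (fun u hu => ?_) M.weight_nonneg
      rw [← bayes_linear hl]
      exact bayes_mono hl (spread_linearGrowth _) (LinearGrowth.linear _)
        (fun w hw => spread_le_diag hV hw) hu
    simp only [gram_apply, M.sum_weight_quadratic, Matrix.trace_vecMulVec] at h1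
    rw [star_trivial, Matrix.sub_mulVec, Matrix.one_mulVec, dotProduct_sub,
      M.dotProduct_postCov_mulVec hS]
    linarith

/-- A Gaussian observation gains at most half its signal variance. No smallness of `h` is required,
which lets the probe in the main theorem have a fixed strength. -/
lemma sub_le_nodeEnt_add_smul (hS : S.PosSemidef) (hT : T.PosSemidef) {h : ℝ} (hh : 0 ≤ h) :
    M.nodeEnt S - h / 2 * (M.postCov S * T).trace ≤ M.nodeEnt (S + h • T) := by
  have hK := M.gram_posSemidef hS
  have hKT := M.gram_posSemidef hT
  rw [M.trace_postCov_mul hS, ← bayes_const_mul, nodeEnt,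
    ← bayes_sub M.isLik_cov (ent_linearGrowth.gauss hK)
      (((spread_linearGrowth _).gauss hK).const_mul _) M.weight_nonneg, nodeEnt, gram_add, gram_smul]
  exact bayes_mono M.isLik_cov ((ent_linearGrowth.gauss hK).sub
    (((spread_linearGrowth _).gauss hK).const_mul _))
    (ent_linearGrowth.gauss (hK.add (hKT.smul hh)))
    (fun u hu => gauss_sub_le_gauss_add hK hKT hh hu) M.weight_nonneg

/-- The converse estimate, valid for small `h` only and with a quadratic error. It makes the
expansion in `sub_le_nodeEnt_add_smul` sharp to first order, as stationarity requires. -/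
lemma exists_nodeEnt_add_smul_le (hS : S.PosSemidef) (hT : T.PosSemidef) :
    ∃ C, 0 ≤ C ∧ ∀ h : ℝ, 0 ≤ h → 4 * (h * C) ≤ 1 → M.nodeEnt (S + h • T)
      ≤ M.nodeEnt S - h / 2 * (M.postCov S * T).trace + 16 * (h * C) ^ 2 := by
  have hK := M.gram_posSemidef hS
  have hKT := M.gram_posSemidef hT
  obtain ⟨C, hC0, hC⟩ := exists_abs_entry_le (M.gram T)
  refine ⟨C, hC0, fun h hh hh1 => ?_⟩
  have h0 := (ent_linearGrowth.gauss hK).sub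
    (((spread_linearGrowth (M.gram T)).gauss hK).const_mul (h / 2))
  have h1 : 16 * (h * C) ^ 2
      = bayes M.covRef M.covLik (fun u => 16 * (h * C) ^ 2 * ∑ a, u a) M.weight := by
    rw [bayes_const_mul, bayes_mass M.isLik_cov, M.sum_weight, mul_one]
  rw [M.trace_postCov_mul hS, ← bayes_const_mul, nodeEnt, gram_add, gram_smul, nodeEnt,
    ← bayes_sub M.isLik_cov (ent_linearGrowth.gauss hK)
      (((spread_linearGrowth _).gauss hK).const_mul _) M.weight_nonneg, h1,
    ← bayes_add M.isLik_cov h0 (LinearGrowth.mass.const_mul _) M.weight_nonneg]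
  exact bayes_mono M.isLik_cov (ent_linearGrowth.gauss (hK.add (hKT.smul hh)))
    (h0.add (LinearGrowth.mass.const_mul _))
    (fun u hu => gauss_add_le_gauss_sub hK hKT hC hh hh1 hu) M.weight_nonneg

/-- Gaussian side information has diminishing returns. -/
lemma nodeEnt_add_le (hS : S.PosSemidef) (hA : A.PosSemidef) (hB : B.PosSemidef) :
    M.nodeEnt (S + A) + M.nodeEnt (S + B) ≤ M.nodeEnt (S + A + B) + M.nodeEnt S := by
  have hK := M.gram_posSemidef hS
  have hKA := M.gram_posSemidef hA
  have hKB := M.gram_posSemidef hB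
  have hl := isLik_gauss hK
  have g := fun {K : Matrix (Fin k) (Fin k) ℝ} (h : K.PosSemidef) => ent_linearGrowth.gauss h
  simp only [nodeEnt, gram_add]
  rw [← bayes_add M.isLik_cov (g (hK.add hKA)) (g (hK.add hKB)) M.weight_nonneg,
    ← bayes_add M.isLik_cov (g ((hK.add hKA).add hKB)) (g hK) M.weight_nonneg]
  refine bayes_mono M.isLik_cov ((g (hK.add hKA)).add (g (hK.add hKB)))
    ((g ((hK.add hKA).add hKB)).add (g hK)) (fun u hu => ?_) M.weight_nonneg
  -- The observation at level `S` is made first, and `gauss_ent_add_le` is applied at each posterior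
  -- it produces.
  rw [add_assoc, gauss_add hK hKA ent_linearGrowth hu, gauss_add hK hKB ent_linearGrowth hu,
    gauss_add hK (hKA.add hKB) ent_linearGrowth hu]
  rw [show gauss (M.gram S) = bayes _ _ from rfl, ← bayes_add hl (g hKA) (g hKB) hu,
    ← bayes_add hl (g (hKA.add hKB)) ent_linearGrowth hu]
  exact bayes_mono hl ((g hKA).add (g hKB)) ((g (hKA.add hKB)).add ent_linearGrowth)
    (fun v hv => gauss_ent_add_le hKA hKB hv) hu

variable {R : Fin L → Matrix (Fin (k - 1)) (Fin (k - 1)) ℝ}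

/-- The potential is stationary at a minimizer: the minimizer is a fixed point of the map
sending a matrix to the posterior covariance at the corresponding level of side information. -/
lemma postCov_eq_of_isMinOn (hL : 1 ≤ L) (hR : ∀ ℓ, (R ℓ).PosDef ∨ (-R ℓ).PosDef)
    {U : Matrix (Fin (k - 1)) (Fin (k - 1)) ℝ} (hU : U ∈ loewnerInterval (k - 1))
    (hmin : IsMinOn (M.potential R 0) (loewnerInterval (k - 1)) U) :
    M.postCov (∑ ℓ, R ℓ * (1 - U) * R ℓ) = U := by
  have hRs := fun ℓ => isSymm_of_definite (hR ℓ)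
  have hΔ := sum_conj_posSemidef hRs hU.2
  set Δ := ∑ ℓ, R ℓ * (1 - U) * R ℓ with hΔdef
  have hP := M.postCov_mem hΔ
  set P := M.postCov Δ with hPdef
  have hD := sum_conj_posSemidef hRs hU.1
  have hD' := sum_conj_posSemidef hRs hP.1
  set D := ∑ ℓ, R ℓ * U * R ℓ with hDdef
  set D' := ∑ ℓ, R ℓ * P * R ℓ with hD'def
  set H := P - U with hH
  have hHs : Hᵀ = H := by
    simpa [Matrix.IsHermitian, hH] using hP.1.isHermitian.sub hU.1.isHermitian
  obtain ⟨C, hC0, hC⟩ := M.exists_nodeEnt_add_smul_le hΔ (hD.add hD')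
  -- The right-hand side is `-2` times the slope of the potential at `U` in the direction `H`.
  have hsum : ∑ ℓ, (R ℓ * H * R ℓ * Hᵀ).trace = (P * D').trace - (P * D).trace
      - ∑ ℓ, (U * R ℓ * H * R ℓ).trace := by
    rw [hDdef, hD'def, Finset.mul_sum, Finset.mul_sum, Matrix.trace_sum, Matrix.trace_sum,
      ← Finset.sum_sub_distrib, ← Finset.sum_sub_distrib]
    refine Finset.sum_congr rfl fun ℓ _ => ?_
    rw [hHs, Matrix.trace_mul_comm]
    nth_rewrite 1 [hH]
    rw [← Matrix.trace_sub, ← Matrix.trace_sub]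
    congr 1
    rw [hH]
    noncomm_ring
  have hnonneg : ∀ ℓ, 0 ≤ (R ℓ * H * R ℓ * Hᵀ).trace := fun ℓ => trace_definite_nonneg (hR ℓ) H
  -- The first order condition on the segment from `U` to `P`, which stays in the convex set of
  -- admissible matrices.
  have key : ∀ s : ℝ, 0 < s → s ≤ 1 → 4 * (s * C) ≤ 1 →
      ∑ ℓ, (R ℓ * H * R ℓ * Hᵀ).trace
        ≤ s * (32 * C ^ 2 + 1 / 2 * ∑ ℓ, (R ℓ * H * R ℓ * Hᵀ).trace) := by
    intro s hs hs1 hsC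
    have h1s : 0 ≤ 1 - s := by linarith
    have hV : (1 - s) • U + s • P ∈ loewnerInterval (k - 1) := by
      refine ⟨(hU.1.smul h1s).add (hP.1.smul hs.le), ?_⟩
      convert (hU.2.smul h1s).add (hP.2.smul hs.le) using 1
      rw [smul_sub, smul_sub, sub_smul]
      simp only [sub_smul, one_smul]
      abel
    have hΔV := sum_conj_posSemidef hRs hV.2
    set V := (1 - s) • U + s • P with hVdef
    have hVH : V = U + s • H := by
      rw [hVdef, hH, sub_smul, smul_sub, one_smul]
      abel
    set ΔV := ∑ ℓ, R ℓ * (1 - V) * R ℓ with hΔVdef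
    -- The difference of `ΔV` and `Δ` has no sign, whereas entropies are only compared along
    -- positive semidefinite increments. Both levels are therefore compared with a common higher
    -- one.
    have hshift : ΔV + s • D' = Δ + s • D := by
      rw [hΔVdef, hD'def, hΔdef, hDdef, Finset.smul_sum, Finset.smul_sum, ← Finset.sum_add_distrib,
        ← Finset.sum_add_distrib]
      refine Finset.sum_congr rfl fun ℓ _ => ?_
      rw [hVH, hH]
      simp only [Matrix.mul_sub, Matrix.sub_mul, Matrix.mul_add, Matrix.add_mul, smul_sub,
        Matrix.mul_smul, Matrix.smul_mul]
      abel
    -- Diminishing returns bound the entropy at `ΔV` below by twice that at `Δ + s D` minus that at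
    -- `Δ + s (D + D')`. Both are levels above `Δ`, where the expansions `h2` and `h3` apply.
    have h1 := M.nodeEnt_add_le hΔV (hD'.smul hs.le) (hD'.smul hs.le)
    rw [hshift, add_assoc Δ, ← smul_add] at h1
    have h2 := M.sub_le_nodeEnt_add_smul hΔ hD hs.le
    have h3 := hC s hs.le hsC
    have h4 : M.potential R 0 U ≤ M.potential R 0 V := hmin hV
    simp only [potential, zero_add] at h4
    rw [← hΔdef, ← hΔVdef, M.info_eq hΔ, M.info_eq hΔV] at h4
    rw [Matrix.mul_add, Matrix.trace_add, ← hPdef] at h3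
    have h5 : ∑ ℓ, ((R ℓ * V) ^ 2).trace = ∑ ℓ, ((R ℓ * U) ^ 2).trace
        + 2 * s * ∑ ℓ, (U * R ℓ * H * R ℓ).trace
        + s ^ 2 * ∑ ℓ, (R ℓ * H * R ℓ * Hᵀ).trace := by
      rw [Finset.mul_sum, Finset.mul_sum, ← Finset.sum_add_distrib, ← Finset.sum_add_distrib]
      refine Finset.sum_congr rfl fun ℓ _ => ?_
      have e : (R ℓ * V) ^ 2 = (R ℓ * U) ^ 2 + s • (R ℓ * (U * R ℓ * H)) + s • (R ℓ * H * R ℓ * U)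
          + s ^ 2 • (R ℓ * H * R ℓ * H) := by
        rw [hVH, sq, sq, sq]
        simp only [Matrix.mul_add, Matrix.add_mul, Matrix.mul_smul, Matrix.smul_mul,
          Matrix.mul_assoc, smul_smul, smul_add]
        abel
      rw [e, Matrix.trace_add, Matrix.trace_add, Matrix.trace_add, Matrix.trace_smul,
        Matrix.trace_smul, Matrix.trace_smul, Matrix.trace_mul_comm (R ℓ),
        Matrix.trace_mul_comm _ U, hHs]
      simp only [smul_eq_mul, Matrix.mul_assoc]
      ring
    rw [h5] at h4
    have h6 : s * ∑ ℓ, (R ℓ * H * R ℓ * Hᵀ).trace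
        ≤ s * (s * (32 * C ^ 2 + 1 / 2 * ∑ ℓ, (R ℓ * H * R ℓ * Hᵀ).trace)) := by
      nlinarith
    exact le_of_mul_le_mul_left h6 hs
  have hzero : ∑ ℓ, (R ℓ * H * R ℓ * Hᵀ).trace ≤ 0 := by
    have ht : Tendsto (fun s : ℝ => s * (32 * C ^ 2 + 1 / 2 * ∑ ℓ, (R ℓ * H * R ℓ * Hᵀ).trace))
        (𝓝[>] 0) (𝓝 0) := by
      have : Tendsto (fun s : ℝ => s * (32 * C ^ 2 + 1 / 2 * ∑ ℓ, (R ℓ * H * R ℓ * Hᵀ).trace))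
        (𝓝 0) (𝓝 (0 * _)) := tendsto_id.mul_const _
      rw [zero_mul] at this
      exact this.mono_left nhdsWithin_le_nhds
    have hC1 : ∀ᶠ s : ℝ in 𝓝 0, 4 * (s * C) < 1 := by
      have : Tendsto (fun s : ℝ => 4 * (s * C)) (𝓝 0) (𝓝 (4 * (0 * C))) :=
        (tendsto_id.mul_const C).const_mul 4
      exact this.eventually_lt_const (by simp)
    refine ge_of_tendsto ht ?_
    filter_upwards [self_mem_nhdsWithin, mem_nhdsWithin_of_mem_nhds (Iic_mem_nhds one_pos),
      mem_nhdsWithin_of_mem_nhds hC1] with s h1 h2 h3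
    exact key s h1 h2 h3.le
  -- All summands are nonnegative and their sum is zero. A single network, which `1 ≤ L` provides,
  -- forces `H = 0`.
  have h0 := (Finset.sum_eq_zero_iff_of_nonneg fun ℓ _ => hnonneg ℓ).1
    (hzero.antisymm (Finset.sum_nonneg fun ℓ _ => hnonneg ℓ)) ⟨0, hL⟩ (Finset.mem_univ _)
  exact sub_eq_zero.1 (eq_zero_of_trace_eq_zero (hR _) h0)

end LabelModel

/-! ### Probing the networks with rank-one side information -/

open scoped MatrixOrder Matrix.Norms.L2Operator in
lemma exists_pos_sub_smul_one {m : ℕ} {S : Matrix (Fin m) (Fin m) ℝ} (hS : S.PosDef) :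
    ∃ c : ℝ, 0 < c ∧ (S - c • (1 : Matrix (Fin m) (Fin m) ℝ)).PosSemidef := by
  have h := hS.isStrictlyPositive
  rcases subsingleton_or_nontrivial (Matrix (Fin m) (Fin m) ℝ) with hs | hs
  · exact ⟨1, one_pos, by rw [Subsingleton.elim (S - _) 0]; exact Matrix.PosSemidef.zero⟩
  obtain ⟨r, hr, hle⟩ := (CFC.exists_pos_algebraMap_le_iff h.isSelfAdjoint).2
    fun x hx => h.spectrum_pos (𝕜 := ℝ) hx
  refine ⟨r, hr, ?_⟩
  rw [Algebra.algebraMap_eq_smul_one] at hle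
  exact hle

/-- Cauchy-Schwarz: `ε vvᵀ ⪯ ε |v|² 1 ⪯ c 1 ⪯ S`. -/
lemma posSemidef_sub_vecMulVec {m : ℕ} {S : Matrix (Fin m) (Fin m) ℝ} (hS : S.PosSemidef) {c ε : ℝ}
    (hc : (S - c • (1 : Matrix (Fin m) (Fin m) ℝ)).PosSemidef) {v : Fin m → ℝ} (hε : 0 ≤ ε)
    (h : ε * (v ⬝ᵥ v) ≤ c) : (S - ε • Matrix.vecMulVec v v).PosSemidef := by
  refine .of_dotProduct_mulVec_nonneg
    (hS.isHermitian.sub ((posSemidef_vecMulVec_self v).smul hε).isHermitian) fun w => ?_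
  have h1 := hc.dotProduct_mulVec_nonneg w
  rw [star_trivial, Matrix.sub_mulVec, dotProduct_sub, Matrix.smul_mulVec, Matrix.one_mulVec,
    dotProduct_smul, smul_eq_mul] at h1
  rw [star_trivial, Matrix.sub_mulVec, dotProduct_sub, Matrix.smul_mulVec, dotProduct_smul,
    Matrix.vecMulVec_mulVec, op_smul_eq_smul, dotProduct_smul, smul_eq_mul, smul_eq_mul]
  have h2 : (v ⬝ᵥ w) * (w ⬝ᵥ v) ≤ (v ⬝ᵥ v) * (w ⬝ᵥ w) := by
    have := Finset.sum_mul_sq_le_sq_mul_sq Finset.univ v w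
    rw [dotProduct_comm w v, ← sq]
    simpa only [dotProduct, sq] using this
  have h3 : 0 ≤ w ⬝ᵥ w := Finset.sum_nonneg fun i _ => mul_self_nonneg _
  have h4 := mul_le_mul_of_nonneg_left h2 hε
  have h5 := mul_le_mul_of_nonneg_right h h3
  linarith

lemma posSemidef_of_forall_le {m : ℕ} {A B : Matrix (Fin m) (Fin m) ℝ} (hA : A.IsSymm)
    (hB : B.IsSymm) (h : ∀ v, v ⬝ᵥ B *ᵥ v ≤ v ⬝ᵥ A *ᵥ v) : (A - B).PosSemidef := by
  refine .of_dotProduct_mulVec_nonneg ?_ fun v => ?_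
  · rw [Matrix.IsHermitian, Matrix.conjTranspose_eq_transpose_of_trivial, Matrix.transpose_sub,
      hA, hB]
  · rw [star_trivial, Matrix.sub_mulVec, dotProduct_sub]
    exact sub_nonneg.2 (h v)

namespace LabelModel

variable {k L : ℕ} {𝒴 : Type*} [MeasurableSpace 𝒴] (M : LabelModel k 𝒴)
  (d : Fin L → ℕ → ℝ) (R : Fin L → Matrix (Fin (k - 1)) (Fin (k - 1)) ℝ) (n : ℕ)
  {S : Matrix (Fin (k - 1)) (Fin (k - 1)) ℝ}

lemma ent_prior : ent (M.prior n) = n * ent M.weight := by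
  refine (ent_prod (ι := Fin n) fun _ => M.weight).trans ?_
  simp [M.sum_weight]

/-- The mean posterior variance is at most the prior second moment, and whitening makes the latter
the identity. This handles the values of `n` that escape the asymptotic bound. -/
lemma dotProduct_mmse_mulVec_le (hS : S.PosSemidef) (v : Fin (k - 1) → ℝ) :
    v ⬝ᵥ M.mmse d R n S *ᵥ v ≤ v ⬝ᵥ v := by
  have hK := M.nodesGram_posSemidef n hS
  have hV := M.nodesGram_posSemidef n (posSemidef_vecMulVec_self v)
  have h := M.base_mono d R n ((spread_linearGrowth (M.nodesGram n (Matrix.vecMulVec v v))).gauss hK)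
    (LinearGrowth.linear fun x => M.nodesGram n (Matrix.vecMulVec v v) x x) fun u hu => by
      rw [← bayes_linear (isLik_gauss hK)]
      exact bayes_mono (isLik_gauss hK) (spread_linearGrowth _) (LinearGrowth.linear _)
        (fun w hw => spread_le_diag hV hw) hu
  rw [base_linear, sum_prior_nodesGram, Matrix.trace_vecMulVec] at h
  rw [M.dotProduct_mmse_mulVec d R n hS]
  have hv : 0 ≤ v ⬝ᵥ v := Finset.sum_nonneg fun i _ => mul_self_nonneg _
  rcases n.eq_zero_or_pos with rfl | hn
  · simpa using hv
  have hn' : (0 : ℝ) < n := by exact_mod_cast hn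
  refine (mul_le_mul_of_nonneg_left h (by positivity)).trans_eq ?_
  field_simp

/-- Side information that is dominated by `S` decreases the entropy at least at the rate of the
MMSE at `S`. -/
lemma mmse_le_base_ent_sub {ε : ℝ} (hε : 0 ≤ ε) (hn : 0 < n) {v : Fin (k - 1) → ℝ}
    (hS : (S - ε • Matrix.vecMulVec v v).PosSemidef) :
    ε / 2 * (n * (v ⬝ᵥ M.mmse d R n S *ᵥ v))
      ≤ M.base d R n ent - M.base d R n (gauss (M.nodesGram n (ε • Matrix.vecMulVec v v)) ent) := by
  have hV := posSemidef_vecMulVec_self v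
  have hSV : S = ε • Matrix.vecMulVec v v + (S - ε • Matrix.vecMulVec v v) := by abel
  have hS0 : S.PosSemidef := by
    rw [hSV]
    exact (hV.smul hε).add hS
  have hKε := M.nodesGram_posSemidef n (hV.smul hε)
  have hKV := M.nodesGram_posSemidef n hV
  have hK' := M.nodesGram_posSemidef n hS
  have hK := M.nodesGram_posSemidef n hS0
  have hn' : (0 : ℝ) < n := by exact_mod_cast hn
  rw [M.dotProduct_mmse_mulVec d R n hS0, ← mul_assoc (n : ℝ), mul_one_div_cancel hn'.ne', one_mul,
    ← base_const_mul, ← M.base_sub d R n ent_linearGrowth (ent_linearGrowth.gauss hKε)]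
  refine M.base_mono d R n (((spread_linearGrowth _).gauss hK).const_mul _)
    (ent_linearGrowth.sub (ent_linearGrowth.gauss hKε)) fun u hu => ?_
  -- The probe gains at least half the spread that remains after it (`h1`), and the rest of `S` can
  -- only decrease that spread (`h2`).
  have h1 := gauss_spread_le hKε hu
  have h2 := gauss_spread_le_of_add hKε hK' hKV hu
  rw [← nodesGram_add, ← hSV] at h2
  have h3 : gauss (M.nodesGram n (ε • Matrix.vecMulVec v v))
      (spread (M.nodesGram n (ε • Matrix.vecMulVec v v))) u
      = ε * gauss (M.nodesGram n (ε • Matrix.vecMulVec v v))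
        (spread (M.nodesGram n (Matrix.vecMulVec v v))) u := by
    rw [gauss, ← bayes_const_mul]
    refine congrArg (bayes _ _ · u) (funext fun w => ?_)
    rw [nodesGram_smul, spread_smul_left]
  rw [h3] at h1
  have h4 := mul_le_mul_of_nonneg_left h2 hε
  linarith

end LabelModel

end CommunityDetection

end

open CommunityDetection in
theorem theorem2 {k L : ℕ} (hL : 1 ≤ L) {𝒴 : Type*} [MeasurableSpace 𝒴] (M : LabelModel k 𝒴)
    (d : Fin L → ℕ → ℝ) (R : Fin L → Matrix (Fin (k - 1)) (Fin (k - 1)) ℝ)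
    (hd : ∀ ℓ, Tendsto (d ℓ) atTop atTop ∧ Tendsto (fun n : ℕ => (n : ℝ) - d ℓ n) atTop atTop)
    (hR : ∀ ℓ, (R ℓ).PosDef ∨ (-R ℓ).PosDef)
    (htight : Tendsto (fun n : ℕ => 1 / (n : ℝ) * M.networkInfo d R n) atTop
      (𝓝 (sInf (M.potential R 0 '' loewnerInterval (k - 1)))))
    (S : Matrix (Fin (k - 1)) (Fin (k - 1)) ℝ) (hS : S.PosDef)
    (Ustar : Matrix (Fin (k - 1)) (Fin (k - 1)) ℝ)
    (hU : Ustar ∈ loewnerInterval (k - 1))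
    (hmin : IsMinOn (M.potential R 0) (loewnerInterval (k - 1)) Ustar) :
    ∃ E : ℕ → Matrix (Fin (k - 1)) (Fin (k - 1)) ℝ,
      (∀ n, (E n).IsSymm) ∧ Tendsto E atTop (𝓝 0) ∧
        ∀ n, (Ustar + E n - M.mmse d R n S).PosSemidef := by
  obtain ⟨err, herr, hlow⟩ := M.exists_le_base_gauss_ent hd hR hU
  obtain ⟨c, hc, hSc⟩ := exists_pos_sub_smul_one hS
  have hfix := M.postCov_eq_of_isMinOn hL hR hU hmin
  have hΔ := LabelModel.sum_conj_posSemidef (fun ℓ => isSymm_of_definite (hR ℓ)) hU.2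
  set Δ := ∑ ℓ, R ℓ * (1 - Ustar) * R ℓ with hΔdef
  set q := 1 / 4 * ∑ ℓ, ((R ℓ * Ustar) ^ 2).trace with hq
  have hF : sInf (M.potential R 0 '' loewnerInterval (k - 1))
      = ent M.weight - M.nodeEnt Δ + q := by
    rw [IsLeast.csInf_eq ⟨Set.mem_image_of_mem _ hU, Set.forall_mem_image.2 fun V hV => hmin hV⟩,
      LabelModel.potential, zero_add, M.info_eq hΔ]
  rw [hF] at htight
  set gap : ℕ → ℝ := fun n => ent M.weight - M.nodeEnt Δ + q - 1 / (n : ℝ) * M.networkInfo d R n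
    with hgap
  have hgap0 : Tendsto gap atTop (𝓝 0) := by
    simpa [hgap] using htight.const_sub (ent M.weight - M.nodeEnt Δ + q)
  have hUs : Ustar.IsSymm := by simpa [Matrix.IsHermitian, Matrix.IsSymm] using hU.1.isHermitian
  have hev : ∀ᶠ n : ℕ in atTop, (Ustar + (2 / c * |gap n + err n|) •
      (1 : Matrix (Fin (k - 1)) (Fin (k - 1)) ℝ) - M.mmse d R n S).PosSemidef := by
    filter_upwards [eventually_gt_atTop 0, hlow] with n hn hlow
    have hn' : (0 : ℝ) < n := by exact_mod_cast hn
    refine posSemidef_of_forall_le (hUs.add (Matrix.isSymm_one.smul _))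
      (M.mmse_isSymm d R n hS.posSemidef) fun v => ?_
    rcases eq_or_ne v 0 with rfl | hv
    · simp
    have hvv : 0 < v ⬝ᵥ v := by simpa using Matrix.dotProduct_star_self_pos_iff.2 hv
    -- The strongest probe along `v` that `S ⪰ c • 1` guarantees. Since `ε |v|² = c`, the final
    -- error is the same multiple of `|v|²` for every `v`.
    have hε : 0 < c / (v ⬝ᵥ v) := div_pos hc hvv
    set ε := c / (v ⬝ᵥ v) with hεdef
    have hV := posSemidef_vecMulVec_self v
    have h1 := M.mmse_le_base_ent_sub d R n hε.le hn
      (posSemidef_sub_vecMulVec hS.posSemidef hSc hε.le (div_mul_cancel₀ c hvv.ne').le)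
    have h2 := hlow (hV.smul hε.le)
    have h3 := M.sub_le_nodeEnt_add_smul hΔ hV hε.le
    rw [hfix, Matrix.mul_vecMulVec, Matrix.trace_vecMulVec, dotProduct_comm] at h3
    -- The definition of `gap`, rewritten for the entropy without probe. Tightness enters through
    -- `gap → 0`.
    have h4 : M.base d R n ent = n * (M.nodeEnt Δ - q + gap n) := by
      have := M.networkInfo_eq d R n
      rw [M.ent_prior] at this
      rw [hgap]
      field_simp
      linarith
    rw [add_comm _ Δ] at h2
    have h5 : n * (ε / 2 * (v ⬝ᵥ M.mmse d R n S *ᵥ v))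
        ≤ n * (ε / 2 * (v ⬝ᵥ Ustar *ᵥ v) + (gap n + err n)) := by
      have := mul_le_mul_of_nonneg_left h3 hn'.le
      rw [h4] at h1
      linarith
    have h6 := le_of_mul_le_mul_left h5 hn'
    have h7 : ε / 2 * (2 / c * |gap n + err n| * (v ⬝ᵥ v)) = |gap n + err n| := by
      rw [hεdef]
      field_simp
    rw [Matrix.add_mulVec, dotProduct_add, Matrix.smul_mulVec, Matrix.one_mulVec, dotProduct_smul,
      smul_eq_mul]
    refine le_of_mul_le_mul_left (h6.trans ?_) (half_pos hε)
    rw [mul_add, h7]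
    gcongr
    exact le_abs_self _
  classical
  -- The bound `hev` holds only eventually. At an exceptional `n` the value 1 suffices, because the
  -- MMSE matrix is at most the identity and `Ustar` is positive semidefinite.
  set t : ℕ → ℝ := fun n => if (Ustar + (2 / c * |gap n + err n|) •
      (1 : Matrix (Fin (k - 1)) (Fin (k - 1)) ℝ) - M.mmse d R n S).PosSemidef
    then 2 / c * |gap n + err n| else 1 with ht
  have ht0 : Tendsto t atTop (𝓝 0) := by
    have h : Tendsto (fun n => 2 / c * |gap n + err n|) atTop (𝓝 0) := by
      simpa using (hgap0.add herr).abs.const_mul (2 / c)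
    refine h.congr' ?_
    filter_upwards [hev] with n hn
    exact (if_pos hn).symm
  refine ⟨fun n => t n • 1, fun n => Matrix.isSymm_one.smul _, ?_, fun n => ?_⟩
  · simpa using ht0.smul_const (1 : Matrix (Fin (k - 1)) (Fin (k - 1)) ℝ)
  · by_cases h : (Ustar + (2 / c * |gap n + err n|) •
      (1 : Matrix (Fin (k - 1)) (Fin (k - 1)) ℝ) - M.mmse d R n S).PosSemidef
    · simpa only [ht, if_pos h] using h
    · simp only [ht, if_neg h, one_smul]
      refine posSemidef_of_forall_le (hUs.add Matrix.isSymm_one)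
        (M.mmse_isSymm d R n hS.posSemidef) fun v => ?_
      have h1 := M.dotProduct_mmse_mulVec_le d R n hS.posSemidef v
      have h2 := hU.1.dotProduct_mulVec_nonneg v
      rw [star_trivial] at h2
      rw [Matrix.add_mulVec, dotProduct_add, Matrix.one_mulVec]
      linarith
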